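/- Let $K=C-\tfrac12\subset\mathbb R\subset\mathbb C$, with $C$ the triadic Cantor set. Let $\lambda_k>0$ satisfy $\sum_k 2^k\lambda_k=1$ and $\sum_k\lambda_k(2\kappa)^k<\infty$ for some $\kappa>3$. For each $k\ge 0$ let $x_{k,1},\dots,x_{k,2^k}$ be distinct end-points of the stage-$k$ intervals of the construction of $K$, such that every end-point of a removed interval is some $x_{k,l}$. Put $\nu=\sum_k\lambda_k\sum_l\delta_{x_{k,l}}$, $f(z)=\frac1{2\pi i}\int\frac{d\nu(t)}{z-t}$ and $F=\int_0 f$ (multivalued on $\mathbb C-K$). Let $G_1\subset K$ be the set of $x\in K$ for which $F$, restricted to the two open half-lines of $(x+i\mathbb R)-\{x\}$ (a branch on each), extends continuously to $x+i\mathbb R$. *Sheets.* Let $\mathcal S_\nu$ be $\mathbb C-K$ with the log-euclidean length distance given by $|f(z)|\,|dz|$, $\tilde{\mathcal S}_\nu$ its universal covering (homotopy classes of paths from $0$) with the lifted length distance, and $\mathcal S_\nu^*,\tilde{\mathcal S}_\nu^*$ their Cauchy completions. For $x\in G_1$, the tip of $\mathcal S^*_\nu$ over $x$ is $\lim_{y\to0}(x+iy)$.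 For $g\in\pi_1(\mathbb C-K,0)$, the upper (lower) tip of $\tilde{\mathcal S}_\nu^*$ over $x$ with label $g$ is the limit as $y\to0^+$ ($y\to 0^-$) of the class of $g$ followed by the segment $[0,x+iy]$. If $x=-\frac12+\sum_{n\ge1}2b_n3^{-n}$ with $(b_n)\in\{0,1\}^{\mathbb N}$ not eventually constant, the Green angle landing at $x$ from the upper half-plane is $\theta=\frac12\bigl(1-\sum_n b_n2^{-n}\bigr)\in\mathbb R/\mathbb Z$, and $-\theta$ lands at $x$ from the lower half-plane; $x=\sigma(\pm\theta)$. Let $A=\sigma^{-1}(G_1)$. *Riemanniums.* $\hat C^r_\nu$ consists of copies of $\mathcal S_\nu^*$ indexed by the finite sequences in $A$, the copies $\boldsymbol\theta$ and $(\boldsymbol\theta,\theta)$ being glued at their tips over $\sigma(\theta)$. $\check C^r_\nu$ consists of copies of $\tilde{\mathcal S}_\nu^*$ indexed by the finite sequences $\boldsymbol\theta$ in $\pi_1(\mathbb C-K,0)\times A$: the tip over $\sigma(\theta)$ with label $g$ on the side of $\theta$ in the copy $\boldsymbol\theta$ is identified with the tip over $\sigma(\theta)$ with label $g$ on the opposite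 side in the copy $(\boldsymbol\theta,(g,\theta))$. Let $M(\boldsymbol\theta)$ be the Borel monodromy of $F$ along a path of $\check C^r_\nu$ from the point over $0$ (class of the constant path) of the principal copy to that of the copy $\boldsymbol\theta$; it is the sum over the terms $(g,\theta)$ of $\boldsymbol\theta$ of the monodromies of the loops that go from $0$ to $\sigma(\theta)$ on the side of $\theta$ and come back on the other side. $\tilde C^r_\nu$ is the quotient of $\check C^r_\nu$ in which the copies $\boldsymbol\theta,\boldsymbol\theta'$ are identified pointwise whenever $M(\boldsymbol\theta)=M(\boldsymbol\theta')$. All these spaces carry the log-euclidean length distance (the gluing distance induced by that of the sheets). **Proposition.** $\hat C^r_\nu$ and $\tilde C^r_\nu$ are not complete. More precisely, in each of the two spaces there is a sequence $(P_n)$ of regular points, lying over points of $\mathbb C-K$ that are alternately in the upper and in the lower half-plane and converge to a point of $G_1$, such that $\sum_n d(P_n,P_{n+1})<\infty$ (so it is a Cauchy sequence) and $(P_n)$ has no limit in the space. -/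

import Mathlib

open Set Filter Topology MeasureTheory
open scoped ENNReal

noncomputable section

namespace CantorRiemannium

section Generic

/-! ### Length distances, Cauchy completions and gluings of (extended, pseudo-) metric spaces -/

/-- `ChainOfCost c x y l`: there is a finite chain of steps from `x` to `y` of total cost `l`, where
a step between `u` and `v` (in either direction) costs `c u v` or `c v u`. -/
inductive ChainOfCost {X : Type*} (c : X → X → ℝ≥0∞) : X → X → ℝ≥0∞ → Prop
  | refl (x : X) : ChainOfCost c x x 0
  | step {x y z : X} {l : ℝ≥0∞} (h : ChainOfCost c x y l) :
      ChainOfCost c x z (l + min (c y z) (c z y))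

theorem ChainOfCost.trans {X : Type*} {c : X → X → ℝ≥0∞} {x y z : X} {l m : ℝ≥0∞}
    (h : ChainOfCost c x y l) (k : ChainOfCost c y z m) : ChainOfCost c x z (l + m) := by
  induction k with
  | refl => simpa using h
  | step _ ih => rw [← add_assoc]; exact ih.step

theorem ChainOfCost.symm {X : Type*} {c : X → X → ℝ≥0∞} {x y : X} {l : ℝ≥0∞}
    (h : ChainOfCost c x y l) : ChainOfCost c y x l := by
  induction h with
  | refl => exact .refl _
  | @step y z l _ ih =>
    have h1 : ChainOfCost c z y (0 + min (c z y) (c y z)) := (ChainOfCost.refl z).step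
    have h2 := h1.trans ih
    rwa [zero_add, min_comm, add_comm] at h2

/-- The extended pseudo-distance `inf (total cost of a chain from x to y)`. -/
@[reducible] def chainPseudoEMetric {X : Type*} (c : X → X → ℝ≥0∞) : PseudoEMetricSpace X where
  edist x y := ⨅ (l : ℝ≥0∞) (_ : ChainOfCost c x y l), l
  edist_self x := le_antisymm (iInf₂_le 0 (ChainOfCost.refl x)) zero_le
  edist_comm x y := le_antisymm
    (le_iInf₂ fun l h => iInf₂_le l h.symm) (le_iInf₂ fun l h => iInf₂_le l h.symm)
  edist_triangle x y z := by
    refine ENNReal.le_of_forall_pos_le_add fun ε hε hlt => ?_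
    have hε2 : (0 : ℝ≥0∞) < (ε / 2 : NNReal) := by
      rw [ENNReal.coe_pos]; exact half_pos hε
    obtain ⟨h1, h2⟩ := ENNReal.add_lt_top.mp hlt
    have e1 := ENNReal.lt_add_right h1.ne hε2.ne'
    have e2 := ENNReal.lt_add_right h2.ne hε2.ne'
    simp only [iInf_lt_iff] at e1 e2
    obtain ⟨l, hl, hl'⟩ := e1
    obtain ⟨m, hm, hm'⟩ := e2
    have hsum : (ε : ℝ≥0∞) = (ε / 2 : NNReal) + (ε / 2 : NNReal) := by
      rw [← ENNReal.coe_add, add_halves]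
    calc (⨅ (l : ℝ≥0∞) (_ : ChainOfCost c x z l), l) ≤ l + m := iInf₂_le _ (hl.trans hm)
      _ ≤ _ := add_le_add hl'.le hm'.le
      _ = _ := by rw [hsum]; exact add_add_add_comm _ _ _ _

/-- Cauchy sequences of an extended pseudo-metric space. -/
structure CauchySeqs (X : Type*) [PseudoEMetricSpace X] where
  seq : ℕ → X
  cauchy : CauchySeq seq

/-- The distance of two Cauchy sequences, `lim d(uₙ, vₙ)`. -/
instance (X : Type*) [PseudoEMetricSpace X] : PseudoEMetricSpace (CauchySeqs X) where
  edist u v := limsup (fun n => edist (u.seq n) (v.seq n)) atTop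
  edist_self u := by simp
  edist_comm u v := by simp only [edist_comm]
  edist_triangle u v w := by
    refine ENNReal.le_of_forall_pos_le_add fun ε hε hlt => ?_
    have hε2 : (0 : ℝ≥0∞) < (ε / 2 : NNReal) := by
      rw [ENNReal.coe_pos]; exact half_pos hε
    obtain ⟨h1, h2⟩ := ENNReal.add_lt_top.mp hlt
    have e1 := eventually_lt_of_limsup_lt (ENNReal.lt_add_right h1.ne hε2.ne')
    have e2 := eventually_lt_of_limsup_lt (ENNReal.lt_add_right h2.ne hε2.ne')
    have hsum : (ε : ℝ≥0∞) = (ε / 2 : NNReal) + (ε / 2 : NNReal) := by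
      rw [← ENNReal.coe_add, add_halves]
    rw [hsum, ← add_add_add_comm]
    refine limsup_le_of_le (h := ?_)
    filter_upwards [e1, e2] with n hn1 hn2
    exact (edist_triangle _ (v.seq n) _).trans (add_le_add hn1.le hn2.le)

/-- The Cauchy completion: Cauchy sequences modulo sequences at distance `0`. -/
abbrev CauchyCompletion (X : Type*) [PseudoEMetricSpace X] : Type _ :=
  SeparationQuotient (CauchySeqs X)

/-- The canonical map into the completion. -/
def toCompletion {X : Type*} [PseudoEMetricSpace X] (x : X) : CauchyCompletion X :=
  SeparationQuotient.mk ⟨fun _ => x, cauchySeq_const x⟩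

/-- Disjoint copies of `X` indexed by `ι`; distinct copies are at infinite distance. -/
structure Copies (ι X : Type*) where
  index : ι
  pt : X

open Classical in
instance (ι X : Type*) [PseudoEMetricSpace X] : PseudoEMetricSpace (Copies ι X) where
  edist P Q := if P.index = Q.index then edist P.pt Q.pt else ⊤
  edist_self P := by simp
  edist_comm P Q := by simp only [edist_comm, eq_comm]
  edist_triangle P Q R := by
    by_cases h1 : P.index = Q.index
    · by_cases h2 : Q.index = R.index
      · simpa [h1, h2] using edist_triangle P.pt Q.pt R.pt
      · simp [h2]
    · simp [h1]

/-- The quotient of `X` by the equivalence relation generated by `r`. -/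
def Glued {X : Type*} (r : X → X → Prop) : Type _ := Quot r

/-- The quotient map. -/
def Glued.mk {X : Type*} (r : X → X → Prop) (x : X) : Glued r := Quot.mk r x

/-- The gluing distance: the infimum of the total length of the chains that move inside `X` and jump
at no cost between identified points.  If `X` carries a length distance, so does the quotient. -/
instance {X : Type*} [PseudoEMetricSpace X] (r : X → X → Prop) : PseudoEMetricSpace (Glued r) :=
  chainPseudoEMetric fun P Q =>
    ⨅ (x : X) (y : X) (_ : Glued.mk r x = P) (_ : Glued.mk r y = Q), edist x y

end Generic

/-! ### The Cantor set, the measure and its Cauchy transform -/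

/-- The triadic Cantor set translated by `-1/2`, in the complex plane. -/
def cantorK : Set ℂ := (fun t : ℝ => ((t - 1 / 2 : ℝ) : ℂ)) '' cantorSet

theorem not_mem_cantorK_of_im {z : ℂ} (hz : z.im ≠ 0) : z ∉ cantorK := by
  rintro ⟨t, -, rfl⟩
  exact hz (Complex.ofReal_im _)

theorem zero_not_mem_cantorK : (0 : ℂ) ∉ cantorK := by
  rintro ⟨t, ht, h⟩
  have h0 : t - 1 / 2 = 0 := Complex.ofReal_eq_zero.mp h
  have h1 : t ∈ preCantorSet 1 := by
    have h2 := Set.mem_iInter.mp (show t ∈ ⋂ n, preCantorSet n from ht) 1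
    exact h2
  rw [preCantorSet_succ, preCantorSet_zero] at h1
  rcases h1 with ⟨a, ha, hat⟩ | ⟨a, ha, hat⟩
  · have := ha.2
    simp only at hat
    linarith
  · have := ha.1
    simp only at hat
    linarith

/-- The end-points of the `2 ^ n` intervals of the `n`-th stage of the construction of the triadic
Cantor set in `[0, 1]`. -/
def stageEndpoints : ℕ → Set ℝ
  | 0 => {0, 1}
  | n + 1 => (fun t => t / 3) '' stageEndpoints n ∪ (fun t => (2 + t) / 3) '' stageEndpoints n

/-- `x k 1, …, x k (2 ^ k)` are end-points of order `k` of the translated Cantor set: distinct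
end-points of the intervals of stage `k`, every end-point of a removed interval being some
`x k l`. -/
structure IsEndpointEnumeration (x : (k : ℕ) → Fin (2 ^ k) → ℝ) : Prop where
  injective : ∀ k, Function.Injective (x k)
  mem : ∀ k l, x k l + 1 / 2 ∈ stageEndpoints k
  exhausts : ∀ n, ∀ e ∈ stageEndpoints n, e ≠ 0 → e ≠ 1 → ∃ k l, x k l + 1 / 2 = e

/-- The measure `∑ₖ λₖ ∑ₗ δ_{x k l}`. -/
def atomicMeasure (lam : ℕ → ℝ) (x : (k : ℕ) → Fin (2 ^ k) → ℝ) : Measure ℂ :=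
  Measure.sum fun k => ∑ l : Fin (2 ^ k), ENNReal.ofReal (lam k) • Measure.dirac ((x k l : ℝ) : ℂ)

/-- The Cauchy transform `f(z) = (1 / 2πi) ∫ dν(t) / (z - t)`. -/
def cauchyTransform (ν : Measure ℂ) (z : ℂ) : ℂ :=
  (2 * Real.pi * Complex.I)⁻¹ * ∫ t, (z - t)⁻¹ ∂ν

/-- The set `G₁` of the points `x` of the Cantor set such that the primitive `F` of the Cauchy
transform, restricted to `(x + iℝ) - {x}`, extends continuously to `x + iℝ`.  (`F` is multivalued:
its restrictions are the primitives of `f` along the two open half-lines.) -/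
def G₁ (ν : Measure ℂ) : Set ℝ :=
  {x | (x : ℂ) ∈ cantorK ∧ ∃ Φ : ℝ → ℂ, Continuous Φ ∧
    ∀ y : ℝ, y ≠ 0 → HasDerivAt Φ (Complex.I * cauchyTransform ν (x + y * Complex.I)) y}

/-! ### The surface and its universal covering, with their log-euclidean metrics -/

/-- The domain `ℂ - K`. -/
abbrev Omega : Type := {z : ℂ // z ∉ cantorK}

/-- The base point `0`. -/
def base : Omega := ⟨0, zero_not_mem_cantorK⟩

/-- A `C¹` arc in `ℂ - K`. -/
structure SmoothArc (z w : Omega) where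
  path : Path z w
  ext : ℝ → ℂ
  contDiff : ContDiff ℝ 1 ext
  ext_eq : ∀ t : unitInterval, ((path t : Omega) : ℂ) = ext t

/-- The log-euclidean length `∫ |f(z)| |dz|` of an arc, that is the euclidean length of its image
under the primitive `F` of `f`. -/
def SmoothArc.length (ν : Measure ℂ) {z w : Omega} (γ : SmoothArc z w) : ℝ≥0∞ :=
  ∫⁻ t in Set.Icc (0 : ℝ) 1, ‖cauchyTransform ν (γ.ext t)‖ₑ * ‖deriv γ.ext t‖ₑ

/-- The tube-log Riemann surface of `F`, uniformized by `F` on `ℂ - K`. -/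
def Surface (_ν : Measure ℂ) : Type := Omega

/-- The log-euclidean distance: infimum of the lengths of piecewise `C¹` paths in `ℂ - K`. -/
instance (ν : Measure ℂ) : PseudoEMetricSpace (Surface ν) :=
  chainPseudoEMetric fun z w : Omega => ⨅ γ : SmoothArc z w, γ.length ν

/-- The universal covering of the surface: homotopy classes of paths of `ℂ - K` starting at `0`. -/
def UnivCover (_ν : Measure ℂ) : Type := Σ z : Omega, Path.Homotopic.Quotient base z

/-- The covering map. -/
def UnivCover.proj {ν : Measure ℂ} (α : UnivCover ν) : Omega := α.1

/-- The log-euclidean distance of the universal covering: infimum of the lengths of the projections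
of its piecewise `C¹` paths. -/
instance (ν : Measure ℂ) : PseudoEMetricSpace (UnivCover ν) :=
  chainPseudoEMetric fun α β : (Σ z : Omega, Path.Homotopic.Quotient base z) =>
    ⨅ (γ : SmoothArc α.1 β.1) (_ : α.2.trans (Path.Homotopic.Quotient.mk γ.path) = β.2), γ.length ν

/-! ### Green angles and tips -/

/-- The point of the Cantor set with triadic digits `2 * b n`. -/
def cantorPoint (b : ℕ → Bool) : ℝ := (∑' n : ℕ, 2 * ((b n).toNat : ℝ) / 3 ^ (n + 1)) - 1 / 2

/-- The angle `(1/2) μ([x, 1/2])` of the upper Green line of the equilibrium measure `μ` of the Cantor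
set that lands at `x = cantorPoint b`; the line through `0` has angle `1/4`. -/
def greenAngle (b : ℕ → Bool) : UnitAddCircle :=
  ((1 / 2 * (1 - ∑' n : ℕ, ((b n).toNat : ℝ) / 2 ^ (n + 1)) : ℝ) : UnitAddCircle)

/-- The Green line of angle `θ`, a non-dyadic angle, lands at `x` from the upper half-plane. -/
def LandsAbove (θ : UnitAddCircle) (x : ℝ) : Prop :=
  ∃ b : ℕ → Bool, (∀ N, (∃ n ≥ N, b n = true) ∧ ∃ n ≥ N, b n = false) ∧
    θ = greenAngle b ∧ x = cantorPoint b

/-- The Green line of angle `θ` lands at `x` from the lower half-plane. -/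
def LandsBelow (θ : UnitAddCircle) (x : ℝ) : Prop := LandsAbove (-θ) x

/-- The angles whose Green line lands at a point of `G₁`. -/
def Angle (ν : Measure ℂ) : Type :=
  {θ : UnitAddCircle // ∃ x ∈ G₁ ν, LandsAbove θ x ∨ LandsBelow θ x}

/-- The point `x + iy`, `y ≠ 0`. -/
def vertPt (x : ℝ) (y : {y : ℝ // y ≠ 0}) : Omega :=
  ⟨x + (y : ℝ) * Complex.I, not_mem_cantorK_of_im (by simpa using y.2)⟩

/-- The straight segment from `0` to `x + iy`, `y ≠ 0`. -/
def segPath (x : ℝ) (y : {y : ℝ // y ≠ 0}) : Path base (vertPt x y) where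
  toFun t := ⟨((t : ℝ) : ℂ) * (x + (y : ℝ) * Complex.I), by
    by_cases ht : (t : ℝ) = 0
    · rw [ht]; simpa using zero_not_mem_cantorK
    · exact not_mem_cantorK_of_im (by simpa using ⟨fun h => ht (by simp [h]), y.2⟩)⟩
  continuous_toFun := by fun_prop
  source' := by ext; simp [base]
  target' := by ext; simp [vertPt]

/-- `p` is the tip over `x` in the completed surface: the limit of `x + iy` as `y → 0`, `y ≠ 0`. -/
def IsTip (ν : Measure ℂ) (x : ℝ) (p : CauchyCompletion (Surface ν)) : Prop :=
  Tendsto (fun y : {y : ℝ // y ≠ 0} => toCompletion (show Surface ν from vertPt x y))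
    (comap Subtype.val (𝓝 (0 : ℝ))) (𝓝 p)

/-- The lift of `x + iy` in the sheet over the half-plane obtained by following first the loop class
`g` and then the segment from `0` to `x + iy`. -/
def liftPt (ν : Measure ℂ) (g : Path.Homotopic.Quotient base base) (x : ℝ) (y : {y : ℝ // y ≠ 0}) :
    UnivCover ν :=
  ⟨vertPt x y, g.trans (Path.Homotopic.Quotient.mk (segPath x y))⟩

/-- `p` is the tip over `x` of the lift with label `g` of the upper half-plane. -/
def IsUpperTip (ν : Measure ℂ) (g : Path.Homotopic.Quotient base base) (x : ℝ)
    (p : CauchyCompletion (UnivCover ν)) : Prop :=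
  Tendsto (fun y : {y : ℝ // y ≠ 0} => toCompletion (liftPt ν g x y))
    (comap Subtype.val (𝓝[>] (0 : ℝ))) (𝓝 p)

/-- `p` is the tip over `x` of the lift with label `g` of the lower half-plane. -/
def IsLowerTip (ν : Measure ℂ) (g : Path.Homotopic.Quotient base base) (x : ℝ)
    (p : CauchyCompletion (UnivCover ν)) : Prop :=
  Tendsto (fun y : {y : ℝ // y ≠ 0} => toCompletion (liftPt ν g x y))
    (comap Subtype.val (𝓝[<] (0 : ℝ))) (𝓝 p)

/-! ### The space `Ĉ` -/

/-- The copy with index `(θ₁, …, θₙ)` and the copy with index `(θ₁, …, θₙ, θ)` are glued at the tip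
over the landing point of `θ`. -/
def hatRel (ν : Measure ℂ) (P Q : Copies (List (Angle ν)) (CauchyCompletion (Surface ν))) : Prop :=
  ∃ (θ : Angle ν) (x : ℝ), x ∈ G₁ ν ∧ (LandsAbove θ.1 x ∨ LandsBelow θ.1 x) ∧
    Q.index = P.index ++ [θ] ∧ IsTip ν x P.pt ∧ Q.pt = P.pt

/-- The restricted Riemannium `Ĉ`: the completed surfaces indexed by finite sequences of angles,
glued at tips, with the log-euclidean length distance. -/
abbrev HatC (ν : Measure ℂ) : Type := Glued (hatRel ν)

/-- The point `z` of the copy with index `s`. -/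
def hatPt (ν : Measure ℂ) (s : List (Angle ν)) (z : Surface ν) : HatC ν :=
  Glued.mk (hatRel ν) ⟨s, toCompletion z⟩

/-! ### The spaces `Č` and `C̃` -/

/-- The Green lines of the universal covering: lifts of Green lines landing in `G₁`, that is a loop
class (the label of the lifted half-plane) and an angle. -/
abbrev LiftedAngle (ν : Measure ℂ) : Type := Path.Homotopic.Quotient base base × Angle ν

/-- The copy with index `s` and the copy with index `s` followed by `(g, θ)` are glued at one point:
the tip of the lifted Green line `(g, θ)` in the first copy is identified to the tip of the
conjugate line `(g, -θ)` in the second one. -/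
def checkRel (ν : Measure ℂ)
    (P Q : Copies (List (LiftedAngle ν)) (CauchyCompletion (UnivCover ν))) : Prop :=
  ∃ (g : Path.Homotopic.Quotient base base) (θ : Angle ν) (x : ℝ), x ∈ G₁ ν ∧
    Q.index = P.index ++ [(g, θ)] ∧
    ((LandsAbove θ.1 x ∧ IsUpperTip ν g x P.pt ∧ IsLowerTip ν g x Q.pt) ∨
      (LandsBelow θ.1 x ∧ IsLowerTip ν g x P.pt ∧ IsUpperTip ν g x Q.pt))

/-- The space `Č`: the completed universal coverings, glued at tips. -/
abbrev CheckC (ν : Measure ℂ) : Type := Glued (checkRel ν)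

/-- The point `p` of the copy with index `s` of `Č`. -/
def checkMk (ν : Measure ℂ) (s : List (LiftedAngle ν)) (p : CauchyCompletion (UnivCover ν)) :
    CheckC ν :=
  Glued.mk (checkRel ν) ⟨s, p⟩

/-- The branch `F(z) = ∫_0^z f` on the two half-planes, along the segment from `0` to `z`. -/
def primitive (ν : Measure ℂ) (z : ℂ) : ℂ :=
  ∫ t in (0 : ℝ)..1, cauchyTransform ν ((t : ℂ) * z) * z

/-- `c` is the Borel monodromy of `F` along the loop that goes from `0` to the landing point of `θ` in
the half-plane of `θ`, crosses the real axis there and comes back to `0` in the other half-plane. -/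
def CrossingMonodromy (ν : Measure ℂ) (θ : UnitAddCircle) (c : ℂ) : Prop :=
  ∃ x ∈ G₁ ν, ∃ v w : ℂ,
    Tendsto (fun y : ℝ => primitive ν (x + y * Complex.I)) (𝓝[>] 0) (𝓝 v) ∧
    Tendsto (fun y : ℝ => primitive ν (x + y * Complex.I)) (𝓝[<] 0) (𝓝 w) ∧
    ((LandsAbove θ x ∧ c = v - w) ∨ (LandsBelow θ x ∧ c = w - v))

/-- `m` is the Borel monodromy of `F` along a path that joins in `Č` the point over `0` of the
principal copy to the corresponding point of the copy with index `s`.  In the step from `s` to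
`s` followed by `(g, θ)` the projected path is the loop of `θ` conjugated by `g`, so the
contribution of `g` cancels. -/
inductive Monodromy (ν : Measure ℂ) : List (LiftedAngle ν) → ℂ → Prop
  | nil : Monodromy ν [] 0
  | snoc {s : List (LiftedAngle ν)} {m c : ℂ} (g : Path.Homotopic.Quotient base base) (θ : Angle ν) :
      Monodromy ν s m → CrossingMonodromy ν θ.1 c → Monodromy ν (s ++ [(g, θ)]) (m + c)

/-- Two copies in `Č` are identified (pointwise) when their monodromies are equal. -/
def tildeRel (ν : Measure ℂ) (P Q : CheckC ν) : Prop :=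
  ∃ (s t : List (LiftedAngle ν)) (m : ℂ) (p : CauchyCompletion (UnivCover ν)),
    Monodromy ν s m ∧ Monodromy ν t m ∧ P = checkMk ν s p ∧ Q = checkMk ν t p

/-- The restricted Riemannium `C̃`, with the log-euclidean length distance. -/
abbrev TildeC (ν : Measure ℂ) : Type := Glued (tildeRel ν)

/-- The image in `C̃` of the point `α` of the copy with index `s`. -/
def tildePt (ν : Measure ℂ) (s : List (LiftedAngle ν)) (α : UnivCover ν) : TildeC ν :=
  Glued.mk (tildeRel ν) (checkMk ν s (toCompletion α))

end CantorRiemannium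

end

noncomputable section

namespace CantorRiemannium

section Generic

open scoped NNReal

/-! ### Lipschitz maps on chain metrics, gluings and completions -/

/-! Both sequences run along tips accumulating at 1/4, and Lipschitz functions on the quotients show
that they have no limit. The basic function is `potential`: up to a constant it is Re F on the upper
half-plane, folded by z ↦ z̄. Since F' = f it is 1-Lipschitz for |f||dz|
(`lipschitzWith_potential`). On a gap of K it equals half the ν-mass lying to the right, so it drops
by at least ν{p}/2 across an atom p.

The tips lie over xⱼ = 1/4 - 9⁻ʲ/2, and the atoms `sepSeq j` separate consecutive ones. The points
xⱼ stay at distance at least 3⁻ᵏ/12 from the end-points of stage k, and Σ λₖ 6ᵏ < ∞, hence ∫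
dν(t)/|xⱼ - t| ≤ M with a single M (`exists_nice`). So |f| is bounded by a multiple of M on the
vertical line through xⱼ, on suitable crossings of nearby gaps, and on suitable detours between two
tips in the lower half-plane. Lengths are then O(M) times euclidean sizes, and both sequences have
finite total length.

For Ĉ the copies form a tree. The n-th point lies in the copy indexed by the angles of x₀, …, xₙ₋₁,
and each step passes through the tip over xₙ. A limit would lie in a copy whose index has some
length k. The potential composed with the retraction of the tree onto the copy S reached after k + 1
steps (`hatRetract`) is Lipschitz. It takes at the limit the value of the tip over xₖ, and on the
tail of the sequence the value of the tip over xₖ₊₁. These differ because of the atom between them.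

For C̃ the identifications destroy the tree, but they do not change the point of the universal
covering, so functions of that point survive. For a bump Ψⱼ equal to 1 on the potential of the gaps
between two atoms and to 0 on the other gaps, Ψⱼ ∘ `potential` above the axis and 0 below it define
a map ℂ - K → ℝ/ℤ. Its winding number Wⱼ on the universal covering is Cⱼ-Lipschitz, and jumps by at
most 1 at glued tips. The sequence spirals: it goes down through a tip, which leaves the label
unchanged, and comes back up through a gap, which multiplies the label by a loop. It does so more
than j Cⱼ times inside the j-th window before moving right for good. The Wⱼ of the tail is then at
least j Cⱼ in modulus, and this passes to a limit Q (`le_abs_winding_of_tendsto`). But Q is at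
finite distance from the first point, hence joined to it by a finite chain of finite length, so the
values of Wⱼ at the two points differ by at most R Cⱼ with R independent of j
(`winding_bounded_of_edist_ne_top`). Large j gives a contradiction. -/

theorem edist_le_mul_of_chain {X Y : Type*} [PseudoEMetricSpace Y] {c : X → X → ℝ≥0∞} {φ : X → Y}
    {K : ℝ≥0∞} (h : ∀ x y, edist (φ x) (φ y) ≤ K * c x y) {x y : X} {l : ℝ≥0∞}
    (hl : ChainOfCost c x y l) : edist (φ x) (φ y) ≤ K * l := by
  induction hl with
  | refl => simp
  | @step y z l _ ih =>
    refine (edist_triangle _ (φ y) _).trans ?_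
    rw [mul_add]
    refine add_le_add ih ?_
    rcases min_cases (c y z) (c z y) with ⟨h1, -⟩ | ⟨h1, -⟩ <;> rw [h1]
    · exact h y z
    · rw [edist_comm]; exact h z y

theorem lipschitzWith_chain {X Y : Type*} [PseudoEMetricSpace Y] {c : X → X → ℝ≥0∞} {φ : X → Y}
    {K : ℝ≥0} (h : ∀ x y, edist (φ x) (φ y) ≤ K * c x y) :
    @LipschitzWith X Y (chainPseudoEMetric c) _ K φ := by
  intro x y
  change edist (φ x) (φ y) ≤ K * ⨅ (l : ℝ≥0∞) (_ : ChainOfCost c x y l), l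
  -- Division by K is not available for K = 0; there a single step suffices, since its cost is
  -- multiplied by 0 even when infinite.
  rcases eq_or_ne K 0 with rfl | hK
  · have := edist_le_mul_of_chain h (ChainOfCost.refl (c := c) x).step (y := y)
    simpa using this
  · have h1 : edist (φ x) (φ y) / K ≤ ⨅ (l : ℝ≥0∞) (_ : ChainOfCost c x y l), l :=
      le_iInf₂ fun l hl => ENNReal.div_le_of_le_mul' (edist_le_mul_of_chain h hl)
    rw [ENNReal.div_le_iff_le_mul (by simp [hK]) (by simp)] at h1
    rwa [mul_comm]

theorem edist_chain_le {X : Type*} (c : X → X → ℝ≥0∞) (x y : X) :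
    (chainPseudoEMetric c).edist x y ≤ c x y := by
  have h : ChainOfCost c x y (0 + min (c x y) (c y x)) := (ChainOfCost.refl x).step
  exact (iInf₂_le _ h).trans (by simp)

/-- A chain of finite total cost is a finite succession of steps of finite cost, so the relation
propagates from one end to the other. -/
theorem rel_of_edist_chain_ne_top {X : Type*} {c : X → X → ℝ≥0∞} {E : X → X → Prop}
    (hE : Equivalence E) (h : ∀ x y, c x y ≠ ⊤ → E x y) {x y : X}
    (hxy : (chainPseudoEMetric c).edist x y ≠ ⊤) : E x y := by
  have h0 : (⨅ (l : ℝ≥0∞) (_ : ChainOfCost c x y l), l) < ⊤ := lt_top_iff_ne_top.mpr hxy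
  simp only [iInf_lt_iff] at h0
  obtain ⟨l, hl, hlt⟩ := h0
  clear hxy
  induction hl with
  | refl => exact hE.refl _
  | @step y z l _ ih =>
    obtain ⟨h1, h2⟩ := ENNReal.add_lt_top.mp hlt
    refine hE.trans (ih h1) ?_
    rcases min_lt_iff.mp h2 with h3 | h3
    · exact h _ _ h3.ne
    · exact hE.symm (h _ _ h3.ne)

theorem Glued.edist_mk_le {X : Type*} [PseudoEMetricSpace X] (r : X → X → Prop) (x y : X) :
    edist (Glued.mk r x) (Glued.mk r y) ≤ edist x y :=
  (edist_chain_le _ _ _).trans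
    ((iInf₂_le x y).trans ((iInf_le _ rfl).trans (iInf_le _ rfl)))

theorem Glued.mk_eq {X : Type*} {r : X → X → Prop} {x y : X} (h : r x y) :
    Glued.mk r x = Glued.mk r y := Quot.sound h

theorem Glued.mk_surjective {X : Type*} (r : X → X → Prop) :
    Function.Surjective (Glued.mk r) := fun P => Quot.exists_rep P

/-- A function compatible with the identifications descends to the quotient. -/
def Glued.lift {X Y : Type*} {r : X → X → Prop} (φ : X → Y) (h : ∀ x y, r x y → φ x = φ y) :
    Glued r → Y := Quot.lift φ h

theorem Glued.lipschitzWith_lift {X Y : Type*} [PseudoEMetricSpace X] [PseudoEMetricSpace Y]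
    {r : X → X → Prop} {φ : X → Y} (h : ∀ x y, r x y → φ x = φ y) {K : ℝ≥0}
    (hφ : LipschitzWith K φ) : LipschitzWith K (Glued.lift φ h) := by
  refine lipschitzWith_chain fun P Q => ?_
  obtain ⟨x, rfl⟩ := Glued.mk_surjective r P
  obtain ⟨y, rfl⟩ := Glued.mk_surjective r Q
  rcases eq_or_ne K 0 with rfl | hK
  · have h0 := hφ x y
    change edist (φ x) (φ y) ≤ _
    simpa using h0
  have h1 : edist (Glued.lift φ h (Glued.mk r x)) (Glued.lift φ h (Glued.mk r y)) / K ≤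
      ⨅ (x' : X) (y' : X) (_ : Glued.mk r x' = Glued.mk r x) (_ : Glued.mk r y' = Glued.mk r y),
        edist x' y' := by
    refine le_iInf₂ fun x' y' => le_iInf₂ fun hx hy => ENNReal.div_le_of_le_mul' ?_
    rw [← hx, ← hy]
    exact hφ x' y'
  rwa [ENNReal.div_le_iff_le_mul (by simp [hK]) (by simp), mul_comm] at h1

theorem Glued.rel_of_mk_eq {X : Type*} {r : X → X → Prop} {E : X → X → Prop}
    (hE : Equivalence E) (hr : ∀ x y, r x y → E x y) {x y : X}
    (h : Glued.mk r x = Glued.mk r y) : E x y := by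
  have h1 := Quot.eqvGen_exact h
  clear h
  induction h1 with
  | rel x y h => exact hr x y h
  | refl => exact hE.refl _
  | symm _ _ _ ih => exact hE.symm ih
  | trans _ _ _ _ _ ih1 ih2 => exact hE.trans ih1 ih2

theorem Glued.rel_of_edist_ne_top {X : Type*} [PseudoEMetricSpace X] {r : X → X → Prop}
    {E : X → X → Prop} (hE : Equivalence E) (hr : ∀ x y, r x y → E x y)
    (hd : ∀ x y, edist x y ≠ ⊤ → E x y) {x y : X}
    (h : edist (Glued.mk r x) (Glued.mk r y) ≠ ⊤) : E x y := by
  -- Quantifying over all representatives costs nothing, because E contains the gluing relation.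
  let E' : Glued r → Glued r → Prop := fun P Q =>
    ∀ x y, Glued.mk r x = P → Glued.mk r y = Q → E x y
  have hE' : Equivalence E' := by
    refine ⟨fun P x y hx hy => Glued.rel_of_mk_eq hE hr (hx.trans hy.symm),
      fun h x y hx hy => hE.symm (h y x hy hx), fun {P Q R} h1 h2 x z hx hz => ?_⟩
    obtain ⟨y, hy⟩ := Glued.mk_surjective r Q
    exact hE.trans (h1 x y hx hy) (h2 y z hy hz)
  refine rel_of_edist_chain_ne_top hE' (fun P Q hPQ => ?_) h x y rfl rfl
  intro x y hx hy
  have h1 := lt_top_iff_ne_top.mpr hPQ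
  simp only [iInf_lt_iff] at h1
  obtain ⟨x', y', hx', hy', hlt⟩ := h1
  exact hE.trans (Glued.rel_of_mk_eq hE hr (hx.trans hx'.symm))
    (hE.trans (hd x' y' hlt.ne) (Glued.rel_of_mk_eq hE hr (hy'.trans hy.symm)))

theorem edist_toCompletion {X : Type*} [PseudoEMetricSpace X] (x y : X) :
    edist (toCompletion x) (toCompletion y) = edist x y := by
  rw [toCompletion, toCompletion, SeparationQuotient.edist_mk]
  change limsup (fun _ : ℕ => edist x y) atTop = _
  simp

theorem edist_mk_toCompletion_le {X : Type*} [PseudoEMetricSpace X] (x : X) (u : CauchySeqs X)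
    {d : ℝ≥0∞} {b : ℕ → ℝ≥0∞} (h : ∀ n, edist x (u.seq n) ≤ d + b n)
    (hb : Tendsto b atTop (𝓝 0)) :
    edist (toCompletion x) (SeparationQuotient.mk u) ≤ d := by
  rw [toCompletion, SeparationQuotient.edist_mk]
  change limsup (fun n : ℕ => edist x (u.seq n)) atTop ≤ d
  have h1 : Tendsto (fun n => d + b n) atTop (𝓝 (d + 0)) := tendsto_const_nhds.add hb
  rw [add_zero] at h1
  rw [← h1.limsup_eq]
  exact limsup_le_limsup (Eventually.of_forall h)

theorem exists_completion_extension {X : Type*} [PseudoEMetricSpace X] {φ : X → ℝ} {K : ℝ≥0}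
    (hφ : LipschitzWith K φ) :
    ∃ Φ : CauchyCompletion X → ℝ, LipschitzWith K Φ ∧ ∀ x, Φ (toCompletion x) = φ x := by
  have hlim : ∀ u : CauchySeqs X, ∃ v, Tendsto (fun n => φ (u.seq n)) atTop (𝓝 v) := fun u =>
    cauchySeq_tendsto_of_complete (hφ.uniformContinuous.comp_cauchySeq u.cauchy)
  choose Φ hΦ using hlim
  have hlip : LipschitzWith K Φ := by
    intro u v
    have h1 : Tendsto (fun n => edist (φ (u.seq n)) (φ (v.seq n))) atTop
        (𝓝 (edist (Φ u) (Φ v))) := (hΦ u).edist (hΦ v)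
    rw [← h1.limsup_eq]
    refine (limsup_le_limsup (Eventually.of_forall fun n => hφ (u.seq n) (v.seq n))).trans ?_
    exact ENNReal.limsup_const_mul_of_ne_top ENNReal.coe_ne_top |>.le
  refine ⟨SeparationQuotient.lift Φ fun u v huv => ?_, fun P Q => ?_, fun x => ?_⟩
  · have h1 := hlip u v
    rw [huv.edist_eq_zero, mul_zero] at h1
    exact edist_le_zero.mp h1
  · obtain ⟨u, rfl⟩ := SeparationQuotient.surjective_mk P
    obtain ⟨v, rfl⟩ := SeparationQuotient.surjective_mk Q
    simpa using hlip u v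
  · exact tendsto_nhds_unique (hΦ _) tendsto_const_nhds

/-- The continuous extension of a real Lipschitz function to the completion. -/
def extend {X : Type*} [PseudoEMetricSpace X] {φ : X → ℝ} {K : ℝ≥0} (hφ : LipschitzWith K φ) :
    CauchyCompletion X → ℝ := (exists_completion_extension hφ).choose

theorem lipschitzWith_extend {X : Type*} [PseudoEMetricSpace X] {φ : X → ℝ} {K : ℝ≥0}
    (hφ : LipschitzWith K φ) : LipschitzWith K (extend hφ) :=
  (exists_completion_extension hφ).choose_spec.1

@[simp]
theorem extend_toCompletion {X : Type*} [PseudoEMetricSpace X] {φ : X → ℝ} {K : ℝ≥0}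
    (hφ : LipschitzWith K φ) (x : X) : extend hφ (toCompletion x) = φ x :=
  (exists_completion_extension hφ).choose_spec.2 x

/-- A family `ψ i` with `d(ψ i, ψ j) ≤ ρ i + ρ j` converges in the completion when `ρ i` tends
to `0`, and `ρ` bounds the distance to the limit. -/
theorem exists_completion_limit {ι X : Type*} [PseudoEMetricSpace X] {ψ : ι → X} {ρ : ι → ℝ≥0∞}
    {S : Set ι} (h : ∀ i ∈ S, ∀ j ∈ S, edist (ψ i) (ψ j) ≤ ρ i + ρ j) {u : ℕ → ι}
    (huS : ∀ n, u n ∈ S) (hu : Tendsto (fun n => ρ (u n)) atTop (𝓝 0)) :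
    ∃ p : CauchyCompletion X, (∀ i ∈ S, edist (toCompletion (ψ i)) p ≤ ρ i) ∧
      ∀ F : Filter ι, S ∈ F → Tendsto ρ F (𝓝 0) →
        Tendsto (fun i => toCompletion (ψ i)) F (𝓝 p) := by
  have hc : CauchySeq fun n => ψ (u n) := by
    rw [EMetric.cauchySeq_iff]
    intro ε hε
    have h1 : ∀ᶠ n in atTop, ρ (u n) < ε / 2 :=
      hu.eventually_lt_const (ENNReal.half_pos hε.ne')
    obtain ⟨N, hN⟩ := eventually_atTop.mp h1
    refine ⟨N, fun m hm n hn => (h _ (huS m) _ (huS n)).trans_lt ?_⟩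
    exact (ENNReal.add_lt_add (hN m hm) (hN n hn)).trans_eq (ENNReal.add_halves ε)
  refine ⟨SeparationQuotient.mk ⟨_, hc⟩, ?_⟩
  have hd : ∀ i ∈ S, edist (toCompletion (ψ i)) (SeparationQuotient.mk ⟨_, hc⟩) ≤ ρ i :=
    fun i hi => edist_mk_toCompletion_le _ _ (fun n => h i hi _ (huS n)) hu
  refine ⟨hd, fun F hS hρ => ?_⟩
  rw [tendsto_iff_edist_tendsto_0]
  exact tendsto_of_tendsto_of_tendsto_of_le_of_le' tendsto_const_nhds hρ
    (Eventually.of_forall fun _ => zero_le) (by filter_upwards [hS] with i hi using hd i hi)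

theorem Copies.edist_same {ι X : Type*} [PseudoEMetricSpace X] (i : ι) (x y : X) :
    edist (⟨i, x⟩ : Copies ι X) ⟨i, y⟩ = edist x y := if_pos rfl

theorem Copies.edist_ne_top {ι X : Type*} [PseudoEMetricSpace X] {P Q : Copies ι X}
    (h : edist P Q ≠ ⊤) : P.index = Q.index ∧ edist P.pt Q.pt ≠ ⊤ := by
  by_cases h1 : P.index = Q.index
  · refine ⟨h1, ?_⟩
    have h2 : edist P Q = edist P.pt Q.pt := if_pos h1
    rwa [h2] at h
  · exact absurd (if_neg h1) h

/-- A function on disjoint copies is Lipschitz as soon as it is so on each copy. -/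
theorem Copies.lipschitzWith {ι X Y : Type*} [PseudoEMetricSpace X] [PseudoEMetricSpace Y]
    {φ : Copies ι X → Y} {K : ℝ≥0} (hK : K ≠ 0)
    (h : ∀ i, LipschitzWith K fun x => φ ⟨i, x⟩) : LipschitzWith K φ := by
  rintro ⟨i, x⟩ ⟨j, y⟩
  by_cases hij : i = j
  · subst hij
    rw [Copies.edist_same]
    exact h i x y
  · have h2 : edist (⟨i, x⟩ : Copies ι X) ⟨j, y⟩ = ⊤ := if_neg hij
    -- K ≠ 0 is needed here: 0 * ⊤ = 0 would give no room for distinct copies.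
    rw [h2, ENNReal.mul_top (by simpa using hK)]
    exact le_top

end Generic

/-! ### A 1-Lipschitz function on the sheets: the folded real part of F. -/

section Potential

/-! ### The Cantor set in the plane -/

theorem isCompact_cantorK : IsCompact cantorK :=
  isCompact_cantorSet.image (by fun_prop)

theorem isClosed_cantorK : IsClosed cantorK := isCompact_cantorK.isClosed

theorem im_eq_zero_of_mem_cantorK {z : ℂ} (hz : z ∈ cantorK) : z.im = 0 := by
  by_contra h
  exact not_mem_cantorK_of_im h hz

theorem conj_eq_of_mem_cantorK {z : ℂ} (hz : z ∈ cantorK) : (starRingEnd ℂ) z = z :=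
  Complex.conj_eq_iff_im.mpr (im_eq_zero_of_mem_cantorK hz)

theorem exists_dist_cantorK {z : ℂ} (hz : z ∉ cantorK) :
    ∃ r > 0, ∀ t ∈ cantorK, r ≤ ‖z - t‖ := by
  have h1 : cantorKᶜ ∈ 𝓝 z := isClosed_cantorK.isOpen_compl.mem_nhds hz
  obtain ⟨r, hr, hball⟩ := Metric.mem_nhds_iff.mp h1
  refine ⟨r, hr, fun t ht => ?_⟩
  by_contra! h
  refine hball ?_ ht
  rwa [Metric.mem_ball, dist_comm, dist_eq_norm]

theorem conj_not_mem_cantorK {z : ℂ} (hz : z ∉ cantorK) : (starRingEnd ℂ) z ∉ cantorK := by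
  intro h
  have h1 := conj_eq_of_mem_cantorK h
  rw [Complex.conj_conj] at h1
  exact hz (h1 ▸ h)

/-! ### The folded real part of the primitive -/

/-- The function `(1 / 2π) ∫ |arg (z - t)| dν(t)`, that is, up to a constant, the real part of the
primitive of the Cauchy transform on the upper half-plane, extended by reflection. -/
def potential (ν : Measure ℂ) (z : ℂ) : ℝ := (2 * Real.pi)⁻¹ * ∫ t, |(z - t).arg| ∂ν

variable {ν : Measure ℂ}

theorem potential_conj (hK : ∀ᵐ t ∂ν, t ∈ cantorK) (z : ℂ) :
    potential ν ((starRingEnd ℂ) z) = potential ν z := by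
  rw [potential, potential]
  congr 1
  refine integral_congr_ae ?_
  filter_upwards [hK] with t ht
  rw [← conj_eq_of_mem_cantorK ht, ← map_sub, conj_eq_of_mem_cantorK ht, Complex.arg_conj]
  split_ifs with h
  · rw [h]
  · rw [abs_neg]

theorem norm_cauchyTransform_conj (hK : ∀ᵐ t ∂ν, t ∈ cantorK) (z : ℂ) :
    ‖cauchyTransform ν ((starRingEnd ℂ) z)‖ = ‖cauchyTransform ν z‖ := by
  rw [cauchyTransform, cauchyTransform, norm_mul, norm_mul]
  congr 1
  rw [← RCLike.norm_conj, ← integral_conj]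
  congr 1
  refine integral_congr_ae ?_
  filter_upwards [hK] with t ht
  rw [map_inv₀, map_sub, Complex.conj_conj, conj_eq_of_mem_cantorK ht]

theorem measurable_arg_sub (z : ℂ) : Measurable fun t : ℂ => (z - t).arg :=
  Complex.measurable_arg.comp (measurable_const.sub measurable_id)

theorem integrable_abs_arg_sub [IsFiniteMeasure ν] (z : ℂ) :
    Integrable (fun t : ℂ => |(z - t).arg|) ν :=
  Integrable.of_bound (C := Real.pi) (measurable_arg_sub z).abs.aestronglyMeasurable
    (Eventually.of_forall fun t => by simpa using Complex.abs_arg_le_pi (z - t))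

/-- Both arguments lie in [0, π] and the argument of the quotient in (-π/2, π/2), which leaves no
room for a nonzero multiple of 2π. -/
theorem arg_sub_arg_eq_arg_div {a b : ℂ} (ha : a ≠ 0) (hb : b ≠ 0) (ha' : 0 ≤ a.im)
    (hb' : 0 ≤ b.im) (h : 0 < (a / b).re) : a.arg - b.arg = (a / b).arg := by
  have h1 : ((a / b).arg : Real.Angle) = ((a.arg - b.arg : ℝ) : Real.Angle) := by
    rw [Complex.arg_div_coe_angle ha hb, Real.Angle.coe_sub]
  rw [Real.Angle.angle_eq_iff_two_pi_dvd_sub] at h1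
  obtain ⟨k, hk⟩ := h1
  have h2 : |(a / b).arg| < Real.pi / 2 :=
    Complex.abs_arg_lt_pi_div_two_iff.mpr (Or.inl h)
  have h3 := Complex.arg_nonneg_iff.mpr ha'
  have h4 := Complex.arg_nonneg_iff.mpr hb'
  have h5 := Complex.arg_le_pi a
  have h6 := Complex.arg_le_pi b
  have hpi := Real.pi_pos
  rw [abs_lt] at h2
  have hk1 : (k : ℝ) < 1 := by nlinarith
  have hk2 : (-1 : ℝ) < k := by nlinarith
  have hk0 : k = 0 := by
    have h7 : k < 1 := by exact_mod_cast hk1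
    have h8 : -1 < k := by exact_mod_cast hk2
    omega
  rw [hk0] at hk
  push_cast at hk
  linarith

theorem re_div_pos_of_norm_sub_lt {a b : ℂ} (h : ‖a - b‖ < ‖b‖) : 0 < (a / b).re := by
  have hb : b ≠ 0 := by
    rintro rfl
    simp at h
    exact absurd h (not_lt.mpr (norm_nonneg a))
  have h1 : ‖a / b - 1‖ < 1 := by
    rw [div_sub_one hb, norm_div, div_lt_one (norm_pos_iff.mpr hb)]
    exact h
  have h2 := (Complex.abs_re_le_norm (a / b - 1)).trans_lt h1
  rw [abs_lt, Complex.sub_re, Complex.one_re] at h2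
  linarith

/-- Dividing by z₀ - t keeps the quotient in Re > 0 for z near z₀, away from the cut of the
logarithm. The principal branch of log (z - t) itself would not do at a point z₀ of a gap, where the
cut passes for every t to its right. -/
theorem hasDerivAt_integral_log [IsFiniteMeasure ν] (hK : ∀ᵐ t ∂ν, t ∈ cantorK) {z₀ : ℂ}
    {r : ℝ} (hr : 0 < r) (hz : ∀ t ∈ cantorK, r ≤ ‖z₀ - t‖) :
    HasDerivAt (fun z => ∫ t, Complex.log ((z - t) / (z₀ - t)) ∂ν) (∫ t, (z₀ - t)⁻¹ ∂ν) z₀ ∧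
    ∀ z ∈ Metric.ball z₀ (r / 2), Integrable (fun t => Complex.log ((z - t) / (z₀ - t))) ν := by
  have hmeas : ∀ z, Measurable fun t => Complex.log ((z - t) / (z₀ - t)) := fun z =>
    Complex.measurable_log.comp (((measurable_const.sub measurable_id)).div
      (measurable_const.sub measurable_id))
  have h := hasDerivAt_integral_of_dominated_loc_of_deriv_le (𝕜 := ℂ) (μ := ν)
    (F := fun z t => Complex.log ((z - t) / (z₀ - t))) (F' := fun z t => (z - t)⁻¹)
    (x₀ := z₀) (s := Metric.ball z₀ (r / 2)) (bound := fun _ => (r / 2)⁻¹)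
    (Metric.ball_mem_nhds _ (half_pos hr))
    (Eventually.of_forall fun z => (hmeas z).aestronglyMeasurable)
    ?_ ?_ ?_ (integrable_const _) ?_
  · refine ⟨h.2, fun z hzr => ?_⟩
    refine Integrable.of_bound (C := Real.log 2 + Real.pi) (hmeas z).aestronglyMeasurable ?_
    filter_upwards [hK] with t ht
    have hzt : ‖z - z₀‖ < r / 2 := by rwa [← dist_eq_norm]
    have h0 := hz t ht
    have hne : z₀ - t ≠ 0 := norm_pos_iff.mp (hr.trans_le h0)
    have hn : ‖(z - t) / (z₀ - t) - 1‖ ≤ 1 / 2 := by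
      rw [div_sub_one hne, norm_div, div_le_iff₀ (norm_pos_iff.mpr hne)]
      have : z - t - (z₀ - t) = z - z₀ := by ring
      rw [this]; linarith
    refine (Complex.norm_le_abs_re_add_abs_im _).trans (add_le_add ?_ ?_)
    · rw [Complex.log_re]
      have h1 : ‖(z - t) / (z₀ - t)‖ ≤ 2 := by
        have := norm_le_norm_add_norm_sub' ((z - t) / (z₀ - t)) 1
        rw [norm_one] at this; linarith
      have h2 : 1 / 2 ≤ ‖(z - t) / (z₀ - t)‖ := by
        have := norm_sub_norm_le (1 : ℂ) ((z - t) / (z₀ - t))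
        rw [norm_one, norm_sub_rev] at this; linarith
      rw [abs_le]
      constructor
      · rw [← Real.log_inv]
        exact Real.log_le_log (by norm_num) (by linarith)
      · exact Real.log_le_log (by linarith) h1
    · rw [Complex.log_im]; exact Complex.abs_arg_le_pi _
  · refine (integrable_zero ℂ ℂ ν).congr ?_
    filter_upwards [hK] with t ht
    have hne : z₀ - t ≠ 0 := norm_pos_iff.mp (hr.trans_le (hz t ht))
    simp [div_self hne]
  · exact ((measurable_const.sub measurable_id).inv).aestronglyMeasurable
  · filter_upwards [hK] with t ht z hzr
    have hzt : ‖z - z₀‖ < r / 2 := by rwa [← dist_eq_norm]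
    rw [norm_inv]
    refine inv_anti₀ (half_pos hr) ?_
    have h1 := hz t ht
    have h2 : ‖z₀ - t‖ ≤ ‖z - t‖ + ‖z - z₀‖ := by
      have : z₀ - t = (z - t) - (z - z₀) := by ring
      rw [this]; exact norm_sub_le _ _
    linarith
  · filter_upwards [hK] with t ht z hzr
    have hzt : ‖z - z₀‖ < r / 2 := by rwa [← dist_eq_norm]
    have h0 := hz t ht
    have hne : z₀ - t ≠ 0 := norm_pos_iff.mp (hr.trans_le h0)
    have hre : 0 < ((z - t) / (z₀ - t)).re := by
      refine re_div_pos_of_norm_sub_lt ?_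
      have : z - t - (z₀ - t) = z - z₀ := by ring
      rw [this]; linarith
    have hne' : z - t ≠ 0 := by
      intro h; rw [h] at hre; simp at hre
    have hd := (((hasDerivAt_id z).sub_const t).div_const (z₀ - t)).clog (Or.inl hre)
    refine hd.congr_deriv ?_
    simp only [id]
    field_simp

/-- On the closed upper half-plane |arg| = arg, so increments of the potential are imaginary parts
of a holomorphic function with derivative ∫ (z₀ - t)⁻¹ dν. Real points are allowed, which is what
makes gaps crossable. -/
theorem potential_sub_potential [IsFiniteMeasure ν] (hK : ∀ᵐ t ∂ν, t ∈ cantorK) {z₀ : ℂ}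
    {r : ℝ} (hr : 0 < r) (hz : ∀ t ∈ cantorK, r ≤ ‖z₀ - t‖) (him : 0 ≤ z₀.im) {z : ℂ}
    (hzr : z ∈ Metric.ball z₀ (r / 2)) (hzim : 0 ≤ z.im) :
    potential ν z - potential ν z₀ =
      (2 * Real.pi)⁻¹ * (∫ t, Complex.log ((z - t) / (z₀ - t)) ∂ν).im := by
  have hint := (hasDerivAt_integral_log hK hr hz).2 z hzr
  have h1 : (∫ t, Complex.log ((z - t) / (z₀ - t)) ∂ν).im =
      ∫ t, (Complex.log ((z - t) / (z₀ - t))).im ∂ν := by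
    have := integral_im hint
    simpa using this.symm
  rw [potential, potential, ← mul_sub, h1,
    ← integral_sub (integrable_abs_arg_sub z) (integrable_abs_arg_sub z₀)]
  congr 1
  refine integral_congr_ae ?_
  filter_upwards [hK] with t ht
  have hti := im_eq_zero_of_mem_cantorK ht
  have hzt : ‖z - z₀‖ < r / 2 := by rwa [← dist_eq_norm]
  have h0 := hz t ht
  have hne : z₀ - t ≠ 0 := norm_pos_iff.mp (hr.trans_le h0)
  have hre : 0 < ((z - t) / (z₀ - t)).re := by
    refine re_div_pos_of_norm_sub_lt ?_
    have : z - t - (z₀ - t) = z - z₀ := by ring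
    rw [this]; linarith
  have hne' : z - t ≠ 0 := by
    intro h; rw [h] at hre; simp at hre
  have i1 : 0 ≤ (z - t).im := by rw [Complex.sub_im, hti]; linarith
  have i2 : 0 ≤ (z₀ - t).im := by rw [Complex.sub_im, hti]; linarith
  rw [Complex.log_im, ← arg_sub_arg_eq_arg_div hne' hne i1 i2 hre,
    abs_of_nonneg (Complex.arg_nonneg_iff.mpr i1), abs_of_nonneg (Complex.arg_nonneg_iff.mpr i2)]

theorem norm_cauchyTransform (z : ℂ) :
    ‖cauchyTransform ν z‖ = (2 * Real.pi)⁻¹ * ‖∫ t, (z - t)⁻¹ ∂ν‖ := by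
  rw [cauchyTransform, norm_mul, norm_inv]
  congr 2
  simp [abs_of_pos Real.pi_pos]

/-- The slope of `potential` at a point is at most the modulus of the Cauchy transform. -/
theorem eventually_abs_potential_sub_le [IsFiniteMeasure ν] (hK : ∀ᵐ t ∂ν, t ∈ cantorK) {z₀ : ℂ}
    (hz₀ : z₀ ∉ cantorK) {ε : ℝ} (hε : 0 < ε) :
    ∀ᶠ z in 𝓝 z₀, |potential ν z - potential ν z₀| ≤ (‖cauchyTransform ν z₀‖ + ε) * ‖z - z₀‖ := by
  -- The potential and |f| are both invariant under conjugation, since ν is carried by the real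
  -- axis.
  wlog him : 0 ≤ z₀.im generalizing z₀
  · have h1 := this (conj_not_mem_cantorK hz₀) (by rw [Complex.conj_im]; linarith)
    have h2 := (Complex.continuous_conj.tendsto z₀).eventually h1
    filter_upwards [h2] with z hz
    rwa [potential_conj hK, potential_conj hK, norm_cauchyTransform_conj hK, ← map_sub,
      RCLike.norm_conj] at hz
  obtain ⟨r, hr, hz⟩ := exists_dist_cantorK hz₀
  have hd := (hasDerivAt_integral_log hK hr hz).1
  have hpi : 0 < (2 * Real.pi)⁻¹ := by positivity
  have hlo := hd.isLittleO.def (c := 2 * Real.pi * ε) (by positivity)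
  have key : ∀ᶠ z in 𝓝 z₀, 0 ≤ z.im →
      |potential ν z - potential ν z₀| ≤ (‖cauchyTransform ν z₀‖ + ε) * ‖z - z₀‖ := by
    filter_upwards [hlo, Metric.ball_mem_nhds z₀ (half_pos hr)] with z h1 h2 h3
    rw [potential_sub_potential hK hr hz him h2 h3, abs_mul, abs_of_pos hpi, norm_cauchyTransform]
    have h0 : ∫ t, Complex.log ((z₀ - t) / (z₀ - t)) ∂ν = 0 := by
      rw [integral_eq_zero_of_ae]
      filter_upwards [hK] with t ht
      have hne : z₀ - t ≠ 0 := norm_pos_iff.mp (hr.trans_le (hz t ht))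
      simp [div_self hne]
    rw [h0, sub_zero, smul_eq_mul] at h1
    have h4 := (Complex.abs_im_le_norm (∫ t, Complex.log ((z - t) / (z₀ - t)) ∂ν))
    have h5 := norm_le_norm_add_norm_sub' (∫ t, Complex.log ((z - t) / (z₀ - t)) ∂ν)
      ((z - z₀) * ∫ t, (z₀ - t)⁻¹ ∂ν)
    rw [norm_mul] at h5
    calc _ ≤ (2 * Real.pi)⁻¹ * (‖z - z₀‖ * ‖∫ t, (z₀ - t)⁻¹ ∂ν‖ + 2 * Real.pi * ε * ‖z - z₀‖) := by
          refine mul_le_mul_of_nonneg_left ?_ hpi.le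
          linarith
      _ = _ := by field_simp
  rcases him.lt_or_eq with him | him
  · have h1 : ∀ᶠ z : ℂ in 𝓝 z₀, 0 < z.im :=
      Complex.continuous_im.continuousAt.eventually (lt_mem_nhds him)
    filter_upwards [key, h1] with z h2 h3 using h2 h3.le
  -- Now z₀ lies on the real axis: nearby points below the axis are reflected into the closed upper
  -- half-plane, where `key` applies.
  · have hconj : (starRingEnd ℂ) z₀ = z₀ := Complex.conj_eq_iff_im.mpr him.symm
    have h1 : Tendsto (starRingEnd ℂ) (𝓝 z₀) (𝓝 z₀) := by
      have := Complex.continuous_conj.tendsto z₀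
      rwa [hconj] at this
    filter_upwards [key, h1.eventually key] with z h2 h3
    rcases le_total 0 z.im with h4 | h4
    · exact h2 h4
    · have h5 := h3 (by rw [Complex.conj_im]; linarith)
      rw [potential_conj hK] at h5
      have h6 : ‖(starRingEnd ℂ) z - z₀‖ = ‖z - z₀‖ := by
        rw [← RCLike.norm_conj, map_sub, Complex.conj_conj, hconj]
      rwa [h6] at h5

theorem continuousAt_cauchyTransform [IsFiniteMeasure ν] (hK : ∀ᵐ t ∂ν, t ∈ cantorK) {z₀ : ℂ}
    (hz₀ : z₀ ∉ cantorK) : ContinuousAt (cauchyTransform ν) z₀ := by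
  obtain ⟨r, hr, hz⟩ := exists_dist_cantorK hz₀
  refine ContinuousAt.mul continuousAt_const ?_
  refine continuousAt_of_dominated (bound := fun _ => (r / 2)⁻¹)
    (Eventually.of_forall fun z =>
      ((measurable_const.sub measurable_id).inv).aestronglyMeasurable) ?_ (integrable_const _) ?_
  · filter_upwards [Metric.ball_mem_nhds z₀ (half_pos hr)] with z hzr
    filter_upwards [hK] with t ht
    have hzt : ‖z - z₀‖ < r / 2 := by rwa [← dist_eq_norm]
    rw [norm_inv]
    refine inv_anti₀ (half_pos hr) ?_
    have h1 := hz t ht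
    have h2 : ‖z₀ - t‖ ≤ ‖z - t‖ + ‖z - z₀‖ := by
      have : z₀ - t = (z - t) - (z - z₀) := by ring
      rw [this]; exact norm_sub_le _ _
    linarith
  · filter_upwards [hK] with t ht
    have hne : z₀ - t ≠ 0 := norm_pos_iff.mp (hr.trans_le (hz t ht))
    exact (continuousAt_id.sub continuousAt_const).inv₀ hne

/-! ### From slopes to lengths of arcs -/

/-- A continuous function whose slope at each `t` is at most `C |f(γ t)| |γ' t|` varies along the arc
by at most `C` times its log-euclidean length. -/
theorem SmoothArc.edist_le_mul_length [IsFiniteMeasure ν] (hK : ∀ᵐ t ∂ν, t ∈ cantorK)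
    {z w : Omega} (γ : SmoothArc z w) {ω : ℝ → ℝ} (hω : ContinuousOn ω (Icc 0 1)) {C : NNReal}
    (h : ∀ t ∈ Ico (0 : ℝ) 1, ∀ ε > 0, ∀ᶠ s in 𝓝[>] t,
      |ω s - ω t| ≤ C * ((‖cauchyTransform ν (γ.ext t)‖ + ε) * ‖γ.ext s - γ.ext t‖)) :
    edist (ω 0) (ω 1) ≤ C * γ.length ν := by
  set g : ℝ → ℝ := fun t => ‖cauchyTransform ν (γ.ext t)‖ * ‖deriv γ.ext t‖ with hg
  have hcext : Continuous γ.ext := γ.contDiff.continuous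
  have hcder : Continuous (deriv γ.ext) := γ.contDiff.continuous_deriv le_rfl
  have hmem : ∀ t ∈ Icc (0 : ℝ) 1, γ.ext t ∉ cantorK := fun t ht => by
    rw [← γ.ext_eq ⟨t, ht⟩]; exact (γ.path ⟨t, ht⟩).2
  have hgc : ContinuousOn g (Icc 0 1) := fun t ht =>
    (((continuousAt_cauchyTransform hK (hmem t ht)).comp hcext.continuousAt).norm.mul
      hcder.norm.continuousAt).continuousWithinAt
  have hmain : |ω 1 - ω 0| ≤ C * ∫ t in (0 : ℝ)..1, g t := by
    have hB : ContinuousOn (fun x => C * ∫ t in (0 : ℝ)..x, g t) (Icc 0 1) := by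
      refine continuousOn_const.mul ?_
      have := intervalIntegral.continuousOn_primitive_interval (μ := volume) (f := g)
        (a := 0) (b := 1) (by
          rw [uIcc_of_le zero_le_one]
          exact hgc.integrableOn_Icc)
      rwa [uIcc_of_le zero_le_one] at this
    -- The function ω need not be differentiable; a bound on its right slopes by the derivative of C
    -- ∫ g is enough for the mean value inequality.
    have := image_le_of_liminf_slope_right_le_deriv_boundary (f := fun x => |ω x - ω 0|)
      (a := 0) (b := 1) (B := fun x => C * ∫ t in (0 : ℝ)..x, g t) (B' := fun x => C * g x)
      ((hω.sub continuousOn_const).abs) (by simp) hB ?_ ?_ (right_mem_Icc.mpr zero_le_one)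
    · exact this
    · intro x hx
      refine HasDerivWithinAt.const_mul _ ?_
      refine intervalIntegral.integral_hasDerivWithinAt_right (s := Ici x) (t := Ioi x) ?_ ?_ ?_
      · refine ContinuousOn.intervalIntegrable ?_
        rw [uIcc_of_le hx.1]
        exact hgc.mono (Icc_subset_Icc_right hx.2.le)
      · refine ⟨Ioc x 1, ?_, ?_⟩
        · exact Ioc_mem_nhdsGT hx.2
        · exact (hgc.mono (fun y hy => ⟨hx.1.trans hy.1.le, hy.2⟩)).aestronglyMeasurable
            measurableSet_Ioc
      · have h1 : ContinuousAt g x :=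
          ((continuousAt_cauchyTransform hK (hmem x ⟨hx.1, hx.2.le⟩)).comp
            hcext.continuousAt).norm.mul hcder.norm.continuousAt
        exact h1.continuousWithinAt
    · intro x hx r hr
      -- One ε absorbs both the error of the slope bound and that of the linear approximation of the
      -- arc.
      have hcont : Tendsto (fun ε : ℝ => C * ((‖cauchyTransform ν (γ.ext x)‖ + ε) *
          (‖deriv γ.ext x‖ + ε))) (𝓝[>] 0) (𝓝 (C * g x)) := by
        have : Continuous fun ε : ℝ => C * ((‖cauchyTransform ν (γ.ext x)‖ + ε) *
          (‖deriv γ.ext x‖ + ε)) := by fun_prop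
        have h2 := this.tendsto 0
        simp only [add_zero] at h2
        exact h2.mono_left nhdsWithin_le_nhds
      obtain ⟨ε, hε1, hε⟩ := ((hcont.eventually (gt_mem_nhds hr)).and self_mem_nhdsWithin).exists
      have hε : 0 < ε := hε
      have hder : HasDerivAt γ.ext (deriv γ.ext x) x :=
        ((γ.contDiff.differentiable one_ne_zero) x).hasDerivAt
      have h3 := (hder.isLittleO.def hε).filter_mono (nhdsWithin_le_nhds (s := Ioi x))
      refine Eventually.frequently ?_
      filter_upwards [h x hx ε hε, h3, self_mem_nhdsWithin] with s hs1 hs2 hs3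
      have hs3 : 0 < s - x := sub_pos.mpr hs3
      refine lt_of_le_of_lt ?_ hε1
      rw [slope_def_field, div_le_iff₀ hs3]
      have h4 : ‖γ.ext s - γ.ext x‖ ≤ (‖deriv γ.ext x‖ + ε) * (s - x) := by
        have h5 := norm_le_norm_add_norm_sub' (γ.ext s - γ.ext x) ((s - x) • deriv γ.ext x)
        rw [norm_smul, Real.norm_eq_abs, abs_of_pos hs3] at h5
        rw [Real.norm_eq_abs, abs_of_pos hs3] at hs2
        linarith
      have h6 : |ω s - ω 0| - |ω x - ω 0| ≤ |ω s - ω x| := by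
        have := abs_sub_abs_le_abs_sub (ω s - ω 0) (ω x - ω 0)
        simpa using this
      refine h6.trans (hs1.trans ?_)
      rw [mul_assoc, mul_assoc]
      gcongr
  have hint : ENNReal.ofReal (∫ t in (0 : ℝ)..1, g t) = γ.length ν := by
    rw [intervalIntegral.integral_of_le zero_le_one, ← integral_Icc_eq_integral_Ioc,
      ofReal_integral_eq_lintegral_ofReal hgc.integrableOn_Icc
        (Eventually.of_forall fun t => by positivity)]
    refine lintegral_congr fun t => ?_
    rw [hg, ENNReal.ofReal_mul (norm_nonneg _), ofReal_norm, ofReal_norm]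
  rw [edist_comm, edist_dist, Real.dist_eq, ← hint]
  refine (ENNReal.ofReal_le_ofReal hmain).trans_eq ?_
  rw [ENNReal.ofReal_mul C.coe_nonneg, ENNReal.ofReal_coe_nnreal]

theorem lipschitzWith_potential [IsFiniteMeasure ν] (hK : ∀ᵐ t ∂ν, t ∈ cantorK) :
    LipschitzWith 1 (fun z : Surface ν => potential ν (show Omega from z)) := by
  refine lipschitzWith_chain (X := Omega) fun z w => ?_
  rw [ENNReal.coe_one, one_mul]
  refine le_iInf fun γ => ?_
  have hmem : ∀ t ∈ Icc (0 : ℝ) 1, γ.ext t ∉ cantorK := fun t ht => by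
    rw [← γ.ext_eq ⟨t, ht⟩]; exact (γ.path ⟨t, ht⟩).2
  have hslope := fun t (ht : t ∈ Icc (0 : ℝ) 1) (ε : ℝ) (hε : 0 < ε) =>
    γ.contDiff.continuous.continuousAt.eventually
      (eventually_abs_potential_sub_le (ν := ν) hK (hmem t ht) hε)
  have h := γ.edist_le_mul_length (ν := ν) hK (ω := fun t => potential ν (γ.ext t)) (C := 1) ?_ ?_
  · have e0 : γ.ext 0 = z := by
      have := γ.ext_eq 0; rw [γ.path.source] at this; exact this.symm
    have e1 : γ.ext 1 = w := by
      have := γ.ext_eq 1; rw [γ.path.target] at this; exact this.symm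
    rw [e0, e1] at h
    simpa using h
  · intro t ht
    refine ContinuousAt.continuousWithinAt ?_
    rw [ContinuousAt, tendsto_iff_norm_sub_tendsto_zero]
    have h1 : Tendsto (fun s => (‖cauchyTransform ν (γ.ext t)‖ + 1) * ‖γ.ext s - γ.ext t‖) (𝓝 t)
        (𝓝 0) := by
      have : Continuous fun s => (‖cauchyTransform ν (γ.ext t)‖ + 1) * ‖γ.ext s - γ.ext t‖ := by
        have := γ.contDiff.continuous
        fun_prop
      simpa using this.tendsto t
    exact tendsto_of_tendsto_of_tendsto_of_le_of_le' tendsto_const_nhds h1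
      (Eventually.of_forall fun _ => norm_nonneg _) (hslope t ht 1 one_pos)
  · intro t ht ε hε
    rw [NNReal.coe_one]
    simp only [one_mul]
    exact (hslope t ⟨ht.1, ht.2.le⟩ ε hε).filter_mono nhdsWithin_le_nhds

end Potential

/-! ### The chosen tips, the atoms between them, and the values of the potential on gaps. -/

section Geometry

/-! ### Points of the Cantor set that are badly approximated by end-points -/

theorem exists_int_of_mem_stageEndpoints {k : ℕ} {e : ℝ} (he : e ∈ stageEndpoints k) :
    ∃ n : ℤ, e * 3 ^ k = n := by
  induction k generalizing e with
  | zero =>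
    rcases he with rfl | rfl
    · exact ⟨0, by simp⟩
    · exact ⟨1, by simp⟩
  | succ k ih =>
    rcases he with ⟨t, ht, rfl⟩ | ⟨t, ht, rfl⟩ <;> obtain ⟨n, hn⟩ := ih ht
    · exact ⟨n, by rw [← hn]; ring⟩
    · exact ⟨2 * 3 ^ k + n, by push_cast; rw [← hn]; ring⟩

theorem div_three_mem_cantorSet {t : ℝ} (ht : t ∈ cantorSet) : t / 3 ∈ cantorSet := by
  rw [cantorSet_eq_union_halves]; exact Or.inl ⟨t, ht, rfl⟩

theorem two_add_div_three_mem_cantorSet {t : ℝ} (ht : t ∈ cantorSet) :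
    (2 + t) / 3 ∈ cantorSet := by
  rw [cantorSet_eq_union_halves]; exact Or.inr ⟨t, ht, rfl⟩

theorem stageEndpoints_subset_cantorSet (k : ℕ) : stageEndpoints k ⊆ cantorSet := by
  induction k with
  | zero =>
    rintro e (rfl | rfl)
    · exact zero_mem_cantorSet
    · refine Set.mem_iInter.mpr fun n => ?_
      induction n with
      | zero => simp
      | succ n ih => rw [preCantorSet_succ]; exact Or.inr ⟨1, ih, by norm_num⟩
  | succ k ih =>
    rintro e (⟨t, ht, rfl⟩ | ⟨t, ht, rfl⟩)
    · exact div_three_mem_cantorSet (ih ht)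
    · exact two_add_div_three_mem_cantorSet (ih ht)

/-- m is the centre of the middle third of the stage-k interval that contains t: half that interval
has length 3⁻ᵏ/2 and half its middle third 3⁻ᵏ/6. Self-similarity of the Cantor set gives the
induction. -/
theorem exists_gap {t : ℝ} (ht : t ∈ cantorSet) (k : ℕ) :
    ∃ m ∈ Icc (0 : ℝ) 1, |t - m| ≤ (1 / 3) ^ k / 2 ∧ ∀ c ∈ cantorSet, (1 / 3) ^ k / 6 ≤ |m - c| := by
  induction k generalizing t with
  | zero =>
    have h1 := cantorSet_subset_unitInterval ht
    refine ⟨1 / 2, ⟨by norm_num, by norm_num⟩, ?_, fun c hc => ?_⟩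
    · rw [abs_le]; constructor <;> linarith [h1.1, h1.2]
    · rw [cantorSet_eq_union_halves] at hc
      rcases hc with ⟨d, hd, rfl⟩ | ⟨d, hd, rfl⟩ <;> have h2 := cantorSet_subset_unitInterval hd
      · exact le_trans (by simp only; linarith [h2.2]) (le_abs_self _)
      · exact le_trans (by simp only; linarith [h2.1]) (neg_le_abs _)
  | succ k ih =>
    have hk : (1 / 3 : ℝ) ^ k ≤ 1 := pow_le_one₀ (by norm_num) (by norm_num)
    rw [cantorSet_eq_union_halves] at ht
    rcases ht with ⟨s, hs, rfl⟩ | ⟨s, hs, rfl⟩ <;> obtain ⟨m, hm, h1, h2⟩ := ih hs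
    · refine ⟨m / 3, ⟨by linarith [hm.1], by linarith [hm.2]⟩, ?_, fun c hc => ?_⟩
      · have : s / 3 - m / 3 = (s - m) / 3 := by ring
        simp only
        rw [this, abs_div, abs_of_pos (by norm_num : (0 : ℝ) < 3), pow_succ]
        linarith
      · rw [cantorSet_eq_union_halves] at hc
        rcases hc with ⟨d, hd, rfl⟩ | ⟨d, hd, rfl⟩
        · have h3 := h2 d hd
          have : m / 3 - d / 3 = (m - d) / 3 := by ring
          simp only
          rw [this, abs_div, abs_of_pos (by norm_num : (0 : ℝ) < 3), pow_succ]
          linarith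
        · have h4 := cantorSet_subset_unitInterval hd
          refine le_trans ?_ (neg_le_abs _)
          rw [pow_succ]; simp only; linarith [hm.2, h4.1]
    · refine ⟨(2 + m) / 3, ⟨by linarith [hm.1], by linarith [hm.2]⟩, ?_, fun c hc => ?_⟩
      · have : (2 + s) / 3 - (2 + m) / 3 = (s - m) / 3 := by ring
        simp only
        rw [this, abs_div, abs_of_pos (by norm_num : (0 : ℝ) < 3), pow_succ]
        linarith
      · rw [cantorSet_eq_union_halves] at hc
        rcases hc with ⟨d, hd, rfl⟩ | ⟨d, hd, rfl⟩
        · have h4 := cantorSet_subset_unitInterval hd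
          refine le_trans ?_ (le_abs_self _)
          rw [pow_succ]; simp only; linarith [hm.1, h4.2]
        · have h3 := h2 d hd
          have : (2 + m) / 3 - (2 + d) / 3 = (m - d) / 3 := by ring
          simp only
          rw [this, abs_div, abs_of_pos (by norm_num : (0 : ℝ) < 3), pow_succ]
          linarith

/-- The points `1/4 - 9⁻ʲ/2`, which increase to `1/4`; in base `3` the digits of the corresponding
points of `[0, 1]` are `(20)ʲ02020…`. -/
def tipSeq (j : ℕ) : ℝ := 1 / 4 - (1 / 9) ^ j / 2

/-- End-points of removed intervals that separate the points `tipSeq j`. -/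
def sepSeq (j : ℕ) : ℝ := 1 / 4 - (1 / 9) ^ j * (5 / 12)

/-- 3ᵏ e is an integer n, so 3ᵏ (3/4 - e) = (3ᵏ⁺¹ - 4n)/4 has an odd numerator. -/
theorem quarter_nice (k : ℕ) {e : ℝ} (he : e ∈ stageEndpoints k) :
    (1 / 3) ^ k / 12 ≤ |(1 / 4 : ℝ) + 1 / 2 - e| := by
  obtain ⟨n, hn⟩ := exists_int_of_mem_stageEndpoints he
  have h3 : (0 : ℝ) < 3 ^ k := by positivity
  have hodd : (1 : ℤ) ≤ |3 ^ (k + 1) - 4 * n| := by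
    apply Int.one_le_abs
    have h1 : Odd ((3 : ℤ) ^ (k + 1)) := Odd.pow (by decide)
    obtain ⟨r, hr⟩ := h1
    omega
  have hodd' : (1 : ℝ) ≤ |(3 : ℝ) ^ (k + 1) - 4 * (n : ℝ)| := by exact_mod_cast hodd
  have h5 : (1 / 4 : ℝ) + 1 / 2 - e = (3 ^ (k + 1) - 4 * n) / (4 * 3 ^ k) := by
    rw [← hn]; field_simp; ring
  rw [h5, abs_div, abs_of_pos (by positivity : (0 : ℝ) < 4 * 3 ^ k), one_div, inv_pow,
    le_div_iff₀ (by positivity)]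
  field_simp
  linarith

/-- Write 3ᵏ (3/4 - 9⁻ʲ/2) - n as an odd integer over 4 when k ≥ 2j. For k < 2j the perturbation 3ᵏ
9⁻ʲ/2 is at most 1/6, and 1/4 - 1/6 = 1/12. The bound does not depend on j. -/
theorem tipSeq_nice (j k : ℕ) {e : ℝ} (he : e ∈ stageEndpoints k) :
    (1 / 3) ^ k / 12 ≤ |tipSeq j + 1 / 2 - e| := by
  obtain ⟨n, hn⟩ := exists_int_of_mem_stageEndpoints he
  have h3 : (0 : ℝ) < 3 ^ k := by positivity
  have key : (1 : ℝ) / 12 ≤ |3 ^ k * (tipSeq j + 1 / 2) - n| := by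
    rcases le_or_gt (2 * j) k with h | h
    · have hodd : (1 : ℤ) ≤ |3 ^ (k + 1) - 2 * 3 ^ (k - 2 * j) - 4 * n| := by
        apply Int.one_le_abs
        have h1 : Odd ((3 : ℤ) ^ (k + 1)) := Odd.pow (by decide)
        obtain ⟨r, hr⟩ := h1
        omega
      have hodd' : (1 : ℝ) ≤ |(3 : ℝ) ^ (k + 1) - 2 * 3 ^ (k - 2 * j) - 4 * (n : ℝ)| := by exact_mod_cast hodd
      have h9 : (3 : ℝ) ^ k * (1 / 9) ^ j = 3 ^ (k - 2 * j) := by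
        obtain ⟨d, rfl⟩ := Nat.exists_eq_add_of_le h
        rw [Nat.add_sub_cancel_left, pow_add, pow_mul, mul_right_comm, ← mul_pow]
        norm_num
      have h5 : (3 : ℝ) ^ k * (tipSeq j + 1 / 2) - n =
          (3 ^ (k + 1) - 2 * 3 ^ (k - 2 * j) - 4 * n) / 4 := by
        rw [tipSeq, ← h9]; ring
      rw [h5, abs_div, abs_of_pos (by norm_num : (0 : ℝ) < 4)]
      linarith
    · have hodd : (1 : ℤ) ≤ |3 ^ (k + 1) - 4 * n| := by
        apply Int.one_le_abs
        have h1 : Odd ((3 : ℤ) ^ (k + 1)) := Odd.pow (by decide)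
        obtain ⟨r, hr⟩ := h1
        omega
      have hodd' : (1 : ℝ) ≤ |(3 : ℝ) ^ (k + 1) - 4 * (n : ℝ)| := by exact_mod_cast hodd
      have h9 : (3 : ℝ) ^ k * (1 / 9) ^ j ≤ 1 / 3 := by
        have h6 : (3 : ℝ) ^ (k + 1) ≤ 3 ^ (2 * j) := pow_le_pow_right₀ (by norm_num) h
        rw [pow_mul, pow_succ] at h6
        norm_num at h6
        rw [one_div, inv_pow, ← div_eq_mul_inv, div_le_iff₀ (by positivity)]
        linarith
      have h10 : (0 : ℝ) < 3 ^ k * (1 / 9) ^ j := by positivity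
      have h5 : (3 : ℝ) ^ k * (tipSeq j + 1 / 2) - n =
          (3 ^ (k + 1) - 4 * n) / 4 - 3 ^ k * (1 / 9) ^ j / 2 := by
        rw [tipSeq]; ring
      rw [h5]
      refine le_trans ?_ (abs_sub_abs_le_abs_sub _ _)
      rw [abs_div, abs_of_pos (by norm_num : (0 : ℝ) < 4), abs_of_pos (half_pos h10)]
      linarith
  have h5 : tipSeq j + 1 / 2 - e = (3 ^ k * (tipSeq j + 1 / 2) - n) / 3 ^ k := by
    rw [← hn]; field_simp
  rw [h5, abs_div, abs_of_pos h3, one_div, inv_pow, le_div_iff₀ h3]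
  have h6 : ((3 : ℝ) ^ k)⁻¹ / 12 * 3 ^ k = 1 / 12 := by field_simp
  rwa [h6]

theorem tipSeq_succ (j : ℕ) :
    tipSeq (j + 1) + 1 / 2 = (2 + (tipSeq j + 1 / 2) / 3) / 3 := by
  rw [tipSeq, tipSeq, pow_succ]; ring

theorem tipSeq_mem_cantorSet (j : ℕ) : tipSeq j + 1 / 2 ∈ cantorSet := by
  induction j with
  | zero => convert quarter_mem_cantorSet using 1; norm_num [tipSeq]
  | succ j ih =>
    rw [tipSeq_succ]
    exact two_add_div_three_mem_cantorSet (div_three_mem_cantorSet ih)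

theorem sepSeq_mem_stageEndpoints (j : ℕ) : sepSeq j + 1 / 2 ∈ stageEndpoints (2 * j + 1) := by
  induction j with
  | zero => exact Or.inl ⟨1, by simp [stageEndpoints], by norm_num [sepSeq]⟩
  | succ j ih =>
    refine Or.inr ⟨(sepSeq j + 1 / 2) / 3, Or.inl ⟨_, ih, rfl⟩, ?_⟩
    simp only [sepSeq, pow_succ]; ring

theorem tipSeq_lt_sepSeq (j : ℕ) : tipSeq j < sepSeq j := by
  have : (0 : ℝ) < (1 / 9) ^ j := by positivity
  rw [tipSeq, sepSeq]; linarith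

theorem sepSeq_lt_tipSeq (j : ℕ) : sepSeq j < tipSeq (j + 1) := by
  have : (0 : ℝ) < (1 / 9) ^ j := by positivity
  rw [tipSeq, sepSeq, pow_succ]; linarith

theorem strictMono_tipSeq : StrictMono tipSeq :=
  strictMono_nat_of_lt_succ fun j => (tipSeq_lt_sepSeq j).trans (sepSeq_lt_tipSeq j)

theorem strictMono_sepSeq : StrictMono sepSeq :=
  strictMono_nat_of_lt_succ fun j => (sepSeq_lt_tipSeq j).trans (tipSeq_lt_sepSeq (j + 1))

theorem tipSeq_lt (j : ℕ) : tipSeq j < 1 / 4 := by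
  have : (0 : ℝ) < (1 / 9) ^ j := by positivity
  rw [tipSeq]; linarith

theorem tendsto_tipSeq : Tendsto tipSeq atTop (𝓝 (1 / 4)) := by
  have h : Tendsto tipSeq atTop (𝓝 (1 / 4 - 0 / 2)) :=
    tendsto_const_nhds.sub
      ((tendsto_pow_atTop_nhds_zero_of_lt_one (by norm_num) (by norm_num)).div_const _)
  simpa using h

theorem mem_cantorK_of_add_half {x : ℝ} (h : x + 1 / 2 ∈ cantorSet) : (x : ℂ) ∈ cantorK :=
  ⟨_, h, by simp⟩

/-! ### The atomic measure -/

variable {lam : ℕ → ℝ} {x : (k : ℕ) → Fin (2 ^ k) → ℝ}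

theorem lintegral_atomicMeasure (g : ℂ → ℝ≥0∞) (hg : Measurable g) :
    ∫⁻ t, g t ∂atomicMeasure lam x =
      ∑' k, ∑ l : Fin (2 ^ k), ENNReal.ofReal (lam k) * g (x k l : ℝ) := by
  rw [atomicMeasure, lintegral_sum_measure]
  congr 1 with k
  rw [lintegral_finsetSum_measure]
  refine Finset.sum_congr rfl fun l _ => ?_
  rw [lintegral_smul_measure, lintegral_dirac' _ hg, smul_eq_mul]

theorem ae_atomicMeasure {p : ℂ → Prop} (h : ∀ k l, p (x k l : ℝ)) (hp : MeasurableSet {t | p t}) :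
    ∀ᵐ t ∂atomicMeasure lam x, p t := by
  have h1 := lintegral_atomicMeasure (lam := lam) (x := x) ({t | p t}ᶜ.indicator 1)
    (measurable_one.indicator hp.compl)
  rw [lintegral_indicator_one hp.compl] at h1
  rw [ae_iff]
  refine h1.trans ?_
  simp [h]

theorem isFiniteMeasure_atomicMeasure
    (hsum : HasSum (fun k => 2 ^ k * lam k) 1) : IsFiniteMeasure (atomicMeasure lam x) := by
  refine ⟨?_⟩
  have h1 := lintegral_atomicMeasure (lam := lam) (x := x) 1 measurable_one
  simp only [Pi.one_apply, lintegral_one] at h1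
  rw [h1]
  simp only [mul_one, Finset.sum_const, Finset.card_univ, Fintype.card_fin,
    nsmul_eq_mul]
  have h2 : ∀ k, ((2 ^ k : ℕ) : ℝ≥0∞) * ENNReal.ofReal (lam k) = ENNReal.ofReal (2 ^ k * lam k) := by
    intro k
    rw [ENNReal.ofReal_mul (by positivity), ENNReal.ofReal_pow (by norm_num)]
    simp
  simp only [h2]
  exact hsum.summable.tsum_ofReal_lt_top

theorem atomicMeasure_singleton_pos (hpos : ∀ k, 0 < lam k) (k : ℕ) (l : Fin (2 ^ k)) :
    0 < atomicMeasure lam x {(x k l : ℂ)} := by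
  have h1 := lintegral_atomicMeasure (lam := lam) (x := x) (({(x k l : ℂ)} : Set ℂ).indicator 1)
    (measurable_one.indicator (measurableSet_singleton _))
  rw [lintegral_indicator_one (measurableSet_singleton _)] at h1
  rw [h1]
  refine lt_of_lt_of_le ?_ (ENNReal.le_tsum k)
  refine lt_of_lt_of_le ?_ (Finset.single_le_sum (fun _ _ => zero_le) (Finset.mem_univ l))
  simpa using hpos k

/-- `x` is a point of the Cantor set at which the potential `∫ dν(t) / |x - t|` is at most `M`. -/
structure Nice (ν : Measure ℂ) (M : ℝ) (x : ℝ) : Prop where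
  mem : (x : ℂ) ∈ cantorK
  ae_ne : ∀ᵐ t ∂ν, t ≠ (x : ℂ)
  integrable : Integrable (fun t : ℂ => ‖(x : ℂ) - t‖⁻¹) ν
  integral_le : ∫ t : ℂ, ‖(x : ℂ) - t‖⁻¹ ∂ν ≤ M

/-- The 2ᵏ atoms of weight λₖ, at distance at least 3⁻ᵏ/12, contribute at most 12 λₖ 6ᵏ, which is
summable because 2κ > 6. The constant M is the same for all such points, so that all steps of the
sequences can be estimated together. -/
theorem exists_nice (hpos : ∀ k, 0 < lam k) {κ : ℝ} (hκ : 3 < κ)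
    (hfast : Summable fun k => lam k * (2 * κ) ^ k) (hx : IsEndpointEnumeration x) :
    ∃ M : ℝ, ∀ y : ℝ, (y : ℂ) ∈ cantorK →
      (∀ k, ∀ e ∈ stageEndpoints k, (1 / 3) ^ k / 12 ≤ |y + 1 / 2 - e|) →
      Nice (atomicMeasure lam x) M y := by
  have h6 : Summable fun k => 12 * (lam k * 6 ^ k) := by
    refine (Summable.of_nonneg_of_le (fun k => ?_) (fun k => ?_) hfast).mul_left 12
    · have := hpos k; positivity
    · have := (hpos k).le
      gcongr
      linarith
  refine ⟨∑' k, 12 * (lam k * 6 ^ k), fun y hy hyn => ?_⟩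
  have hatom : ∀ k l, (1 / 3 : ℝ) ^ k / 12 ≤ ‖(y : ℂ) - (x k l : ℝ)‖ := fun k l => by
    rw [← Complex.ofReal_sub, Complex.norm_real, Real.norm_eq_abs]
    have := hyn k _ (hx.mem k l)
    rwa [add_sub_add_right_eq_sub] at this
  have hmeas : Measurable fun t : ℂ => ‖(y : ℂ) - t‖⁻¹ :=
    ((measurable_const.sub measurable_id).norm).inv
  have hbound : ∫⁻ t, ENNReal.ofReal ‖(y : ℂ) - t‖⁻¹ ∂atomicMeasure lam x ≤
      ENNReal.ofReal (∑' k, 12 * (lam k * 6 ^ k)) := by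
    rw [lintegral_atomicMeasure _ hmeas.ennreal_ofReal, ENNReal.ofReal_tsum_of_nonneg
      (fun k => by have := hpos k; positivity) h6]
    refine ENNReal.tsum_le_tsum fun k => ?_
    have h1 : ∀ l ∈ (Finset.univ : Finset (Fin (2 ^ k))), ENNReal.ofReal (lam k) *
        ENNReal.ofReal ‖(y : ℂ) - (x k l : ℝ)‖⁻¹ ≤ ENNReal.ofReal (lam k * (12 * 3 ^ k)) := by
      intro l _
      rw [← ENNReal.ofReal_mul (hpos k).le]
      refine ENNReal.ofReal_le_ofReal (mul_le_mul_of_nonneg_left ?_ (hpos k).le)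
      have h2 := inv_anti₀ (by positivity) (hatom k l)
      refine h2.trans_eq ?_
      rw [one_div, inv_pow]; field_simp
    refine (Finset.sum_le_card_nsmul _ _ _ h1).trans_eq ?_
    rw [Finset.card_univ, Fintype.card_fin, nsmul_eq_mul,
      show ((2 ^ k : ℕ) : ℝ≥0∞) = ENNReal.ofReal (2 ^ k) by
        rw [ENNReal.ofReal_pow (by norm_num)]; simp,
      ← ENNReal.ofReal_mul (by positivity)]
    congr 1
    rw [show (6 : ℝ) = 2 * 3 by norm_num, mul_pow]; ring
  have hint : Integrable (fun t : ℂ => ‖(y : ℂ) - t‖⁻¹) (atomicMeasure lam x) := by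
    refine ⟨hmeas.aestronglyMeasurable, ?_⟩
    rw [hasFiniteIntegral_iff_ofReal (Eventually.of_forall fun t => by positivity)]
    exact hbound.trans_lt ENNReal.ofReal_lt_top
  refine ⟨hy, ?_, hint, ?_⟩
  · refine ae_atomicMeasure (fun k l h => ?_) (measurableSet_singleton _).compl
    have h1 := hatom k l
    rw [h, sub_self, norm_zero] at h1
    have : (0 : ℝ) < (1 / 3) ^ k / 12 := by positivity
    linarith
  · rw [← ENNReal.ofReal_le_ofReal_iff (tsum_nonneg fun k => by have := hpos k; positivity),
      ofReal_integral_eq_lintegral_ofReal hint (Eventually.of_forall fun t => by positivity)]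
    exact hbound

variable {ν : Measure ℂ} {M : ℝ} {y : ℝ}

theorem Nice.nonneg (h : Nice ν M y) : 0 ≤ M :=
  (integral_nonneg fun t => by positivity).trans h.integral_le

/-- The source of all length estimates: if each point of K is at most A times farther from y than
from ζ, the integrand at ζ is dominated by A times the integrable one at y. -/
theorem Nice.norm_cauchyTransform_le (h : Nice ν M y) (hK : ∀ᵐ t ∂ν, t ∈ cantorK) {A : ℝ}
    (hA : 0 ≤ A) {ζ : ℂ} (hζ : ∀ t ∈ cantorK, ‖(y : ℂ) - t‖ ≤ A * ‖ζ - t‖) :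
    ‖cauchyTransform ν ζ‖ ≤ A * M := by
  rw [norm_cauchyTransform]
  have h1 : ‖∫ t, (ζ - t)⁻¹ ∂ν‖ ≤ ∫ t, A * ‖(y : ℂ) - t‖⁻¹ ∂ν := by
    refine norm_integral_le_of_norm_le (h.integrable.const_mul A) ?_
    filter_upwards [hK, h.ae_ne] with t ht hne
    have h2 := hζ t ht
    have h3 : 0 < ‖(y : ℂ) - t‖ := norm_pos_iff.mpr (sub_ne_zero.mpr hne.symm)
    have h4 : 0 < ‖ζ - t‖ := by
      rcases (norm_nonneg (ζ - t)).eq_or_lt with h5 | h5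
      · rw [← h5, mul_zero] at h2; linarith
      · exact h5
    rw [norm_inv, ← div_eq_mul_inv, inv_le_iff_one_le_mul₀ h4, div_mul_eq_mul_div,
      one_le_div h3]
    exact h2
  rw [integral_const_mul] at h1
  have h2 : (2 * Real.pi)⁻¹ ≤ 1 := inv_le_one_of_one_le₀ (by linarith [Real.two_le_pi])
  calc _ ≤ 1 * ‖∫ t, (ζ - t)⁻¹ ∂ν‖ := by gcongr
    _ ≤ A * M := by
      rw [one_mul]
      exact h1.trans (mul_le_mul_of_nonneg_left h.integral_le hA)

theorem norm_ofReal_sub_le {t : ℂ} (ht : t ∈ cantorK) (y s : ℝ) :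
    ‖(y : ℂ) - t‖ ≤ ‖(y + s * Complex.I : ℂ) - t‖ := by
  have hti := im_eq_zero_of_mem_cantorK ht
  have h1 : (y : ℂ) - t = (((y + s * Complex.I : ℂ) - t).re : ℂ) := by
    apply Complex.ext <;> simp [hti]
  rw [h1, Complex.norm_real, Real.norm_eq_abs]
  exact Complex.abs_re_le_norm _

/-- Points of the vertical line are at least as far from K as y is, so ‖y - t‖⁻¹ dominates; f is
continuous along the whole line, y included, and its primitive is the required extension. -/
theorem Nice.mem_G₁ (h : Nice ν M y) (hK : ∀ᵐ t ∂ν, t ∈ cantorK) : y ∈ G₁ ν := by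
  have hc : Continuous fun s : ℝ => Complex.I * cauchyTransform ν (y + s * Complex.I) := by
    refine continuous_const.mul (continuous_const.mul ?_)
    refine continuous_of_dominated (bound := fun t => ‖(y : ℂ) - t‖⁻¹)
      (fun s => ((measurable_const.sub measurable_id).inv).aestronglyMeasurable) (fun s => ?_)
      h.integrable ?_
    · filter_upwards [hK, h.ae_ne] with t ht hne
      rw [norm_inv]
      exact inv_anti₀ (norm_pos_iff.mpr (sub_ne_zero.mpr hne.symm)) (norm_ofReal_sub_le ht y s)
    · filter_upwards [hK, h.ae_ne] with t ht hne
      refine Continuous.inv₀ (by fun_prop) fun s hs => ?_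
      have h1 := norm_ofReal_sub_le ht y s
      rw [hs, norm_zero] at h1
      exact hne (sub_eq_zero.mp (norm_le_zero_iff.mp h1)).symm
  refine ⟨h.mem, fun s => ∫ r in (0 : ℝ)..s, Complex.I * cauchyTransform ν (y + r * Complex.I), ?_,
    fun s _ => ?_⟩
  · exact intervalIntegral.continuous_primitive (fun a b => hc.intervalIntegrable a b) 0
  · exact intervalIntegral.integral_hasDerivAt_right (hc.intervalIntegrable _ _)
      (hc.stronglyMeasurableAtFilter _ _) hc.continuousAt

/-! ### Values of the potential on the real axis -/

/-- For real m off K the argument of m - t is π when t is to the right and 0 when it is to the left.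
-/
theorem potential_eq_measureReal [IsFiniteMeasure ν] (hK : ∀ᵐ t ∂ν, t ∈ cantorK) {m : ℝ}
    (hm : (m : ℂ) ∉ cantorK) : potential ν m = ν.real {t | m < t.re} / 2 := by
  have hS : MeasurableSet {t : ℂ | m < t.re} := measurableSet_lt measurable_const Complex.measurable_re
  have h1 : ∫ t, |((m : ℂ) - t).arg| ∂ν = ∫ t, {t : ℂ | m < t.re}.indicator (fun _ => Real.pi) t ∂ν := by
    refine integral_congr_ae ?_
    filter_upwards [hK] with t ht
    have hti := im_eq_zero_of_mem_cantorK ht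
    have ht' : t = (t.re : ℂ) := Complex.ext rfl (by simp [hti])
    have hne : m ≠ t.re := fun h => hm (by rw [h, ← ht']; exact ht)
    by_cases h : m < t.re
    · rw [indicator_of_mem (by exact h), ht', ← Complex.ofReal_sub,
        Complex.arg_ofReal_of_neg (by simpa using h), abs_of_pos Real.pi_pos]
    · rw [indicator_of_notMem (by exact h), ht', ← Complex.ofReal_sub,
        Complex.arg_ofReal_of_nonneg (by simp at h ⊢; exact h), abs_zero]
  rw [potential, h1, integral_indicator_const _ hS, smul_eq_mul]
  have := Real.pi_pos
  field_simp

theorem potential_le_of_lt [IsFiniteMeasure ν] (hK : ∀ᵐ t ∂ν, t ∈ cantorK) {m p : ℝ}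
    (hm : (m : ℂ) ∉ cantorK) (hpm : p < m) : potential ν m ≤ ν.real {t | p < t.re} / 2 := by
  rw [potential_eq_measureReal hK hm]
  have := measureReal_mono (μ := ν) (s₁ := {t : ℂ | m < t.re}) (s₂ := {t : ℂ | p < t.re})
    (fun t ht => hpm.trans ht)
  linarith

/-- With `potential_le_of_lt` this gives the drop of at least ν{p}/2 across an atom p. -/
theorem le_potential_of_lt [IsFiniteMeasure ν] (hK : ∀ᵐ t ∂ν, t ∈ cantorK) {m p : ℝ}
    (hm : (m : ℂ) ∉ cantorK) (hpm : m < p) :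
    (ν.real {t | p < t.re} + ν.real {(p : ℂ)}) / 2 ≤ potential ν m := by
  rw [potential_eq_measureReal hK hm]
  have hd : Disjoint {t : ℂ | p < t.re} {(p : ℂ)} := by
    rw [Set.disjoint_singleton_right]; simp
  rw [← measureReal_union hd (measurableSet_singleton _)]
  have := measureReal_mono (μ := ν) (s₁ := {t : ℂ | p < t.re} ∪ {(p : ℂ)})
    (s₂ := {t : ℂ | m < t.re}) (by
      rintro t (ht | rfl)
      · exact hpm.trans ht
      · simpa using hpm)
  linarith

end Geometry

/-! ### Lengths of straight paths in the universal covering, gap crossings, and tips. -/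

section Arcs

/-! ### Straight arcs and homotopies in convex sets -/

/-- The straight arc from `z` to `w`. -/
def segArc (z w : Omega) (h : ∀ t ∈ Icc (0 : ℝ) 1, (z : ℂ) + t * (w - z) ∉ cantorK) :
    SmoothArc z w where
  path :=
    { toFun := fun t => ⟨z + ((t : ℝ) : ℂ) * (w - z), h t t.2⟩
      continuous_toFun := by fun_prop
      source' := by ext; simp
      target' := by ext; simp }
  ext t := z + (t : ℂ) * (w - z)
  contDiff := contDiff_const.add (Complex.ofRealCLM.contDiff.mul contDiff_const)
  ext_eq _ := rfl

theorem segArc_length_le {ν : Measure ℂ} {z w : Omega}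
    (h : ∀ t ∈ Icc (0 : ℝ) 1, (z : ℂ) + t * (w - z) ∉ cantorK) {B : ℝ} (hB : 0 ≤ B)
    (hf : ∀ t ∈ Icc (0 : ℝ) 1, ‖cauchyTransform ν (z + t * (w - z))‖ ≤ B) :
    (segArc z w h).length ν ≤ ENNReal.ofReal (B * ‖(w : ℂ) - z‖) := by
  have hd : ∀ t, deriv (segArc z w h).ext t = w - z := fun t => by
    have h1 : HasDerivAt (fun t : ℝ => (z : ℂ) + (t : ℂ) * (w - z)) (1 * (w - z)) t :=
      ((Complex.ofRealCLM.hasDerivAt (x := t)).mul_const _).const_add _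
    rw [one_mul] at h1
    exact h1.deriv
  calc (segArc z w h).length ν
      ≤ ∫⁻ _ in Icc (0 : ℝ) 1, ENNReal.ofReal (B * ‖(w : ℂ) - z‖) := by
        refine setLIntegral_mono' measurableSet_Icc fun t ht => ?_
        rw [hd, ENNReal.ofReal_mul hB, ofReal_norm]
        gcongr
        rw [← ofReal_norm]
        exact ENNReal.ofReal_le_ofReal (hf t ht)
    _ = _ := by simp

theorem homotopic_of_convex {z w : Omega} {p q : Path z w} {S : Set ℂ} (hS : Convex ℝ S)
    (hSK : ∀ ζ ∈ S, ζ ∉ cantorK) (hp : ∀ t, (p t : ℂ) ∈ S) (hq : ∀ t, (q t : ℂ) ∈ S) :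
    p.Homotopic q := by
  have hmem : ∀ r : unitInterval × unitInterval,
      (1 - (r.1 : ℝ)) • (p r.2 : ℂ) + (r.1 : ℝ) • (q r.2 : ℂ) ∈ S := fun r =>
    hS (hp r.2) (hq r.2) (by linarith [r.1.2.2]) r.1.2.1 (by ring)
  refine ⟨⟨⟨⟨fun r => ⟨_, hSK _ (hmem r)⟩, by fun_prop⟩, fun t => ?_, fun t => ?_⟩, ?_⟩⟩
  · ext; simp
  · ext; simp
  · rintro s t (rfl | rfl)
    · ext; simp; ring
    · ext; simp; ring

/-- For σ ≠ 0 this is an open half-plane with the base point 0 added. It is disjoint from K and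
contains the segments from 0, so paths in it keep the label of a lift. -/
theorem convex_halfPlane (σ : ℝ) : Convex ℝ {z : ℂ | 0 < σ * z.im ∨ z = 0} := by
  rintro z hz w hw a b ha hb hab
  simp only [mem_ofPred_eq, Complex.add_im, Complex.smul_im, smul_eq_mul] at *
  rcases hz with hz | rfl <;> rcases hw with hw | rfl
  · left
    rcases ha.eq_or_lt with rfl | ha
    · rw [zero_add] at hab; subst hab; simpa using hw
    · have h1 : 0 < a * (σ * z.im) := mul_pos ha hz
      have h2 : 0 ≤ b * (σ * w.im) := mul_nonneg hb hw.le
      linarith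
  · rcases ha.eq_or_lt with rfl | ha
    · right; simp
    · left
      have h1 : 0 < a * (σ * z.im) := mul_pos ha hz
      simp; linarith
  · rcases hb.eq_or_lt with rfl | hb
    · right; simp
    · left
      have h1 : 0 < b * (σ * w.im) := mul_pos hb hw
      simp; linarith
  · right; simp

theorem not_mem_cantorK_of_halfPlane {σ : ℝ} {z : ℂ} (hz : 0 < σ * z.im ∨ z = 0) :
    z ∉ cantorK := by
  rcases hz with hz | rfl
  · exact not_mem_cantorK_of_im fun h => by rw [h, mul_zero] at hz; exact lt_irrefl _ hz
  · exact zero_not_mem_cantorK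

variable {ν : Measure ℂ}

theorem edist_univCover_le {α β : UnivCover ν} (γ : SmoothArc α.1 β.1)
    (h : α.2.trans (Path.Homotopic.Quotient.mk γ.path) = β.2) : edist α β ≤ γ.length ν :=
  (edist_chain_le _ _ _).trans (iInf₂_le γ h)

theorem lipschitzWith_proj :
    LipschitzWith 1 (fun α : UnivCover ν => (show Surface ν from α.proj)) := by
  refine lipschitzWith_chain (X := Σ z : Omega, Path.Homotopic.Quotient base z)
    (Y := Surface ν) fun α β => ?_
  rw [ENNReal.coe_one, one_mul]
  refine le_iInf₂ fun γ _ => ?_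
  exact (edist_chain_le _ _ _).trans (iInf_le _ γ)

/-- The opposite of a nonzero real number. -/
def negNe (y : {y : ℝ // y ≠ 0}) : {y : ℝ // y ≠ 0} := ⟨-y, neg_ne_zero.mpr y.2⟩

theorem segment_mem_halfPlane {x x' : ℝ} {y y' : {y : ℝ // y ≠ 0}} (hy : 0 < (y : ℝ) * y')
    {t : ℝ} (ht : t ∈ Icc (0 : ℝ) 1) :
    0 < (y : ℝ) * ((vertPt x y : ℂ) + t * (vertPt x' y' - vertPt x y)).im := by
  have h1 : ((vertPt x y : ℂ) + t * (vertPt x' y' - vertPt x y)).im = (1 - t) * y + t * y' := by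
    simp [vertPt]; ring
  rw [h1]
  have h2 : 0 < (y : ℝ) * y := mul_self_pos.mpr y.2
  rcases ht.1.eq_or_lt with h3 | h3
  · rw [← h3]; linarith
  · have h4 := mul_pos h3 hy
    have h5 := mul_nonneg (sub_nonneg.mpr ht.2) h2.le
    linarith

/-- The condition on y and y' places both points on the same side of the axis. The triangle with
vertices 0 and these points is contractible in ℂ - K, so the straight segment lifts without changing
g. -/
theorem edist_liftPt_le (g : Path.Homotopic.Quotient base base) {x x' : ℝ}
    {y y' : {y : ℝ // y ≠ 0}} (hy : 0 < (y : ℝ) * y') {B : ℝ} (hB : 0 ≤ B)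
    (hf : ∀ t ∈ Icc (0 : ℝ) 1,
      ‖cauchyTransform ν ((vertPt x y : ℂ) + t * (vertPt x' y' - vertPt x y))‖ ≤ B) :
    edist (liftPt ν g x y) (liftPt ν g x' y') ≤
      ENNReal.ofReal (B * ‖(vertPt x' y' : ℂ) - vertPt x y‖) := by
  have hseg : ∀ t ∈ Icc (0 : ℝ) 1, (vertPt x y : ℂ) + t * (vertPt x' y' - vertPt x y) ∉ cantorK :=
    fun t ht => not_mem_cantorK_of_halfPlane (Or.inl (segment_mem_halfPlane hy ht))
  refine (edist_univCover_le (segArc _ _ hseg) ?_).trans (segArc_length_le hseg hB hf)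
  change (g.trans (Path.Homotopic.Quotient.mk (segPath x y))).trans
    (Path.Homotopic.Quotient.mk (segArc _ _ hseg).path) =
    g.trans (Path.Homotopic.Quotient.mk (segPath x' y'))
  rw [Path.Homotopic.Quotient.trans_assoc, ← Path.Homotopic.Quotient.mk_trans]
  congr 1
  refine Path.Homotopic.Quotient.eq.mpr ?_
  refine homotopic_of_convex (convex_halfPlane (y : ℝ))
    (fun ζ hζ => not_mem_cantorK_of_halfPlane hζ) (fun t => ?_) (fun t => ?_)
  · rw [Path.trans_apply]
    split_ifs with h
    · simp only [segPath, Path.coe_mk_mk, mem_ofPred_eq]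
      by_cases ht : (t : ℝ) = 0
      · right; simp [ht]
      · left
        have h2 : 0 < (y : ℝ) * y := mul_self_pos.mpr y.2
        have h3 : 0 < (t : ℝ) := lt_of_le_of_ne t.2.1 (Ne.symm ht)
        have h4 := mul_pos h3 h2
        simp; linarith
    · exact Or.inl (segment_mem_halfPlane hy ⟨by linarith, by linarith [t.2.2]⟩)
  · simp only [segPath, Path.coe_mk_mk, mem_ofPred_eq]
    by_cases ht : (t : ℝ) = 0
    · right; simp [ht]
    · left
      have h3 : 0 < (t : ℝ) := lt_of_le_of_ne t.2.1 (Ne.symm ht)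
      have h4 := mul_pos h3 hy
      simp; linarith

variable {M x x' : ℝ}

theorem Nice.edist_liftPt_vertical (h : Nice ν M x) (hK : ∀ᵐ t ∂ν, t ∈ cantorK)
    (g : Path.Homotopic.Quotient base base) {y y' : {y : ℝ // y ≠ 0}} (hy : 0 < (y : ℝ) * y') :
    edist (liftPt ν g x y) (liftPt ν g x y') ≤ ENNReal.ofReal (M * |(y' : ℝ) - y|) := by
  refine (edist_liftPt_le g hy h.nonneg fun t ht => ?_).trans_eq ?_
  · have h1 := h.norm_cauchyTransform_le hK zero_le_one
      (ζ := (vertPt x y : ℂ) + t * (vertPt x y' - vertPt x y)) fun s hs => ?_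
    · rwa [one_mul] at h1
    · rw [one_mul]
      have h2 := norm_ofReal_sub_le hs x ((1 - t) * y + t * y')
      convert h2 using 3
      simp [vertPt]; ring
  · congr 2
    have : (vertPt x y' : ℂ) - vertPt x y = ((y' - y : ℝ) : ℂ) * Complex.I := by
      simp [vertPt]; ring
    rw [this, norm_mul, Complex.norm_I, mul_one, Complex.norm_real, Real.norm_eq_abs]

/-- Descend to depth H, move horizontally, and come up again. At depth H one has |x - t| ≤ 2H + |ζ -
t| ≤ 3 |ζ - t|, so the three pieces cost at most M H, 3 M H and M H. -/
theorem Nice.edist_liftPt_lower (h : Nice ν M x) (h' : Nice ν M x') (hK : ∀ᵐ t ∂ν, t ∈ cantorK)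
    (g : Path.Homotopic.Quotient base base) {y y' : {y : ℝ // y ≠ 0}} (hy : (y : ℝ) < 0)
    (hy' : (y' : ℝ) < 0) :
    edist (liftPt ν g x y) (liftPt ν g x' y') ≤
      ENNReal.ofReal (5 * M * (|x - x'| + |(y : ℝ)| + |(y' : ℝ)|)) := by
  set H : ℝ := |x - x'| + |(y : ℝ)| + |(y' : ℝ)| with hH
  have hM := h.nonneg
  have hypos : 0 < |(y : ℝ)| := abs_pos.mpr y.2
  have hypos' : 0 < |(y' : ℝ)| := abs_pos.mpr y'.2
  have hxx := abs_nonneg (x - x')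
  have hHpos : 0 < H := by linarith
  let Y : {y : ℝ // y ≠ 0} := ⟨-H, by linarith⟩
  have hY : (Y : ℝ) = -H := rfl
  have e1 := h.edist_liftPt_vertical hK g (y := y) (y' := Y) (by rw [hY]; nlinarith)
  have e3 := h'.edist_liftPt_vertical hK g (y := Y) (y' := y') (by rw [hY]; nlinarith)
  have e2 : edist (liftPt ν g x Y) (liftPt ν g x' Y) ≤ ENNReal.ofReal (3 * M * |x - x'|) := by
    have hdiff : (vertPt x' Y : ℂ) - vertPt x Y = ((x' - x : ℝ) : ℂ) := by simp [vertPt]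
    refine (edist_liftPt_le g (by rw [hY]; nlinarith) (B := 3 * M) (by positivity)
      fun t ht => ?_).trans_eq ?_
    · refine h.norm_cauchyTransform_le hK (by norm_num) fun s hs => ?_
      rw [hdiff]
      have hsi := im_eq_zero_of_mem_cantorK hs
      have h1 : H ≤ ‖(vertPt x Y : ℂ) + t * ((x' - x : ℝ) : ℂ) - s‖ := by
        refine le_trans ?_ (Complex.abs_im_le_norm _)
        have : ((vertPt x Y : ℂ) + t * ((x' - x : ℝ) : ℂ) - s).im = -H := by
          simp [vertPt, hsi, hY]
        rw [this, abs_neg]; exact le_abs_self _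
      have h2 : ‖(x : ℂ) - ((vertPt x Y : ℂ) + t * ((x' - x : ℝ) : ℂ))‖ ≤ 2 * H := by
        have : (x : ℂ) - ((vertPt x Y : ℂ) + t * ((x' - x : ℝ) : ℂ)) =
            (H : ℂ) * Complex.I + ((t * (x - x') : ℝ) : ℂ) := by
          simp [vertPt, hY]; ring
        rw [this]
        refine (norm_add_le _ _).trans ?_
        rw [norm_mul, Complex.norm_I, mul_one, Complex.norm_real, Complex.norm_real,
          Real.norm_eq_abs, Real.norm_eq_abs, abs_of_pos hHpos, abs_mul, abs_of_nonneg ht.1]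
        have := mul_le_of_le_one_left hxx ht.2
        linarith
      have h3 := norm_sub_le_norm_sub_add_norm_sub (x : ℂ)
        ((vertPt x Y : ℂ) + t * ((x' - x : ℝ) : ℂ)) s
      linarith
    · rw [hdiff, Complex.norm_real, Real.norm_eq_abs, abs_sub_comm]
  have a1 : |(Y : ℝ) - y| ≤ H := by
    rw [hY, abs_le]
    rw [abs_of_neg hy] at hH hypos
    constructor <;> linarith
  have a3 : |(y' : ℝ) - Y| ≤ H := by
    rw [hY, abs_le]
    rw [abs_of_neg hy'] at hH hypos'
    constructor <;> linarith
  have hxH : |x - x'| ≤ H := by linarith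
  calc edist (liftPt ν g x y) (liftPt ν g x' y')
      ≤ edist (liftPt ν g x y) (liftPt ν g x Y) + edist (liftPt ν g x Y) (liftPt ν g x' Y) +
        edist (liftPt ν g x' Y) (liftPt ν g x' y') := edist_triangle4 _ _ _ _
    _ ≤ ENNReal.ofReal (M * H) + ENNReal.ofReal (3 * M * H) + ENNReal.ofReal (M * H) := by
        refine add_le_add (add_le_add (e1.trans ?_) (e2.trans ?_)) (e3.trans ?_) <;>
        exact ENNReal.ofReal_le_ofReal (by gcongr)
    _ = _ := by
        rw [← ENNReal.ofReal_add (by positivity) (by positivity),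
          ← ENNReal.ofReal_add (by positivity) (by positivity)]
        congr 1; ring

/-! ### Crossing a gap of the Cantor set -/

/-- A real point outside the Cantor set. -/
def realPt (m : ℝ) (hm : (m : ℂ) ∉ cantorK) : Omega := ⟨m, hm⟩

theorem segment_to_realPt (x m : ℝ) (hm : (m : ℂ) ∉ cantorK) (y : {y : ℝ // y ≠ 0}) :
    ∀ t ∈ Icc (0 : ℝ) 1, (vertPt x y : ℂ) + t * (realPt m hm - vertPt x y) ∉ cantorK := by
  intro t _
  by_cases h1 : t = 1
  · rw [h1]; simpa [realPt] using hm
  · refine not_mem_cantorK_of_im ?_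
    have : ((vertPt x y : ℂ) + t * (realPt m hm - vertPt x y)).im = (1 - t) * y := by
      simp [vertPt, realPt]; ring
    rw [this]
    exact mul_ne_zero (sub_ne_zero.mpr (Ne.symm h1)) y.2

theorem segment_from_realPt (x m : ℝ) (hm : (m : ℂ) ∉ cantorK) (y : {y : ℝ // y ≠ 0}) :
    ∀ t ∈ Icc (0 : ℝ) 1, (realPt m hm : ℂ) + t * (vertPt x y - realPt m hm) ∉ cantorK := by
  intro t ht
  have := segment_to_realPt x m hm y (1 - t) ⟨by linarith [ht.2], by linarith [ht.1]⟩
  convert this using 1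
  push_cast
  ring_nf

/-- The loop that goes from `0` to `x - iy`, crosses the real axis at `m` towards `x + iy` and comes
back to `0`. -/
def crossLoop (x m : ℝ) (hm : (m : ℂ) ∉ cantorK) (y : {y : ℝ // y ≠ 0}) :
    Path.Homotopic.Quotient base base :=
  ((Path.Homotopic.Quotient.mk (segPath x (negNe y))).trans
    ((Path.Homotopic.Quotient.mk (segArc _ _ (segment_to_realPt x m hm (negNe y))).path).trans
      (Path.Homotopic.Quotient.mk (segArc _ _ (segment_from_realPt x m hm y)).path))).trans
    (Path.Homotopic.Quotient.mk (segPath x y)).symm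

theorem trans_crossLoop (g : Path.Homotopic.Quotient base base) (x m : ℝ) (hm : (m : ℂ) ∉ cantorK)
    (y : {y : ℝ // y ≠ 0}) :
    ((g.trans (Path.Homotopic.Quotient.mk (segPath x (negNe y)))).trans
      (Path.Homotopic.Quotient.mk (segArc _ _ (segment_to_realPt x m hm (negNe y))).path)).trans
      (Path.Homotopic.Quotient.mk (segArc _ _ (segment_from_realPt x m hm y)).path) =
    (g.trans (crossLoop x m hm y)).trans (Path.Homotopic.Quotient.mk (segPath x y)) := by
  simp only [crossLoop, Path.Homotopic.Quotient.trans_assoc, Path.Homotopic.Quotient.symm_trans,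
    Path.Homotopic.Quotient.trans_refl]

/-- A point ζ of the segment from m to x + is is at distance at least h/18 from K: for r ≥ 1/18
through its imaginary part, for r ≤ 1/18 because it is within h/12 of m, itself at distance h/6 from
K. As |x - ζ| ≤ 2h, the ratio is at most 2 · 18 + 1 = 37. -/
theorem norm_sub_le_of_gap {x m h r : ℝ} (hh : 0 < h) (hxm : |x - m| ≤ h / 2)
    (hgap : ∀ t ∈ cantorK, h / 6 ≤ ‖(m : ℂ) - t‖) {s : ℝ} (hs : |s| = h) (hr : r ∈ Icc (0 : ℝ) 1)
    {ζ : ℂ} (hζ : ζ = m + r * (x + s * Complex.I - m)) {t : ℂ} (ht : t ∈ cantorK) :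
    ‖(x : ℂ) - t‖ ≤ 37 * ‖ζ - t‖ := by
  have hti := im_eq_zero_of_mem_cantorK ht
  have hd : ‖(x + s * Complex.I - m : ℂ)‖ ≤ 3 / 2 * h := by
    have : (x + s * Complex.I - m : ℂ) = ((x - m : ℝ) : ℂ) + s * Complex.I := by push_cast; ring
    rw [this]
    refine (norm_add_le _ _).trans ?_
    rw [norm_mul, Complex.norm_I, mul_one, Complex.norm_real, Complex.norm_real, Real.norm_eq_abs,
      Real.norm_eq_abs, hs]
    linarith
  have hmζ : ‖(m : ℂ) - ζ‖ ≤ r * (3 / 2 * h) := by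
    have : (m : ℂ) - ζ = -((r : ℂ) * (x + s * Complex.I - m)) := by rw [hζ]; ring
    rw [this, norm_neg, norm_mul, Complex.norm_real, Real.norm_eq_abs, abs_of_nonneg hr.1]
    exact mul_le_mul_of_nonneg_left hd hr.1
  have hlow : h / 18 ≤ ‖ζ - t‖ := by
    rcases le_total (1 / 18) r with h1 | h1
    · refine le_trans ?_ (Complex.abs_im_le_norm _)
      have : (ζ - t).im = r * s := by rw [hζ]; simp [hti]
      rw [this, abs_mul, hs, abs_of_nonneg hr.1]
      have := mul_le_mul_of_nonneg_right h1 hh.le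
      linarith
    · have h2 := hgap t ht
      have h3 := norm_sub_le_norm_sub_add_norm_sub (m : ℂ) ζ t
      have h4 := mul_le_mul_of_nonneg_right h1 (by positivity : 0 ≤ 3 / 2 * h)
      linarith
  have hxζ : ‖(x : ℂ) - ζ‖ ≤ 2 * h := by
    have h1 := norm_sub_le_norm_sub_add_norm_sub (x : ℂ) m ζ
    rw [← Complex.ofReal_sub, Complex.norm_real, Real.norm_eq_abs] at h1
    have h2 := mul_le_mul_of_nonneg_right hr.2 (by positivity : 0 ≤ 3 / 2 * h)
    linarith
  have h5 := norm_sub_le_norm_sub_add_norm_sub (x : ℂ) ζ t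
  linarith

theorem norm_vertPt_sub_le {x m h : ℝ} (hxm : |x - m| ≤ h / 2) {y : {y : ℝ // y ≠ 0}}
    (hy : |(y : ℝ)| = h) : ‖(vertPt x y : ℂ) - m‖ ≤ 3 / 2 * h := by
  have : (vertPt x y : ℂ) - m = ((x - m : ℝ) : ℂ) + (y : ℝ) * Complex.I := by
    simp [vertPt]; ring
  rw [this]
  refine (norm_add_le _ _).trans ?_
  rw [norm_mul, Complex.norm_I, mul_one, Complex.norm_real, Complex.norm_real, Real.norm_eq_abs,
    Real.norm_eq_abs, hy]
  linarith

/-- The lift of a real point `m` reached from `x + iy` by a straight segment. -/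
def gapPt (ν : Measure ℂ) (g : Path.Homotopic.Quotient base base) (x m : ℝ)
    (hm : (m : ℂ) ∉ cantorK) (y : {y : ℝ // y ≠ 0}) : UnivCover ν :=
  ⟨realPt m hm, (g.trans (Path.Homotopic.Quotient.mk (segPath x y))).trans
    (Path.Homotopic.Quotient.mk (segArc _ _ (segment_to_realPt x m hm y)).path)⟩

theorem Nice.edist_liftPt_gapPt (h : Nice ν M x) (hK : ∀ᵐ t ∂ν, t ∈ cantorK)
    (g : Path.Homotopic.Quotient base base) {m : ℝ} (hm : (m : ℂ) ∉ cantorK)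
    {y : {y : ℝ // y ≠ 0}} (hxm : |x - m| ≤ |(y : ℝ)| / 2)
    (hgap : ∀ t ∈ cantorK, |(y : ℝ)| / 6 ≤ ‖(m : ℂ) - t‖) :
    edist (liftPt ν g x y) (gapPt ν g x m hm y) ≤
      ENNReal.ofReal (37 * M * (3 / 2 * |(y : ℝ)|)) := by
  have hM := h.nonneg
  refine (edist_univCover_le (α := liftPt ν g x y) (β := gapPt ν g x m hm y)
    (segArc _ _ (segment_to_realPt x m hm y)) rfl).trans ?_
  refine (segArc_length_le _ (B := 37 * M) (by positivity) fun r hr => ?_).trans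
    (ENNReal.ofReal_le_ofReal ?_)
  · refine h.norm_cauchyTransform_le hK (by norm_num) fun t ht => ?_
    refine norm_sub_le_of_gap (r := 1 - r) (s := (y : ℝ)) (abs_pos.mpr y.2) hxm hgap rfl
      ⟨by linarith [hr.2], by linarith [hr.1]⟩ ?_ ht
    change (vertPt x y : ℂ) + r * (realPt m hm - vertPt x y) = _
    simp [vertPt, realPt]; ring
  · gcongr
    rw [norm_sub_rev]
    exact norm_vertPt_sub_le hxm rfl

/-- Two segments of length at most 3h/2 meet at the gap point, with |f| ≤ 37 M on them, whence 111 =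
2 · 37 · 3/2. Coming up through the gap replaces the label g by g times the crossing loop. -/
theorem Nice.edist_liftPt_cross (h : Nice ν M x) (hK : ∀ᵐ t ∂ν, t ∈ cantorK)
    (g : Path.Homotopic.Quotient base base) {m : ℝ} (hm : (m : ℂ) ∉ cantorK)
    {y : {y : ℝ // y ≠ 0}} (hy : 0 < (y : ℝ)) (hxm : |x - m| ≤ y / 2)
    (hgap : ∀ t ∈ cantorK, (y : ℝ) / 6 ≤ ‖(m : ℂ) - t‖) :
    edist (liftPt ν g x (negNe y)) (liftPt ν (g.trans (crossLoop x m hm y)) x y) ≤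
      ENNReal.ofReal (111 * M * y) := by
  have hM := h.nonneg
  let β : UnivCover ν := gapPt ν g x m hm (negNe y)
  have hneg : |(negNe y : ℝ)| = y := by simp [negNe, abs_of_pos hy]
  have e1 : edist (liftPt ν g x (negNe y)) β ≤ ENNReal.ofReal (37 * M * (3 / 2 * y)) := by
    have := h.edist_liftPt_gapPt hK g hm (y := negNe y) (by rwa [hneg]) (by rwa [hneg])
    rwa [hneg] at this
  have e2 : edist β (liftPt ν (g.trans (crossLoop x m hm y)) x y) ≤
      ENNReal.ofReal (37 * M * (3 / 2 * y)) := by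
    refine (edist_univCover_le (α := β) (β := liftPt ν (g.trans (crossLoop x m hm y)) x y)
      (segArc _ _ (segment_from_realPt x m hm y)) (trans_crossLoop g x m hm y)).trans ?_
    refine (segArc_length_le _ (B := 37 * M) (by positivity) fun r hr => ?_).trans
      (ENNReal.ofReal_le_ofReal ?_)
    · refine h.norm_cauchyTransform_le hK (by norm_num) fun t ht => ?_
      refine norm_sub_le_of_gap (r := r) (s := (y : ℝ)) hy hxm hgap (abs_of_pos hy) hr ?_ ht
      change (realPt m hm : ℂ) + r * (vertPt x y - realPt m hm) = _
      simp [vertPt, realPt]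
    · gcongr
      exact norm_vertPt_sub_le hxm (abs_of_pos hy)
  refine (edist_triangle _ β _).trans ((add_le_add e1 e2).trans_eq ?_)
  rw [← ENNReal.ofReal_add (by positivity) (by positivity)]
  congr 1; ring

/-- The length of the segment to the gap bounds the variation of the 1-Lipschitz potential. -/
theorem Nice.abs_potential_sub_gap_le [IsFiniteMeasure ν] (h : Nice ν M x)
    (hK : ∀ᵐ t ∂ν, t ∈ cantorK) {m : ℝ} (hm : (m : ℂ) ∉ cantorK) {y : {y : ℝ // y ≠ 0}}
    (hxm : |x - m| ≤ |(y : ℝ)| / 2) (hgap : ∀ t ∈ cantorK, |(y : ℝ)| / 6 ≤ ‖(m : ℂ) - t‖) :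
    |potential ν (vertPt x y) - potential ν m| ≤ 37 * M * (3 / 2 * |(y : ℝ)|) := by
  have hM := h.nonneg
  have h1 := h.edist_liftPt_gapPt hK (.refl _) hm hxm hgap
  have h2 := ((lipschitzWith_potential hK).comp (lipschitzWith_proj (ν := ν)))
    (liftPt ν (.refl _) x y) (gapPt ν (.refl _) x m hm y)
  rw [mul_one, ENNReal.coe_one, one_mul] at h2
  have h3 := h2.trans h1
  rw [edist_dist, ENNReal.ofReal_le_ofReal_iff (by positivity)] at h3
  exact h3

/-! ### Existence of tips -/

theorem tendsto_ofReal_mul_abs (C : ℝ) (S : Set ℝ) :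
    Tendsto (fun y : {y : ℝ // y ≠ 0} => ENNReal.ofReal (C * |(y : ℝ)|))
      (comap Subtype.val (𝓝[S] (0 : ℝ))) (𝓝 0) := by
  have h1 : Tendsto (fun y : ℝ => ENNReal.ofReal (C * |y|)) (𝓝 0) (𝓝 0) := by
    have : Continuous fun y : ℝ => ENNReal.ofReal (C * |y|) :=
      ENNReal.continuous_ofReal.comp (by fun_prop)
    simpa using this.tendsto 0
  exact (h1.mono_left nhdsWithin_le_nhds).comp tendsto_comap

/-- The sequence `1 / (n + 1)` with a sign. -/
def signedInv (σ : ℝ) (hσ : σ ≠ 0) (n : ℕ) : {y : ℝ // y ≠ 0} :=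
  ⟨σ * (1 / ((n : ℝ) + 1)), mul_ne_zero hσ (by positivity)⟩

theorem tendsto_signedInv (C σ : ℝ) (hσ : σ ≠ 0) :
    Tendsto (fun n => ENNReal.ofReal (C * |(signedInv σ hσ n : ℝ)|)) atTop (𝓝 0) := by
  have h1 : Tendsto (fun n : ℕ => C * |σ * (1 / ((n : ℝ) + 1))|) atTop (𝓝 0) := by
    have := ((tendsto_one_div_add_atTop_nhds_zero_nat (𝕜 := ℝ)).const_mul σ).abs.const_mul C
    simpa using this
  have := ENNReal.tendsto_ofReal h1
  rwa [ENNReal.ofReal_zero] at this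

theorem Nice.exists_sided_tip (h : Nice ν M x) (hK : ∀ᵐ t ∂ν, t ∈ cantorK)
    (g : Path.Homotopic.Quotient base base) (σ : ℝ) (hσ : σ ≠ 0) :
    ∃ p : CauchyCompletion (UnivCover ν),
      (∀ y : {y : ℝ // y ≠ 0}, 0 < σ * y →
        edist (toCompletion (liftPt ν g x y)) p ≤ ENNReal.ofReal (M * |(y : ℝ)|)) ∧
      Tendsto (fun y : {y : ℝ // y ≠ 0} => toCompletion (liftPt ν g x y))
        (comap Subtype.val (𝓝[{y | 0 < σ * y}] (0 : ℝ))) (𝓝 p) := by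
  have hM := h.nonneg
  have hd : ∀ y ∈ {y : {y : ℝ // y ≠ 0} | 0 < σ * (y : ℝ)},
      ∀ y' ∈ {y : {y : ℝ // y ≠ 0} | 0 < σ * (y : ℝ)},
      edist (liftPt ν g x y) (liftPt ν g x y') ≤
        ENNReal.ofReal (M * |(y : ℝ)|) + ENNReal.ofReal (M * |(y' : ℝ)|) := by
    intro y (hy : 0 < σ * (y : ℝ)) y' (hy' : 0 < σ * (y' : ℝ))
    have hyy : 0 < (y : ℝ) * y' := by
      have h1 := mul_pos hy hy'
      have h2 : 0 < σ * σ := mul_self_pos.mpr hσ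
      have h3 : σ * (y : ℝ) * (σ * y') = σ * σ * (y * y') := by ring
      rw [h3] at h1
      exact pos_of_mul_pos_right h1 h2.le
    refine (h.edist_liftPt_vertical hK g hyy).trans ?_
    rw [← ENNReal.ofReal_add (by positivity) (by positivity), ← mul_add]
    refine ENNReal.ofReal_le_ofReal (mul_le_mul_of_nonneg_left ?_ hM)
    rw [add_comm]
    exact abs_sub _ _
  have hu : ∀ n, signedInv σ hσ n ∈ {y : {y : ℝ // y ≠ 0} | 0 < σ * (y : ℝ)} := fun n => by
    change 0 < σ * (σ * (1 / ((n : ℝ) + 1)))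
    rw [← mul_assoc]
    exact mul_pos (mul_self_pos.mpr hσ) (by positivity)
  obtain ⟨p, hp1, hp2⟩ := exists_completion_limit hd hu (tendsto_signedInv M σ hσ)
  exact ⟨p, hp1, hp2 _ (preimage_mem_comap self_mem_nhdsWithin) (tendsto_ofReal_mul_abs M _)⟩

theorem Nice.exists_upperTip (h : Nice ν M x) (hK : ∀ᵐ t ∂ν, t ∈ cantorK)
    (g : Path.Homotopic.Quotient base base) :
    ∃ p, IsUpperTip ν g x p ∧ ∀ y : {y : ℝ // y ≠ 0}, 0 < (y : ℝ) →
      edist (toCompletion (liftPt ν g x y)) p ≤ ENNReal.ofReal (M * |(y : ℝ)|) := by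
  obtain ⟨p, h1, h2⟩ := h.exists_sided_tip hK g 1 one_ne_zero
  refine ⟨p, ?_, fun y hy => h1 y (by linarith)⟩
  have : {y : ℝ | 0 < 1 * y} = Ioi 0 := by ext; simp
  rwa [this] at h2

theorem Nice.exists_lowerTip (h : Nice ν M x) (hK : ∀ᵐ t ∂ν, t ∈ cantorK)
    (g : Path.Homotopic.Quotient base base) :
    ∃ p, IsLowerTip ν g x p ∧ ∀ y : {y : ℝ // y ≠ 0}, (y : ℝ) < 0 →
      edist (toCompletion (liftPt ν g x y)) p ≤ ENNReal.ofReal (M * |(y : ℝ)|) := by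
  obtain ⟨p, h1, h2⟩ := h.exists_sided_tip hK g (-1) (by norm_num)
  refine ⟨p, ?_, fun y hy => h1 y (by linarith)⟩
  have : {y : ℝ | 0 < -1 * y} = Iio 0 := by ext; simp
  rwa [this] at h2

theorem Nice.exists_gap (h : Nice ν M x) (k : ℕ) :
    ∃ m : ℝ, (m : ℂ) ∉ cantorK ∧ |x - m| ≤ (1 / 3) ^ k / 2 ∧
      ∀ t ∈ cantorK, (1 / 3 : ℝ) ^ k / 6 ≤ ‖(m : ℂ) - t‖ := by
  obtain ⟨t, ht, htx⟩ := h.mem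
  have hx : t = x + 1 / 2 := by
    have : t - 1 / 2 = x := Complex.ofReal_injective htx
    linarith
  obtain ⟨m, -, h1, h2⟩ := CantorRiemannium.exists_gap ht k
  have h3 : ∀ s ∈ cantorK, (1 / 3 : ℝ) ^ k / 6 ≤ ‖((m - 1 / 2 : ℝ) : ℂ) - s‖ := by
    rintro _ ⟨c, hc, rfl⟩
    rw [← Complex.ofReal_sub, Complex.norm_real, Real.norm_eq_abs, sub_sub_sub_cancel_right]
    exact h2 c hc
  refine ⟨m - 1 / 2, fun hmem => ?_, ?_, h3⟩
  · have h4 := h3 _ hmem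
    rw [sub_self, norm_zero] at h4
    have : (0 : ℝ) < (1 / 3) ^ k / 6 := by positivity
    linarith
  · rw [hx] at h1
    convert h1 using 2; ring

/-- In the completed surface, unlike in the universal covering, the two sides have the same limit:
they communicate through gaps arbitrarily close to x, at a cost proportional to the height of the
crossing. The constant 112 is 111 for the crossing plus 1 for the vertical path. -/
theorem Nice.exists_tip (h : Nice ν M x) (hK : ∀ᵐ t ∂ν, t ∈ cantorK) :
    ∃ p, IsTip ν x p ∧ ∀ y : {y : ℝ // y ≠ 0},
      edist (toCompletion (show Surface ν from vertPt x y)) p ≤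
        ENNReal.ofReal (112 * M * |(y : ℝ)|) := by
  have hM := h.nonneg
  have hproj : ∀ (g g' : Path.Homotopic.Quotient base base) (y y' : {y : ℝ // y ≠ 0}),
      edist (show Surface ν from vertPt x y) (show Surface ν from vertPt x y') ≤
        edist (liftPt ν g x y) (liftPt ν g' x y') := fun g g' y y' => by
    have := lipschitzWith_proj (liftPt ν g x y) (liftPt ν g' x y')
    rwa [ENNReal.coe_one, one_mul] at this
  have hvert : ∀ y y' : {y : ℝ // y ≠ 0}, 0 < (y : ℝ) * y' →
      edist (show Surface ν from vertPt x y) (show Surface ν from vertPt x y') ≤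
        ENNReal.ofReal (M * (|(y : ℝ)| + |(y' : ℝ)|)) := fun y y' hyy =>
    ((hproj (.refl _) (.refl _) y y').trans (h.edist_liftPt_vertical hK _ hyy)).trans
      (ENNReal.ofReal_le_ofReal (mul_le_mul_of_nonneg_left (by rw [add_comm]; exact abs_sub _ _) hM))
  have hopp : ∀ y y' : {y : ℝ // y ≠ 0}, (y : ℝ) < 0 → 0 < (y' : ℝ) →
      edist (show Surface ν from vertPt x y) (show Surface ν from vertPt x y') ≤
        ENNReal.ofReal (112 * M * (|(y : ℝ)| + |(y' : ℝ)|)) := by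
    intro y y' hy hy'
    -- The crossing takes place at a height below both |y| and |y'|.
    obtain ⟨k, hk⟩ := exists_pow_lt_of_lt_one (lt_min (abs_pos.mpr y.2) (abs_pos.mpr y'.2))
      (by norm_num : (1 / 3 : ℝ) < 1)
    obtain ⟨m, hm, hxm, hgap⟩ := h.exists_gap k
    have hkp : (0 : ℝ) < (1 / 3) ^ k := by positivity
    let Y : {y : ℝ // y ≠ 0} := ⟨(1 / 3) ^ k, hkp.ne'⟩
    have hYv : (Y : ℝ) = (1 / 3) ^ k := rfl
    have hYn : (negNe Y : ℝ) = -(1 / 3) ^ k := rfl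
    have e1 := (hproj (.refl _) (.refl _) y (negNe Y)).trans
      (h.edist_liftPt_vertical hK _ (by rw [hYn]; nlinarith))
    have e2 := (hproj (.refl _) _ (negNe Y) Y).trans
      (h.edist_liftPt_cross hK (.refl _) hm (y := Y) hkp hxm hgap)
    have e3 := (hproj (.refl _) (.refl _) Y y').trans
      (h.edist_liftPt_vertical hK _ (by rw [hYv]; positivity))
    refine (edist_triangle4 _ _ _ _).trans ((add_le_add (add_le_add e1 e2) e3).trans ?_)
    rw [← ENNReal.ofReal_add (by positivity) (by positivity),
      ← ENNReal.ofReal_add (by positivity) (by positivity)]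
    refine ENNReal.ofReal_le_ofReal ?_
    have k1 : (1 / 3 : ℝ) ^ k < |(y : ℝ)| := hk.trans_le (min_le_left _ _)
    have k2 : (1 / 3 : ℝ) ^ k < |(y' : ℝ)| := hk.trans_le (min_le_right _ _)
    have a1 : |(negNe Y : ℝ) - y| ≤ |(y : ℝ)| := by
      rw [hYn, abs_of_neg hy, abs_le]; rw [abs_of_neg hy] at k1
      constructor <;> linarith
    have a3 : |(y' : ℝ) - Y| ≤ |(y' : ℝ)| := by
      rw [hYv, abs_of_pos hy', abs_le]; rw [abs_of_pos hy'] at k2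
      constructor <;> linarith
    calc M * |(negNe Y : ℝ) - y| + 111 * M * Y + M * |(y' : ℝ) - Y|
        ≤ M * |(y : ℝ)| + 111 * M * |(y : ℝ)| + M * |(y' : ℝ)| := by
          rw [hYv]; gcongr
      _ ≤ _ := by
          have := mul_nonneg hM (abs_nonneg (y' : ℝ))
          linarith
  have hd : ∀ y ∈ (univ : Set {y : ℝ // y ≠ 0}), ∀ y' ∈ (univ : Set {y : ℝ // y ≠ 0}),
      edist (show Surface ν from vertPt x y) (show Surface ν from vertPt x y') ≤
        ENNReal.ofReal (112 * M * |(y : ℝ)|) + ENNReal.ofReal (112 * M * |(y' : ℝ)|) := by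
    intro y _ y' _
    rw [← ENNReal.ofReal_add (by positivity) (by positivity), ← mul_add]
    rcases lt_or_gt_of_ne y.2 with h1 | h1 <;> rcases lt_or_gt_of_ne y'.2 with h2 | h2
    · refine (hvert y y' (mul_pos_of_neg_of_neg h1 h2)).trans (ENNReal.ofReal_le_ofReal ?_)
      gcongr; linarith
    · exact hopp y y' h1 h2
    · rw [edist_comm, add_comm]; exact hopp y' y h2 h1
    · refine (hvert y y' (mul_pos h1 h2)).trans (ENNReal.ofReal_le_ofReal ?_)
      gcongr; linarith
  obtain ⟨p, hp1, hp2⟩ := exists_completion_limit hd (fun n => mem_univ _)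
    (tendsto_signedInv _ 1 one_ne_zero)
  refine ⟨p, hp2 _ univ_mem ?_, fun y => hp1 y (mem_univ _)⟩
  have := tendsto_ofReal_mul_abs (112 * M) univ
  rwa [nhdsWithin_univ] at this

end Arcs

/-! ### Uniqueness of landing points, and strict decrease of the potential along the tips. -/

section Angles

/-! ### Green angles and their landing points -/

/-- The binary sequences that are not eventually constant. -/
def NotEventuallyConst (b : ℕ → Bool) : Prop :=
  ∀ N, (∃ n ≥ N, b n = true) ∧ ∃ n ≥ N, b n = false

theorem summable_digits (b : ℕ → Bool) (c : ℝ) {q : ℝ} (hq : 1 < q) :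
    Summable fun n : ℕ => c * ((b n).toNat : ℝ) / q ^ (n + 1) := by
  have hq' : 0 ≤ q⁻¹ := by positivity
  have h := ((summable_geometric_of_lt_one hq' (inv_lt_one_of_one_lt₀ hq)).mul_left (|c| * q⁻¹))
  refine Summable.of_norm_bounded h fun n => ?_
  rw [norm_div, norm_mul, Real.norm_eq_abs, norm_pow, Real.norm_of_nonneg (by positivity : 0 ≤ q)]
  have h1 : ‖((b n).toNat : ℝ)‖ ≤ 1 := by cases b n <;> simp
  calc |c| * ‖((b n).toNat : ℝ)‖ / q ^ (n + 1) ≤ |c| * 1 / q ^ (n + 1) := by gcongr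
    _ = |c| * q⁻¹ * q⁻¹ ^ n := by rw [inv_pow, pow_succ]; field_simp

theorem tsum_digits_eq (b : ℕ → Bool) (c : ℝ) {q : ℝ} (hq : 1 < q) :
    ∑' n : ℕ, c * ((b n).toNat : ℝ) / q ^ (n + 1) =
      (c * (b 0).toNat + ∑' n : ℕ, c * ((b (n + 1)).toNat : ℝ) / q ^ (n + 1)) / q := by
  have hq0 : q ≠ 0 := by positivity
  rw [(summable_digits b c hq).tsum_eq_zero_add, add_div, ← tsum_div_const]
  congr 1
  · simp
  · refine tsum_congr fun n => ?_
    rw [pow_succ q (n + 1), div_div]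

/-- The number with the binary digits `b`. -/
def binaryValue (b : ℕ → Bool) : ℝ := ∑' n : ℕ, ((b n).toNat : ℝ) / 2 ^ (n + 1)

theorem summable_binary (b : ℕ → Bool) : Summable fun n : ℕ => ((b n).toNat : ℝ) / 2 ^ (n + 1) := by
  simpa using summable_digits b 1 one_lt_two

theorem binaryValue_eq (b : ℕ → Bool) :
    binaryValue b = ((b 0).toNat + binaryValue fun n => b (n + 1)) / 2 := by
  simpa [binaryValue] using tsum_digits_eq b 1 one_lt_two

theorem NotEventuallyConst.tail {b : ℕ → Bool} (h : NotEventuallyConst b) :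
    NotEventuallyConst fun n => b (n + 1) := by
  intro N
  obtain ⟨⟨n, hn, h1⟩, m, hm, h2⟩ := h (N + 1)
  refine ⟨⟨n - 1, by omega, ?_⟩, m - 1, by omega, ?_⟩
  · simpa [Nat.sub_add_cancel (show 1 ≤ n by omega)] using h1
  · simpa [Nat.sub_add_cancel (show 1 ≤ m by omega)] using h2

theorem binaryValue_pos {b : ℕ → Bool} {n : ℕ} (h : b n = true) : 0 < binaryValue b := by
  refine (summable_binary b).tsum_pos (fun n => by positivity) n ?_
  rw [h]; simp

theorem NotEventuallyConst.binaryValue_mem {b : ℕ → Bool} (h : NotEventuallyConst b) :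
    binaryValue b ∈ Ioo (0 : ℝ) 1 := by
  obtain ⟨⟨n, -, h1⟩, m, -, h2⟩ := h 0
  refine ⟨binaryValue_pos h1, ?_⟩
  have h3 : 0 < binaryValue fun n => !b n := binaryValue_pos (n := m) (by simp [h2])
  have h4 : binaryValue b + binaryValue (fun n => !b n) = 1 := by
    rw [binaryValue, binaryValue, ← (summable_binary b).tsum_add (summable_binary _)]
    have h5 : ∀ n : ℕ, ((b n).toNat : ℝ) / 2 ^ (n + 1) + ((!b n).toNat : ℝ) / 2 ^ (n + 1) =
        1 / 2 / 2 ^ n := by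
      intro n
      rw [← add_div, pow_succ]
      cases b n <;> simp <;> field_simp
    simp only [h5]
    exact tsum_geometric_two' 1
  linarith

/-- The value of a tail lies strictly between 0 and 1, so the first digit decides on which side of
1/2 the number lies. -/
theorem head_eq_of_binaryValue_eq {b b' : ℕ → Bool} (hb : NotEventuallyConst b)
    (hb' : NotEventuallyConst b') (h : binaryValue b = binaryValue b') : b 0 = b' 0 := by
  have h1 := hb.tail.binaryValue_mem
  have h2 := hb'.tail.binaryValue_mem
  rw [binaryValue_eq b, binaryValue_eq b'] at h
  rcases hb0 : b 0 <;> rcases hb0' : b' 0 <;> simp [hb0, hb0'] at h ⊢ <;>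
    linarith [h1.1, h1.2, h2.1, h2.2]

theorem eq_of_binaryValue_eq {b b' : ℕ → Bool} (hb : NotEventuallyConst b)
    (hb' : NotEventuallyConst b') (h : binaryValue b = binaryValue b') (n : ℕ) : b n = b' n := by
  induction n generalizing b b' with
  | zero => exact head_eq_of_binaryValue_eq hb hb' h
  | succ n ih =>
    refine ih hb.tail hb'.tail ?_
    have h0 := head_eq_of_binaryValue_eq hb hb' h
    rw [binaryValue_eq b, binaryValue_eq b', h0] at h
    linarith

theorem greenAngle_eq (b : ℕ → Bool) :
    greenAngle b = ((1 / 2 * (1 - binaryValue b) : ℝ) : UnitAddCircle) := rfl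

/-- Angles from above lie in (0, 1/2), where ℝ → ℝ/ℤ is injective, and a binary expansion that is
not eventually constant is unique. -/
theorem LandsAbove.eq {θ : UnitAddCircle} {x x' : ℝ} (h : LandsAbove θ x) (h' : LandsAbove θ x') :
    x = x' := by
  obtain ⟨b, hb, hθ, rfl⟩ := h
  obtain ⟨b', hb', hθ', rfl⟩ := h'
  have h1 := NotEventuallyConst.binaryValue_mem hb
  have h2 := NotEventuallyConst.binaryValue_mem hb'
  rw [hθ, greenAngle_eq, greenAngle_eq, AddCircle.coe_eq_coe_iff_of_mem_Ico (a := 0)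
    ⟨by linarith [h1.2], by linarith [h1.1]⟩ ⟨by linarith [h2.2], by linarith [h2.1]⟩] at hθ'
  have h3 : b = b' := funext (eq_of_binaryValue_eq hb hb' (by linarith))
  rw [h3]

/-- A common angle would make a sum of two numbers of (0, 1/2) an integer. -/
theorem not_landsAbove_and_landsBelow {θ : UnitAddCircle} {x x' : ℝ} (h : LandsAbove θ x)
    (h' : LandsBelow θ x') : False := by
  obtain ⟨b, hb, hθ, -⟩ := h
  obtain ⟨b', hb', hθ', -⟩ := h'
  have h1 := NotEventuallyConst.binaryValue_mem hb
  have h2 := NotEventuallyConst.binaryValue_mem hb'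
  have h3 : ((1 / 2 * (1 - binaryValue b) + 1 / 2 * (1 - binaryValue b') : ℝ) : UnitAddCircle) =
      0 := by
    rw [AddCircle.coe_add, ← greenAngle_eq, ← greenAngle_eq, ← hθ, ← hθ', add_neg_cancel]
  rw [AddCircle.coe_eq_zero_iff_of_mem_Ico
    ⟨by linarith [h1.2, h2.2], by linarith [h1.1, h2.1]⟩] at h3
  linarith [h1.2, h2.2]

/-- The Green line of angle `θ` lands at `x`, from the upper or from the lower half-plane. -/
def LandsAt (θ : UnitAddCircle) (x : ℝ) : Prop := LandsAbove θ x ∨ LandsBelow θ x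

theorem LandsAt.eq {θ : UnitAddCircle} {x x' : ℝ} (h : LandsAt θ x) (h' : LandsAt θ x') :
    x = x' := by
  rcases h with h | h <;> rcases h' with h' | h'
  · exact h.eq h'
  · exact (not_landsAbove_and_landsBelow h h').elim
  · exact (not_landsAbove_and_landsBelow h' h).elim
  · exact LandsAbove.eq h h'

/-- The digits of `tipSeq j`. -/
def digitSeq : ℕ → ℕ → Bool
  | 0, n => decide (n % 2 = 1)
  | _ + 1, 0 => true
  | _ + 1, 1 => false
  | j + 1, n + 2 => digitSeq j n

theorem digitSeq_notEventuallyConst (j : ℕ) : NotEventuallyConst (digitSeq j) := by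
  induction j with
  | zero =>
    intro N
    refine ⟨⟨2 * N + 1, by omega, ?_⟩, 2 * N, by omega, ?_⟩
    · simp [digitSeq, Nat.add_mod]
    · simp [digitSeq]
  | succ j ih =>
    intro N
    obtain ⟨⟨n, hn, h1⟩, m, hm, h2⟩ := ih N
    exact ⟨⟨n + 2, by omega, h1⟩, m + 2, by omega, h2⟩

theorem cantorPoint_eq (b : ℕ → Bool) : cantorPoint b + 1 / 2 =
    (2 * (b 0).toNat + (2 * (b 1).toNat + (cantorPoint (fun n => b (n + 2)) + 1 / 2)) / 3) / 3 := by
  rw [cantorPoint, cantorPoint, sub_add_cancel, sub_add_cancel,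
    tsum_digits_eq b 2 (by norm_num : (1 : ℝ) < 3),
    tsum_digits_eq (fun n => b (n + 1)) 2 (by norm_num : (1 : ℝ) < 3)]

theorem cantorPoint_digitSeq (j : ℕ) : cantorPoint (digitSeq j) = tipSeq j := by
  induction j with
  | zero =>
    have h1 := cantorPoint_eq (digitSeq 0)
    have h2 : (fun n => digitSeq 0 (n + 2)) = digitSeq 0 := by
      funext n; simp [digitSeq]
    rw [h2] at h1
    simp [digitSeq] at h1
    rw [tipSeq]
    have h3 : (digitSeq 0) = fun n => decide (n % 2 = 1) := by funext n; rw [digitSeq]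
    simp only [h3]
    linarith
  | succ j ih =>
    have h1 := cantorPoint_eq (digitSeq (j + 1))
    have h2 : (fun n => digitSeq (j + 1) (n + 2)) = digitSeq j := by
      funext n; rw [digitSeq]
    rw [h2, ih] at h1
    have h3 := tipSeq_succ j
    simp only [digitSeq, Bool.toNat_true, Bool.toNat_false] at h1
    push_cast at h1
    linarith

theorem landsAbove_tipSeq (j : ℕ) : LandsAbove (greenAngle (digitSeq j)) (tipSeq j) :=
  ⟨digitSeq j, digitSeq_notEventuallyConst j, rfl, (cantorPoint_digitSeq j).symm⟩

variable {ν : Measure ℂ} {M : ℝ}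

/-- The angle of the upper Green line that lands at `tipSeq j`. -/
def tipAngle (hK : ∀ᵐ t ∂ν, t ∈ cantorK) (hM : ∀ j, Nice ν M (tipSeq j)) (j : ℕ) : Angle ν :=
  ⟨greenAngle (digitSeq j), tipSeq j, (hM j).mem_G₁ hK, Or.inl (landsAbove_tipSeq j)⟩

/-! ### The potential at tips -/

instance neBot_comap_nhdsNe : (comap (Subtype.val : {y : ℝ // y ≠ 0} → ℝ) (𝓝 (0 : ℝ))).NeBot := by
  rw [comap_neBot_iff]
  intro t ht
  obtain ⟨y, hy1, hy2⟩ := Filter.nonempty_of_mem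
    (inter_mem (nhdsWithin_le_nhds (s := {(0 : ℝ)}ᶜ) ht) self_mem_nhdsWithin)
  exact ⟨⟨y, hy2⟩, hy1⟩

/-- The limit of the potential at `x + iy` when `y → 0`. -/
def tipPot (ν : Measure ℂ) (x : ℝ) : ℝ :=
  limUnder (comap (Subtype.val : {y : ℝ // y ≠ 0} → ℝ) (𝓝 (0 : ℝ)))
    fun y => potential ν (vertPt x y)

theorem extend_potential_eq_tipPot [IsFiniteMeasure ν] (hK : ∀ᵐ t ∂ν, t ∈ cantorK) {x : ℝ}
    {p : CauchyCompletion (Surface ν)} (hp : IsTip ν x p) :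
    extend (lipschitzWith_potential hK) p = tipPot ν x := by
  have h1 := ((lipschitzWith_extend (lipschitzWith_potential hK)).continuous.tendsto p).comp hp
  refine (Tendsto.limUnder_eq (h1.congr fun y => ?_)).symm
  exact extend_toCompletion _ _

/-- Reduces tips to gaps, where the potential is an explicit mass. -/
theorem Nice.exists_potential_close [IsFiniteMeasure ν] {x : ℝ} (h : Nice ν M x)
    (hK : ∀ᵐ t ∂ν, t ∈ cantorK) {ε : ℝ} (hε : 0 < ε) :
    ∃ m : ℝ, (m : ℂ) ∉ cantorK ∧ |x - m| < ε ∧ |tipPot ν x - potential ν m| < ε := by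
  have hM := h.nonneg
  obtain ⟨p, hp1, hp2⟩ := h.exists_tip hK
  -- 168 M bounds 112 M, from the tip to height 3⁻ᵏ, plus 37 · 3/2 · M, from there to the gap; the
  -- extra 1 keeps the denominator positive and makes |x - m| < ε.
  obtain ⟨k, hk⟩ := exists_pow_lt_of_lt_one (show 0 < ε / (168 * M + 1) by positivity)
    (by norm_num : (1 / 3 : ℝ) < 1)
  have hkp : (0 : ℝ) < (1 / 3) ^ k := by positivity
  rw [lt_div_iff₀ (by positivity)] at hk
  obtain ⟨m, hm, hxm, hgap⟩ := h.exists_gap k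
  let y : {y : ℝ // y ≠ 0} := ⟨(1 / 3) ^ k, hkp.ne'⟩
  have hy : |(y : ℝ)| = (1 / 3) ^ k := abs_of_pos hkp
  have hMk : 0 ≤ M * (1 / 3) ^ k := by positivity
  refine ⟨m, hm, by nlinarith, ?_⟩
  have h1 := h.abs_potential_sub_gap_le hK hm (y := y) (by rwa [hy]) (by rwa [hy])
  have h3 := (lipschitzWith_extend (lipschitzWith_potential hK)
    (toCompletion (show Surface ν from vertPt x y)) p).trans
    (mul_le_mul_right (hp2 y) _)
  rw [extend_toCompletion, extend_potential_eq_tipPot hK hp1, ENNReal.coe_one, one_mul, edist_dist,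
    ENNReal.ofReal_le_ofReal_iff (by positivity), Real.dist_eq, abs_sub_comm, hy] at h3
  rw [hy] at h1
  have h4 := abs_sub_le (tipPot ν x) (potential ν (vertPt x y)) (potential ν m)
  nlinarith

/-- Gaps on the two sides of the atom p have potentials differing by at least ν{p}/2, and replacing
the two tips by gaps costs at most ν{p}/8 each. -/
theorem tipPot_strictAnti [IsFiniteMeasure ν] (hK : ∀ᵐ t ∂ν, t ∈ cantorK) {x x' p : ℝ}
    (h : Nice ν M x) (h' : Nice ν M x') (hxp : x < p) (hpx : p < x')
    (hp : 0 < ν.real {(p : ℂ)}) : tipPot ν x' < tipPot ν x := by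
  set ε := min (min (p - x) (x' - p)) (ν.real {(p : ℂ)} / 8) with hε
  have hε0 : 0 < ε := lt_min (lt_min (by linarith) (by linarith)) (by linarith)
  have hε1 : ε ≤ p - x := (min_le_left _ _).trans (min_le_left _ _)
  have hε2 : ε ≤ x' - p := (min_le_left _ _).trans (min_le_right _ _)
  have hε3 : ε ≤ ν.real {(p : ℂ)} / 8 := min_le_right _ _
  obtain ⟨m, hm, h1, h2⟩ := h.exists_potential_close hK hε0
  obtain ⟨m', hm', h1', h2'⟩ := h'.exists_potential_close hK hε0
  rw [abs_lt] at h1 h2 h1' h2'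
  have h3 := le_potential_of_lt hK hm (p := p) (by linarith [h1.1])
  have h4 := potential_le_of_lt hK hm' (p := p) (by linarith [h1'.2])
  linarith [h2.1, h2'.2]

/-! ### Summability of the steps -/

theorem summable_abs_sub_of_monotone {u : ℕ → ℝ} (hu : Monotone u) {b : ℝ} (hb : ∀ n, u n ≤ b) :
    Summable fun n => |u n - u (n + 1)| := by
  refine summable_of_sum_range_le (c := b - u 0) (fun n => abs_nonneg _) fun n => ?_
  have h1 : ∀ i, |u i - u (i + 1)| = u (i + 1) - u i := fun i => by
    rw [abs_sub_comm, abs_of_nonneg (sub_nonneg.mpr (hu i.le_succ))]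
  simp only [h1]
  rw [Finset.sum_range_sub]
  linarith [hb n]

theorem not_completeSpace_of_tsum {X : Type*} [PseudoEMetricSpace X] {P : ℕ → X}
    (h : ∑' n, edist (P n) (P (n + 1)) ≠ ⊤) (hP : ∀ Q, ¬ Tendsto P atTop (𝓝 Q)) :
    ¬ CompleteSpace X := fun _ => by
  obtain ⟨Q, hQ⟩ := cauchySeq_tendsto_of_complete
    (cauchySeq_of_edist_le_of_tsum_ne_top _ (fun _ => le_rfl) h)
  exact hP Q hQ

end Angles

section Hat

/-! ### Incompleteness of `Ĉ` -/

variable {ν : Measure ℂ} {M : ℝ}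

open Classical in
/-- The potential composed with the retraction of `Ĉ` onto the copy with index `S`: the copies behind
the one with index `S ++ [θ]` are sent to the tip of `θ`; those that do not start with `S` are sent to
a point where the potential is `c`. -/
def hatRetract [IsFiniteMeasure ν] (hK : ∀ᵐ t ∂ν, t ∈ cantorK) (S : List (Angle ν)) (c : ℝ)
    (P : Copies (List (Angle ν)) (CauchyCompletion (Surface ν))) : ℝ :=
  if S <+: P.index then
    match P.index.drop S.length with
    | [] => extend (lipschitzWith_potential hK) P.pt
    | θ :: _ => tipPot ν θ.2.choose
  else c

theorem Angle.landsAt_eq (θ : Angle ν) {x : ℝ} (hx : LandsAt θ.1 x) : θ.2.choose = x :=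
  LandsAt.eq θ.2.choose_spec.2 hx

theorem hatRetract_of_not_prefix [IsFiniteMeasure ν] (hK : ∀ᵐ t ∂ν, t ∈ cantorK)
    {S i : List (Angle ν)} (c : ℝ) (h : ¬ S <+: i) (p : CauchyCompletion (Surface ν)) :
    hatRetract hK S c ⟨i, p⟩ = c := if_neg h

theorem hatRetract_self [IsFiniteMeasure ν] (hK : ∀ᵐ t ∂ν, t ∈ cantorK)
    (S : List (Angle ν)) (c : ℝ) (p : CauchyCompletion (Surface ν)) :
    hatRetract hK S c ⟨S, p⟩ = extend (lipschitzWith_potential hK) p := by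
  refine (if_pos (List.prefix_refl _)).trans ?_
  simp only [List.drop_length]

theorem hatRetract_append_cons [IsFiniteMeasure ν] (hK : ∀ᵐ t ∂ν, t ∈ cantorK)
    (S r : List (Angle ν)) (θ : Angle ν) (c : ℝ) (p : CauchyCompletion (Surface ν)) :
    hatRetract hK S c ⟨S ++ θ :: r, p⟩ = tipPot ν θ.2.choose := by
  refine (if_pos (List.prefix_append _ _)).trans ?_
  simp only [List.drop_append_length]

theorem lipschitzWith_hatRetract [IsFiniteMeasure ν] (hK : ∀ᵐ t ∂ν, t ∈ cantorK)
    (S : List (Angle ν)) (c : ℝ) : LipschitzWith 1 (hatRetract hK S c) := by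
  refine Copies.lipschitzWith one_ne_zero fun i => ?_
  simp only [hatRetract]
  split_ifs
  · rcases i.drop S.length with _ | ⟨θ, _⟩
    · exact lipschitzWith_extend _
    · exact (LipschitzWith.const _).weaken zero_le_one
  · exact (LipschitzWith.const _).weaken zero_le_one

/-- Only the gluings of the copy S itself matter. At a tip towards a later copy both values are the
potential of that tip; at the tip where S is attached to its parent, `hc` says that c is the
potential. All other gluings join copies with the same constant value. -/
theorem hatRetract_eq_of_hatRel [IsFiniteMeasure ν] (hK : ∀ᵐ t ∂ν, t ∈ cantorK)
    {S : List (Angle ν)} {c : ℝ}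
    (hc : ∀ s θ x, S = s ++ [θ] → LandsAt θ.1 x → tipPot ν x = c)
    {P Q : Copies (List (Angle ν)) (CauchyCompletion (Surface ν))} (h : hatRel ν P Q) :
    hatRetract hK S c P = hatRetract hK S c Q := by
  obtain ⟨i, p⟩ := P
  obtain ⟨j, q⟩ := Q
  obtain ⟨θ, x, -, hθ, hidx, htip, hpt⟩ := h
  dsimp only at hidx htip hpt
  subst hidx hpt
  have hval := extend_potential_eq_tipPot hK htip
  by_cases h1 : S <+: i
  · obtain ⟨_ | ⟨θ', r⟩, rfl⟩ := h1
    · rw [List.append_nil, hatRetract_self, hatRetract_append_cons, hval, θ.landsAt_eq hθ]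
    · rw [List.append_assoc, List.cons_append, hatRetract_append_cons, hatRetract_append_cons]
  · rw [hatRetract_of_not_prefix hK c h1]
    by_cases h2 : S <+: i ++ [θ]
    · rcases List.prefix_concat_iff.mp h2 with h3 | h3
      · rw [← h3, hatRetract_self, hval, hc _ _ _ h3 hθ]
      · exact absurd h3 h1
    · rw [hatRetract_of_not_prefix hK c h2]

/-- The index of the `n`-th copy of the sequence. -/
def hatIndex (hK : ∀ᵐ t ∂ν, t ∈ cantorK) (hM : ∀ j, Nice ν M (tipSeq j)) (n : ℕ) :
    List (Angle ν) := (List.range n).map (tipAngle hK hM)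

theorem hatIndex_succ (hK : ∀ᵐ t ∂ν, t ∈ cantorK) (hM : ∀ j, Nice ν M (tipSeq j)) (n : ℕ) :
    hatIndex hK hM (n + 1) = hatIndex hK hM n ++ [tipAngle hK hM n] := by
  simp [hatIndex, List.range_succ]

/-- The heights `±3⁻ⁿ`, positive for even `n`. -/
def altHeight (n : ℕ) : {y : ℝ // y ≠ 0} :=
  ⟨(-1) ^ n * (1 / 3) ^ n, mul_ne_zero (by simp) (by positivity)⟩

theorem im_vertPt (x : ℝ) (y : {y : ℝ // y ≠ 0}) : (vertPt x y : ℂ).im = y := by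
  simp [vertPt]

theorem abs_altHeight (n : ℕ) : |(altHeight n : ℝ)| = (1 / 3) ^ n := by
  simp [altHeight, abs_mul]

/-- The route: from the n-th point to the tip over `tipSeq n`, into the next copy, down to its lower
half-plane, across to the line through `tipSeq (n + 1)`, and through the tip over that point, so
that either sign of the final height can be reached. -/
theorem hat_step [IsFiniteMeasure ν] (hK : ∀ᵐ t ∂ν, t ∈ cantorK)
    (hM : ∀ j, Nice ν M (tipSeq j)) (n : ℕ) :
    edist (hatPt ν (hatIndex hK hM n) (vertPt (tipSeq n) (altHeight n)))
      (hatPt ν (hatIndex hK hM (n + 1)) (vertPt (tipSeq (n + 1)) (altHeight (n + 1)))) ≤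
    ENNReal.ofReal (400 * M * (|tipSeq n - tipSeq (n + 1)| + (1 / 3) ^ n)) := by
  have hM0 := (hM 0).nonneg
  obtain ⟨p, hp1, hp2⟩ := (hM n).exists_tip hK
  obtain ⟨q, -, hq2⟩ := (hM (n + 1)).exists_tip hK
  have hglue : Glued.mk (hatRel ν) ⟨hatIndex hK hM n, p⟩ =
      Glued.mk (hatRel ν) ⟨hatIndex hK hM (n + 1), p⟩ :=
    Glued.mk_eq ⟨tipAngle hK hM n, tipSeq n, (hM n).mem_G₁ hK, Or.inl (landsAbove_tipSeq n),
      hatIndex_succ hK hM n, hp1, rfl⟩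
  have e1 : edist (hatPt ν (hatIndex hK hM n) (vertPt (tipSeq n) (altHeight n)))
      (Glued.mk (hatRel ν) ⟨hatIndex hK hM n, p⟩) ≤ ENNReal.ofReal (112 * M * (1 / 3) ^ n) := by
    refine (Glued.edist_mk_le _ _ _).trans ?_
    rw [Copies.edist_same]
    have := hp2 (altHeight n)
    rwa [abs_altHeight] at this
  let y : {y : ℝ // y ≠ 0} := negNe ⟨(1 / 3) ^ n, by positivity⟩
  let y' : {y : ℝ // y ≠ 0} := negNe ⟨(1 / 3) ^ (n + 1), by positivity⟩
  have hy : (y : ℝ) = -(1 / 3) ^ n := rfl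
  have hy' : (y' : ℝ) = -(1 / 3) ^ (n + 1) := rfl
  have hn : (0 : ℝ) < (1 / 3) ^ n := by positivity
  have hn' : (0 : ℝ) < (1 / 3) ^ (n + 1) := by positivity
  have hay : |(y : ℝ)| = (1 / 3) ^ n := by rw [hy, abs_neg, abs_of_pos hn]
  have hay' : |(y' : ℝ)| = (1 / 3) ^ (n + 1) := by rw [hy', abs_neg, abs_of_pos hn']
  have e2 := hp2 y
  rw [hay] at e2
  have e3 := (lipschitzWith_proj (liftPt ν (.refl _) (tipSeq n) y)
    (liftPt ν (.refl _) (tipSeq (n + 1)) y')).trans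
    (mul_le_mul_right ((hM n).edist_liftPt_lower (hM (n + 1)) hK (.refl _) (by rw [hy]; linarith)
      (by rw [hy']; linarith)) _)
  rw [ENNReal.coe_one, one_mul, hay, hay'] at e3
  change edist (show Surface ν from vertPt (tipSeq n) y)
    (show Surface ν from vertPt (tipSeq (n + 1)) y') ≤ _ at e3
  rw [← edist_toCompletion] at e3
  have e4 := hq2 y'
  rw [hay'] at e4
  have e5 := hq2 (altHeight (n + 1))
  rw [abs_altHeight] at e5
  have e6 : edist p (toCompletion (show Surface ν from
      vertPt (tipSeq (n + 1)) (altHeight (n + 1)))) ≤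
      ENNReal.ofReal (112 * M * (1 / 3) ^ n) + ENNReal.ofReal (5 * M *
        (|tipSeq n - tipSeq (n + 1)| + (1 / 3) ^ n + (1 / 3) ^ (n + 1))) +
      ENNReal.ofReal (112 * M * (1 / 3) ^ (n + 1)) +
      ENNReal.ofReal (112 * M * (1 / 3) ^ (n + 1)) := by
    refine (edist_triangle4 _ (toCompletion (show Surface ν from vertPt (tipSeq n) y))
      (toCompletion (show Surface ν from vertPt (tipSeq (n + 1)) y')) _).trans ?_
    rw [add_assoc _ (ENNReal.ofReal (112 * M * (1 / 3) ^ (n + 1)))]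
    refine add_le_add (add_le_add ?_ e3) ((edist_triangle _ q _).trans (add_le_add e4 ?_))
    · rw [edist_comm]; exact e2
    · rw [edist_comm]; exact e5
  have e7 : edist (Glued.mk (hatRel ν) ⟨hatIndex hK hM n, p⟩)
      (hatPt ν (hatIndex hK hM (n + 1)) (vertPt (tipSeq (n + 1)) (altHeight (n + 1)))) ≤
      ENNReal.ofReal (112 * M * (1 / 3) ^ n) + ENNReal.ofReal (5 * M *
        (|tipSeq n - tipSeq (n + 1)| + (1 / 3) ^ n + (1 / 3) ^ (n + 1))) +
      ENNReal.ofReal (112 * M * (1 / 3) ^ (n + 1)) +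
      ENNReal.ofReal (112 * M * (1 / 3) ^ (n + 1)) := by
    rw [hglue]
    refine (Glued.edist_mk_le _ _ _).trans ?_
    rw [Copies.edist_same]
    exact e6
  refine (edist_triangle _ _ _).trans ((add_le_add e1 e7).trans ?_)
  have hx := abs_nonneg (tipSeq n - tipSeq (n + 1))
  rw [← ENNReal.ofReal_add (by positivity) (by positivity),
    ← ENNReal.ofReal_add (by positivity) (by positivity),
    ← ENNReal.ofReal_add (by positivity) (by positivity),
    ← ENNReal.ofReal_add (by positivity) (by positivity)]
  refine ENNReal.ofReal_le_ofReal ?_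
  rw [pow_succ]
  have h1 := mul_nonneg hM0 hn.le
  have h2 := mul_nonneg hM0 hx
  nlinarith

/-- Only the indices matter; the points z n are arbitrary. -/
theorem hat_no_limit [IsFiniteMeasure ν] (hK : ∀ᵐ t ∂ν, t ∈ cantorK)
    (hM : ∀ j, Nice ν M (tipSeq j)) (hsep : ∀ j, 0 < ν.real {(sepSeq j : ℂ)}) (Q : HatC ν)
    (z : ℕ → Omega) :
    ¬ Tendsto (fun n => hatPt ν (hatIndex hK hM n) (z n)) atTop (𝓝 Q) := by
  intro hQ
  obtain ⟨⟨t, β⟩, rfl⟩ := Glued.mk_surjective _ Q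
  set k := t.length with hk
  -- S is longer than the index t of the supposed limit, so the retraction sends the limit to the
  -- tip where S is attached.
  set S := hatIndex hK hM (k + 1) with hS
  have hSlen : S.length = k + 1 := by simp [hS, hatIndex]
  have hc : ∀ s θ x, S = s ++ [θ] → LandsAt θ.1 x → tipPot ν x = tipPot ν (tipSeq k) := by
    intro s θ x h1 h2
    rw [hS, hatIndex_succ] at h1
    have h3 := (List.append_inj' h1 rfl).2
    rw [List.singleton_inj] at h3
    rw [LandsAt.eq h2 (by rw [← h3]; exact Or.inl (landsAbove_tipSeq k))]
  have hlip := Glued.lipschitzWith_lift (fun _ _ h => hatRetract_eq_of_hatRel hK hc h)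
    (lipschitzWith_hatRetract hK S (tipPot ν (tipSeq k)))
  have hlim := (hlip.continuous.tendsto _).comp hQ
  have h1 : hatRetract hK S (tipPot ν (tipSeq k)) ⟨t, β⟩ = tipPot ν (tipSeq k) := by
    refine hatRetract_of_not_prefix hK _ (fun h => ?_) _
    have := h.length_le
    omega
  -- From n = k + 2 on, the copies lie strictly behind S, through its tip over `tipSeq (k + 1)`.
  have h2 : ∀ n ≥ k + 2, hatRetract hK S (tipPot ν (tipSeq k))
      ⟨hatIndex hK hM n, toCompletion (show Surface ν from z n)⟩ = tipPot ν (tipSeq (k + 1)) := by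
    intro n hn
    obtain ⟨d, rfl⟩ := Nat.exists_eq_add_of_le hn
    have h3 : ∃ r, hatIndex hK hM (k + 2 + d) = S ++ tipAngle hK hM (k + 1) :: r := by
      induction d with
      | zero => exact ⟨[], by rw [add_zero, hatIndex_succ]⟩
      | succ d ih =>
        obtain ⟨r, hr⟩ := ih (by omega)
        exact ⟨r ++ [tipAngle hK hM (k + 2 + d)], by rw [← add_assoc, hatIndex_succ, hr]; simp⟩
    obtain ⟨r, hr⟩ := h3
    rw [hr, hatRetract_append_cons, Angle.landsAt_eq _ (x := tipSeq (k + 1)) (Or.inl (landsAbove_tipSeq (k + 1)))]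
  have h3 : Tendsto (fun _ : ℕ => tipPot ν (tipSeq (k + 1))) atTop (𝓝 (tipPot ν (tipSeq k))) := by
    have h4 : Tendsto _ atTop (𝓝 (hatRetract hK S (tipPot ν (tipSeq k)) ⟨t, β⟩)) := hlim
    rw [h1] at h4
    refine h4.congr' ?_
    filter_upwards [eventually_ge_atTop (k + 2)] with n hn using h2 n hn
  have h4 := tendsto_nhds_unique tendsto_const_nhds h3
  exact (tipPot_strictAnti hK (hM k) (hM (k + 1)) (tipSeq_lt_sepSeq k) (sepSeq_lt_tipSeq k)
    (hsep k)).ne h4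

theorem hat_incomplete [IsFiniteMeasure ν] (hK : ∀ᵐ t ∂ν, t ∈ cantorK)
    (hM : ∀ j, Nice ν M (tipSeq j)) (hsep : ∀ j, 0 < ν.real {(sepSeq j : ℂ)})
    (hlim : (1 / 4 : ℝ) ∈ G₁ ν) :
    ¬ CompleteSpace (HatC ν) ∧
      ∃ a ∈ G₁ ν, ∃ (s : ℕ → List (Angle ν)) (z : ℕ → Omega),
        (∀ n, 0 < (z (2 * n) : ℂ).im ∧ (z (2 * n + 1) : ℂ).im < 0) ∧
        Tendsto (fun n => (z n : ℂ)) atTop (𝓝 (a : ℂ)) ∧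
        (∑' n, edist (hatPt ν (s n) (z n)) (hatPt ν (s (n + 1)) (z (n + 1)))) ≠ ⊤ ∧
        ∀ Q : HatC ν, ¬ Tendsto (fun n => hatPt ν (s n) (z n)) atTop (𝓝 Q) := by
  have hgeo : Summable fun n : ℕ => (1 / 3 : ℝ) ^ n :=
    summable_geometric_of_lt_one (by norm_num) (by norm_num)
  have htsum : (∑' n, edist (hatPt ν (hatIndex hK hM n) (vertPt (tipSeq n) (altHeight n)))
      (hatPt ν (hatIndex hK hM (n + 1)) (vertPt (tipSeq (n + 1)) (altHeight (n + 1))))) ≠ ⊤ := by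
    have h1 : Summable fun n => 400 * M * (|tipSeq n - tipSeq (n + 1)| + (1 / 3) ^ n) :=
      ((summable_abs_sub_of_monotone strictMono_tipSeq.monotone fun n => (tipSeq_lt n).le).add
        hgeo).mul_left _
    exact ((ENNReal.tsum_le_tsum (hat_step hK hM)).trans_lt h1.tsum_ofReal_lt_top).ne
  refine ⟨not_completeSpace_of_tsum htsum fun Q => hat_no_limit hK hM hsep Q _, 1 / 4, hlim,
    hatIndex hK hM, fun n => vertPt (tipSeq n) (altHeight n), fun n => ?_, ?_, htsum,
    fun Q => hat_no_limit hK hM hsep Q _⟩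
  · have h3 : ∀ k : ℕ, (0 : ℝ) < (1 / 3) ^ k := fun k => by positivity
    have h1 := h3 (2 * n)
    have h2 := h3 (2 * n + 1)
    rw [im_vertPt, im_vertPt]
    have h4 : (-1 : ℝ) ^ (2 * n) = 1 := Even.neg_one_pow ⟨n, two_mul n⟩
    simp only [altHeight, pow_succ (-1 : ℝ), h4]
    constructor <;> linarith
  · have h1 : Tendsto (fun n => (altHeight n : ℝ)) atTop (𝓝 0) := by
      have := tendsto_pow_atTop_nhds_zero_of_lt_one (r := (1 / 3 : ℝ)) (by norm_num) (by norm_num)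
      refine squeeze_zero_norm (fun n => ?_) this
      rw [Real.norm_eq_abs, abs_altHeight]
    have h2 : Tendsto (fun n => ((tipSeq n : ℂ) + ((altHeight n : ℝ) : ℂ) * Complex.I)) atTop
        (𝓝 (((1 / 4 : ℝ) : ℂ) + ((0 : ℝ) : ℂ) * Complex.I)) :=
      ((Complex.continuous_ofReal.tendsto _).comp tendsto_tipSeq).add
        (((Complex.continuous_ofReal.tendsto _).comp h1).mul_const _)
    rw [Complex.ofReal_zero, zero_mul, add_zero] at h2
    exact h2

end Hat

section Winding

/-! ### Winding of circle-valued maps along homotopy classes -/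

/-- The variation along a homotopy class of paths of a continuous real lift of `H`. -/
def circleVar {X : Type*} [TopologicalSpace X] (H : C(X, UnitAddCircle)) {z w : X}
    (q : Path.Homotopic.Quotient z w) : ℝ :=
  ((AddCircle.isCoveringMap_coe (1 : ℝ)).monodromy (q.map H)
    ⟨(QuotientAddGroup.mk_surjective (H z)).choose,
      (QuotientAddGroup.mk_surjective (H z)).choose_spec⟩).1 -
    (QuotientAddGroup.mk_surjective (H z)).choose

variable {X : Type*} [TopologicalSpace X] {H : C(X, UnitAddCircle)} {z w : X}

/-- Two lifts of the same path differ by a translation, so any continuous lift computes the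
variation. -/
theorem circleVar_mk_eq (γ : Path z w) {ω : unitInterval → ℝ} (hω : Continuous ω)
    (h : ∀ t, ((ω t : ℝ) : UnitAddCircle) = H (γ t)) :
    circleVar H (.mk γ) = ω 1 - ω 0 := by
  have hc := (QuotientAddGroup.mk_surjective (H z)).choose_spec
  set c := (QuotientAddGroup.mk_surjective (H z)).choose with hcdef
  change ((c : ℝ) : UnitAddCircle) = H z at hc
  have h1 := (IsCoveringMap.eq_liftPath_iff (AddCircle.isCoveringMap_coe (1 : ℝ))
    (γ := (γ.map H.continuous).toContinuousMap) (e := c) (by simp [hc])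
    (Γ := fun t => ω t + (c - ω 0))).mpr ⟨by fun_prop, by
      funext t
      simp [h, hc], by simp⟩
  have h2 : circleVar H (.mk γ) = IsCoveringMap.liftPath (AddCircle.isCoveringMap_coe (1 : ℝ))
    (γ.map H.continuous).toContinuousMap c (by simp [hc]) 1 - c := rfl
  rw [h2, ← h1]
  ring

theorem exists_circle_lift (γ : Path z w) :
    ∃ ω : unitInterval → ℝ, Continuous ω ∧ ∀ t, ((ω t : ℝ) : UnitAddCircle) = H (γ t) := by
  obtain ⟨c, hc⟩ := QuotientAddGroup.mk_surjective (H z)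
  obtain ⟨Γ, h1, -⟩ := IsCoveringMap.exists_path_lifts (AddCircle.isCoveringMap_coe (1 : ℝ))
    (γ.map H.continuous).toContinuousMap c (by simp [← hc])
  exact ⟨Γ, Γ.continuous, fun t => congr_fun h1 t⟩

theorem circleVar_trans {v : X} (p : Path.Homotopic.Quotient z w)
    (q : Path.Homotopic.Quotient w v) :
    circleVar H (p.trans q) = circleVar H p + circleVar H q := by
  obtain ⟨γ, rfl⟩ := Path.Homotopic.Quotient.mk_surjective p
  obtain ⟨δ, rfl⟩ := Path.Homotopic.Quotient.mk_surjective q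
  obtain ⟨ω, hω, hωH⟩ := exists_circle_lift (H := H) γ
  obtain ⟨η, hη, hηH⟩ := exists_circle_lift (H := H) δ
  -- Both ω 1 and η 0 lift the value of H at w, so an integer translate of η continues ω.
  have hint : ((ω 1 - η 0 : ℝ) : UnitAddCircle) = 0 := by
    rw [AddCircle.coe_sub, hωH, hηH, γ.target, δ.source, sub_self]
  let P : Path (ω 0) (ω 1) := ⟨⟨ω, hω⟩, rfl, rfl⟩
  let Q : Path (ω 1) (η 1 + (ω 1 - η 0)) :=
    ⟨⟨fun t => η t + (ω 1 - η 0), by fun_prop⟩, by simp, rfl⟩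
  have h1 : circleVar H (.mk (γ.trans δ)) = (P.trans Q) 1 - (P.trans Q) 0 := by
    refine circleVar_mk_eq _ (P.trans Q).continuous fun t => ?_
    rw [Path.trans_apply, Path.trans_apply]
    split_ifs with ht
    · exact hωH _
    · change ((η _ + (ω 1 - η 0) : ℝ) : UnitAddCircle) = _
      rw [AddCircle.coe_add, hint, add_zero, hηH]
  rw [← Path.Homotopic.Quotient.mk_trans, h1, circleVar_mk_eq γ hω hωH, circleVar_mk_eq δ hη hηH,
    Path.target, Path.source]
  ring

theorem circleVar_refl : circleVar H (.refl z) = 0 := by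
  have := circleVar_trans (H := H) (Path.Homotopic.Quotient.refl z) (.refl z)
  rw [Path.Homotopic.Quotient.refl_trans] at this
  linarith

end Winding

section Bump

/-! ### The circle-valued map of a bump function -/

variable {ν : Measure ℂ}

/-- A Lipschitz function with values in `[0, 1]` such that `Ψ ∘ potential` is `0` or `1` on the gaps
of the Cantor set, and `0` at the base point. -/
structure IsBump (ν : Measure ℂ) (Ψ : ℝ → ℝ) (C : NNReal) : Prop where
  one_le : 1 ≤ C
  lipschitz : LipschitzWith C Ψ
  mem_Icc : ∀ u, Ψ u ∈ Icc (0 : ℝ) 1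
  gap : ∀ m : ℝ, (m : ℂ) ∉ cantorK → Ψ (potential ν m) = 0 ∨ Ψ (potential ν m) = 1
  base_eq : Ψ (potential ν 0) = 0

open Classical in
/-- `Ψ ∘ potential` modulo `1` on the upper half-plane, `0` on the lower half-plane. -/
def bumpFun (ν : Measure ℂ) (Ψ : ℝ → ℝ) (z : Omega) : UnitAddCircle :=
  if 0 ≤ (z : ℂ).im then ((Ψ (potential ν z) : ℝ) : UnitAddCircle) else 0

variable {Ψ : ℝ → ℝ} {C : NNReal}

theorem bumpFun_of_nonneg {z : Omega} (h : 0 ≤ (z : ℂ).im) :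
    bumpFun ν Ψ z = ((Ψ (potential ν z) : ℝ) : UnitAddCircle) := if_pos h

/-- In a gap Ψ ∘ `potential` is 0 or 1, both trivial in ℝ/ℤ, so the definitions on the two
half-planes agree there. -/
theorem IsBump.bumpFun_of_nonpos (hΨ : IsBump ν Ψ C) {z : Omega} (h : (z : ℂ).im ≤ 0) :
    bumpFun ν Ψ z = 0 := by
  rcases h.lt_or_eq with h | h
  · exact if_neg (not_le.mpr h)
  · rw [bumpFun_of_nonneg h.ge]
    have hz : (((z : ℂ).re : ℝ) : ℂ) = z := Complex.ext rfl (by simp [h])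
    rcases hΨ.gap (z : ℂ).re (by rw [hz]; exact z.2) with h1 | h1
    · rw [hz] at h1; rw [h1]; simp
    · rw [hz] at h1; rw [h1]; exact AddCircle.coe_period 1

theorem IsBump.eventually_norm_bumpFun_sub_le [IsFiniteMeasure ν] (hΨ : IsBump ν Ψ C)
    (hK : ∀ᵐ t ∂ν, t ∈ cantorK) (z₀ : Omega) {ε : ℝ} (hε : 0 < ε) :
    ∀ᶠ z in 𝓝 z₀, ‖bumpFun ν Ψ z - bumpFun ν Ψ z₀‖ ≤
      C * ((‖cauchyTransform ν z₀‖ + ε) * ‖(z : ℂ) - z₀‖) := by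
  have h1 : ∀ᶠ z : Omega in 𝓝 z₀, |potential ν z - potential ν z₀| ≤
      (‖cauchyTransform ν z₀‖ + ε) * ‖(z : ℂ) - z₀‖ :=
    continuous_subtype_val.continuousAt.eventually (eventually_abs_potential_sub_le hK z₀.2 hε)
  have hcont : ContinuousAt (fun z : Omega => (z : ℂ).im) z₀ := by fun_prop
  have h2 : ∀ᶠ z : Omega in 𝓝 z₀, (z₀ : ℂ).im < 0 → (z : ℂ).im < 0 := by
    by_cases h : (z₀ : ℂ).im < 0
    · filter_upwards [hcont.eventually (gt_mem_nhds h)] with z hz _ using hz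
    · exact Eventually.of_forall fun z h' => absurd h' h
  have h3 : ∀ᶠ z : Omega in 𝓝 z₀, 0 < (z₀ : ℂ).im → 0 < (z : ℂ).im := by
    by_cases h : 0 < (z₀ : ℂ).im
    · filter_upwards [hcont.eventually (lt_mem_nhds h)] with z hz _ using hz
    · exact Eventually.of_forall fun z h' => absurd h' h
  filter_upwards [h1, h2, h3] with z hz1 hz2 hz3
  by_cases h : 0 ≤ (z : ℂ).im ∧ 0 ≤ (z₀ : ℂ).im
  · rw [bumpFun_of_nonneg h.1, bumpFun_of_nonneg h.2, ← AddCircle.coe_sub]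
    have h4 : ‖((Ψ (potential ν z) - Ψ (potential ν z₀) : ℝ) : UnitAddCircle)‖ ≤
        |Ψ (potential ν z) - Ψ (potential ν z₀)| := by
      exact QuotientAddGroup.norm_mk_le_norm
    refine h4.trans ?_
    have h5 := hΨ.lipschitz.dist_le_mul (potential ν z) (potential ν z₀)
    rw [Real.dist_eq, Real.dist_eq] at h5
    exact h5.trans (mul_le_mul_of_nonneg_left hz1 C.2)
  -- Close to z₀ the two points lie in a common closed half-plane: an open half-plane containing z₀
  -- also contains z.
  · have h4 : (z : ℂ).im ≤ 0 ∧ (z₀ : ℂ).im ≤ 0 := by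
      rw [not_and_or, not_le, not_le] at h
      rcases h with h | h
      · exact ⟨h.le, le_of_not_gt fun h' => absurd (hz3 h') (not_lt.mpr h.le)⟩
      · exact ⟨(hz2 h).le, h.le⟩
    rw [hΨ.bumpFun_of_nonpos h4.1, hΨ.bumpFun_of_nonpos h4.2, sub_self, norm_zero]
    positivity

/-- `bumpFun` as a continuous map. -/
def IsBump.map [IsFiniteMeasure ν] (hΨ : IsBump ν Ψ C) (hK : ∀ᵐ t ∂ν, t ∈ cantorK) :
    C(Omega, UnitAddCircle) where
  toFun := bumpFun ν Ψ
  continuous_toFun := by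
    refine continuous_iff_continuousAt.mpr fun z₀ => tendsto_iff_norm_sub_tendsto_zero.mpr ?_
    refine squeeze_zero' (Eventually.of_forall fun _ => norm_nonneg _)
      (hΨ.eventually_norm_bumpFun_sub_le hK z₀ one_pos) ?_
    have h : Continuous fun z : Omega =>
      C * ((‖cauchyTransform ν z₀‖ + 1) * ‖(z : ℂ) - z₀‖) := by fun_prop
    simpa using h.tendsto z₀

/-- The winding of `bumpFun` on the universal covering. -/
def IsBump.winding [IsFiniteMeasure ν] (hΨ : IsBump ν Ψ C) (hK : ∀ᵐ t ∂ν, t ∈ cantorK)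
    (α : UnivCover ν) : ℝ := circleVar (hΨ.map hK) α.2

/-- Locally a real lift varies exactly as much as the circle-valued map, whose slope is at most C
|f|. Gaps contribute nothing special, since the map is continuous there. -/
theorem IsBump.lipschitzWith_winding [IsFiniteMeasure ν] (hΨ : IsBump ν Ψ C)
    (hK : ∀ᵐ t ∂ν, t ∈ cantorK) : LipschitzWith C (hΨ.winding hK) := by
  refine lipschitzWith_chain fun α β => ?_
  have hmain : ∀ (γ : SmoothArc α.1 β.1),
      α.2.trans (Path.Homotopic.Quotient.mk γ.path) = β.2 →
      edist (hΨ.winding hK α) (hΨ.winding hK β) ≤ C * γ.length ν := by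
    intro γ hγ
    obtain ⟨ω, hω, hωH⟩ := exists_circle_lift (H := hΨ.map hK) γ.path
    have h1 : hΨ.winding hK β = hΨ.winding hK α + (ω 1 - ω 0) := by
      rw [IsBump.winding, IsBump.winding, ← circleVar_mk_eq γ.path hω hωH, ← hγ, circleVar_trans]
    have h2 := γ.edist_le_mul_length hK (ω := fun s => ω (projIcc 0 1 zero_le_one s))
      (C := C) (hω.comp continuous_projIcc).continuousOn ?_
    · have e0 : projIcc (0 : ℝ) 1 zero_le_one 0 = 0 := projIcc_left _
      have e1 : projIcc (0 : ℝ) 1 zero_le_one 1 = 1 := projIcc_right _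
      simp only [e0, e1] at h2
      refine le_of_eq_of_le ?_ h2
      rw [edist_dist, edist_dist, h1, Real.dist_eq, Real.dist_eq]
      congr 2
      ring
    · intro t ht ε hε
      have htI : t ∈ Icc (0 : ℝ) 1 := ⟨ht.1, ht.2.le⟩
      have hcω : Continuous fun s : ℝ => ω (projIcc 0 1 zero_le_one s) :=
        hω.comp continuous_projIcc
      have hcγ : Continuous fun s : ℝ => γ.path (projIcc 0 1 zero_le_one s) :=
        γ.path.continuous.comp continuous_projIcc
      -- For a real number of modulus at most 1/2, the norm of its class in ℝ/ℤ is its absolute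
      -- value.
      have e1 : ∀ᶠ s in 𝓝[>] t, |ω (projIcc 0 1 zero_le_one s) -
          ω (projIcc 0 1 zero_le_one t)| < 1 / 2 := by
        have := Metric.tendsto_nhds.mp (hcω.tendsto t) (1 / 2) (by norm_num)
        filter_upwards [nhdsWithin_le_nhds this] with s hs
        rwa [Real.dist_eq] at hs
      have e2 := (hcγ.tendsto t).eventually (hΨ.eventually_norm_bumpFun_sub_le hK
        (γ.path (projIcc 0 1 zero_le_one t)) hε)
      have e3 : ∀ᶠ s in 𝓝[>] t, s ∈ Ioo t 1 := Ioo_mem_nhdsGT ht.2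
      filter_upwards [e1, nhdsWithin_le_nhds e2, e3] with s hs1 hs2 hs3
      have hsI : s ∈ Icc (0 : ℝ) 1 := ⟨ht.1.trans hs3.1.le, hs3.2.le⟩
      rw [projIcc_of_mem _ htI, projIcc_of_mem _ hsI] at *
      rw [γ.ext_eq, γ.ext_eq] at hs2
      refine le_trans (le_of_eq ?_) hs2
      have e4 : ∀ r, bumpFun ν Ψ (γ.path r) = ((ω r : ℝ) : UnitAddCircle) := fun r => (hωH r).symm
      rw [e4, e4, ← AddCircle.coe_sub]
      refine ((AddCircle.norm_coe_eq_abs_iff 1 one_ne_zero).mpr ?_).symm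
      rw [abs_one]
      exact hs1.le
  -- The infimum is over a possibly empty family, with value ⊤; C can be moved inside only if it is
  -- nonzero.
  have hC0 : (C : ℝ≥0∞) ≠ 0 := by
    rw [ENNReal.coe_ne_zero]; exact (one_pos.trans_le hΨ.one_le).ne'
  rw [ENNReal.mul_iInf_of_ne hC0 ENNReal.coe_ne_top]
  refine le_iInf fun γ => ?_
  rw [ENNReal.mul_iInf_of_ne hC0 ENNReal.coe_ne_top]
  exact le_iInf fun h => hmain γ h

theorem continuous_potential [IsFiniteMeasure ν] (hK : ∀ᵐ t ∂ν, t ∈ cantorK) :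
    Continuous fun z : Omega => potential ν z := by
  refine continuous_iff_continuousAt.mpr fun z₀ => tendsto_iff_norm_sub_tendsto_zero.mpr ?_
  refine squeeze_zero' (Eventually.of_forall fun _ => norm_nonneg _)
    (continuous_subtype_val.continuousAt.eventually
      (eventually_abs_potential_sub_le hK z₀.2 one_pos)) ?_
  have h : Continuous fun z : Omega => (‖cauchyTransform ν z₀‖ + 1) * ‖(z : ℂ) - z₀‖ := by fun_prop
  simpa using h.tendsto z₀

theorem IsBump.circleVar_of_im_nonneg [IsFiniteMeasure ν] (hΨ : IsBump ν Ψ C)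
    (hK : ∀ᵐ t ∂ν, t ∈ cantorK) {z w : Omega} (γ : Path z w) (h : ∀ t, 0 ≤ (γ t : ℂ).im) :
    circleVar (hΨ.map hK) (.mk γ) = Ψ (potential ν w) - Ψ (potential ν z) := by
  have h1 := circleVar_mk_eq (H := hΨ.map hK) γ (ω := fun t => Ψ (potential ν (γ t)))
    (hΨ.lipschitz.continuous.comp ((continuous_potential hK).comp γ.continuous))
    fun t => (bumpFun_of_nonneg (h t)).symm
  rwa [γ.source, γ.target] at h1

theorem IsBump.circleVar_of_im_nonpos [IsFiniteMeasure ν] (hΨ : IsBump ν Ψ C)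
    (hK : ∀ᵐ t ∂ν, t ∈ cantorK) {z w : Omega} (γ : Path z w) (h : ∀ t, (γ t : ℂ).im ≤ 0) :
    circleVar (hΨ.map hK) (.mk γ) = 0 := by
  have h1 := circleVar_mk_eq (H := hΨ.map hK) γ (ω := fun _ => 0) continuous_const
    fun t => (hΨ.bumpFun_of_nonpos (h t)).symm
  rwa [sub_self] at h1

theorem im_segPath (x : ℝ) (y : {y : ℝ // y ≠ 0}) (t : unitInterval) :
    (segPath x y t : ℂ).im = t * y := by
  simp [segPath]

theorem IsBump.circleVar_segPath_of_pos [IsFiniteMeasure ν] (hΨ : IsBump ν Ψ C)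
    (hK : ∀ᵐ t ∂ν, t ∈ cantorK) (x : ℝ) {y : {y : ℝ // y ≠ 0}} (hy : 0 < (y : ℝ)) :
    circleVar (hΨ.map hK) (.mk (segPath x y)) = Ψ (potential ν (vertPt x y)) := by
  rw [hΨ.circleVar_of_im_nonneg hK _ fun t => by
    rw [im_segPath]; exact mul_nonneg t.2.1 hy.le]
  change _ - Ψ (potential ν 0) = _
  rw [hΨ.base_eq, sub_zero]

theorem IsBump.circleVar_segPath_of_neg [IsFiniteMeasure ν] (hΨ : IsBump ν Ψ C)
    (hK : ∀ᵐ t ∂ν, t ∈ cantorK) (x : ℝ) {y : {y : ℝ // y ≠ 0}} (hy : (y : ℝ) < 0) :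
    circleVar (hΨ.map hK) (.mk (segPath x y)) = 0 :=
  hΨ.circleVar_of_im_nonpos hK _ fun t => by
    rw [im_segPath]; exact mul_nonpos_of_nonneg_of_nonpos t.2.1 hy.le

theorem IsBump.winding_liftPt_of_pos [IsFiniteMeasure ν] (hΨ : IsBump ν Ψ C)
    (hK : ∀ᵐ t ∂ν, t ∈ cantorK) (g : Path.Homotopic.Quotient base base) (x : ℝ)
    {y : {y : ℝ // y ≠ 0}} (hy : 0 < (y : ℝ)) :
    hΨ.winding hK (liftPt ν g x y) =
      circleVar (hΨ.map hK) g + Ψ (potential ν (vertPt x y)) := by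
  rw [← hΨ.circleVar_segPath_of_pos hK x hy]
  exact circleVar_trans _ _

theorem IsBump.winding_liftPt_of_neg [IsFiniteMeasure ν] (hΨ : IsBump ν Ψ C)
    (hK : ∀ᵐ t ∂ν, t ∈ cantorK) (g : Path.Homotopic.Quotient base base) (x : ℝ)
    {y : {y : ℝ // y ≠ 0}} (hy : (y : ℝ) < 0) :
    hΨ.winding hK (liftPt ν g x y) = circleVar (hΨ.map hK) g := by
  rw [← add_zero (circleVar _ g), ← hΨ.circleVar_segPath_of_neg hK x hy]
  exact circleVar_trans _ _

/-- The lower half of the loop contributes 0. The upper half starts in the gap with value Ψ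
(`potential ν m`) and ends at 0, where Ψ ∘ `potential` vanishes. -/
theorem IsBump.circleVar_crossLoop [IsFiniteMeasure ν] (hΨ : IsBump ν Ψ C)
    (hK : ∀ᵐ t ∂ν, t ∈ cantorK) (x m : ℝ) (hm : (m : ℂ) ∉ cantorK)
    {y : {y : ℝ // y ≠ 0}} (hy : 0 < (y : ℝ)) :
    circleVar (hΨ.map hK) (crossLoop x m hm y) = -Ψ (potential ν m) := by
  have h := congr_arg (circleVar (hΨ.map hK)) (trans_crossLoop (.refl _) x m hm y)
  have hneg : ((negNe y : {y : ℝ // y ≠ 0}) : ℝ) < 0 := neg_lt_zero.mpr hy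
  rw [circleVar_trans, circleVar_trans, circleVar_trans, circleVar_trans, circleVar_trans,
    circleVar_refl, hΨ.circleVar_segPath_of_pos hK x hy, hΨ.circleVar_segPath_of_neg hK x hneg,
    hΨ.circleVar_of_im_nonpos hK, hΨ.circleVar_of_im_nonneg hK] at h
  · change 0 + 0 + 0 + (_ - Ψ (potential ν m)) = _ at h
    linarith
  · intro t
    rw [SmoothArc.ext_eq]
    simp [segArc, realPt, vertPt]
    exact mul_nonneg t.2.1 hy.le
  · intro t
    rw [SmoothArc.ext_eq]
    simp [segArc, realPt, vertPt]
    have := hneg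
    nlinarith [t.2.2]

end Bump

/-! ### A bump function for each pair of atoms. -/

section BumpExists

variable {ν : Measure ℂ}

theorem lipschitzWith_max_zero_mul_sub (L : NNReal) (c : ℝ) :
    LipschitzWith L fun u : ℝ => max 0 (L * (c - u)) := by
  refine LipschitzWith.of_dist_le_mul fun u v => ?_
  rw [Real.dist_eq, Real.dist_eq]
  refine (abs_max_sub_max_le_max _ _ _ _).trans ?_
  rw [sub_self, abs_zero, ← mul_sub, abs_mul, NNReal.abs_eq, max_eq_right (by positivity)]
  rw [show c - u - (c - v) = -(u - v) by ring, abs_neg]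

theorem mem_cantorK_of_atom (hK : ∀ᵐ t ∂ν, t ∈ cantorK) {z : ℂ} (hz : 0 < ν.real {z}) :
    z ∈ cantorK := by
  by_contra h
  have h1 : ν {z} = 0 := measure_mono_null (fun t ht => by
    rw [mem_singleton_iff.mp ht]; exact h) (ae_iff.mp hK)
  simp [Measure.real, h1] at hz

/-- Two atoms `0 < p < p'` are separated from each other and from the complement of `(p, p')` by a
bump function of the potential. -/
theorem exists_isBump [IsFiniteMeasure ν] (hK : ∀ᵐ t ∂ν, t ∈ cantorK) {p p' : ℝ} (h0 : 0 < p)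
    (hp : 0 < ν.real {(p : ℂ)}) (hp' : 0 < ν.real {(p' : ℂ)}) :
    ∃ (Ψ : ℝ → ℝ) (C : NNReal) (c δ : ℝ), IsBump ν Ψ C ∧ (∀ u ≤ c, Ψ u = 0) ∧ 0 < δ ∧
      (∀ m : ℝ, (m : ℂ) ∉ cantorK → p' < m → potential ν m + δ ≤ c) ∧
      ∀ m : ℝ, (m : ℂ) ∉ cantorK → p < m → m < p' → Ψ (potential ν m) = 1 := by
  set A := (ν.real {t | p' < t.re} + ν.real {(p' : ℂ)}) / 2 with hA
  set B := ν.real {t | p < t.re} / 2 with hB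
  set μ := ν.real {(p : ℂ)} with hμ
  set μ' := ν.real {(p' : ℂ)} with hμ'
  -- The bump is max (0, 1 - K · dist (u, [A, B])). Gaps in (p, p') have potential in [A, B], those
  -- to the left at least B + μ/2, those to the right at most A - μ'/2. The slope K is steep enough
  -- for the bump to vanish on the last two kinds, with a margin, and K ≥ 1.
  set K : NNReal := ⟨1 + 4 / μ + 4 / μ', by positivity⟩ with hKdef
  have hKr : (K : ℝ) = 1 + 4 / μ + 4 / μ' := rfl
  have hKpos : 0 < (K : ℝ) := by rw [hKr]; positivity
  have hK1 : 4 ≤ K * μ := by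
    have : K * μ = μ + 4 + 4 / μ' * μ := by rw [hKr]; field_simp
    rw [this]
    have : 0 ≤ 4 / μ' * μ := by positivity
    linarith
  have hK2 : 4 ≤ K * μ' := by
    have : K * μ' = μ' + 4 + 4 / μ * μ' := by rw [hKr]; field_simp; ring
    rw [this]
    have : 0 ≤ 4 / μ * μ' := by positivity
    linarith
  have hzero1 : ∀ u ≤ A - 1 / K, max 0 (1 - K * max 0 (max (A - u) (u - B))) = 0 := by
    intro u hu
    refine max_eq_left ?_
    have h1 : 1 / (K : ℝ) ≤ max 0 (max (A - u) (u - B)) :=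
      le_trans (by linarith) ((le_max_left _ _).trans (le_max_right _ _))
    have h2 := mul_le_mul_of_nonneg_left h1 hKpos.le
    rw [mul_one_div_cancel hKpos.ne'] at h2
    linarith
  have hzero2 : ∀ u, B + μ / 2 ≤ u → max 0 (1 - K * max 0 (max (A - u) (u - B))) = 0 := by
    intro u hu
    refine max_eq_left ?_
    have h1 : μ / 2 ≤ max 0 (max (A - u) (u - B)) :=
      le_trans (by linarith) ((le_max_right _ _).trans (le_max_right _ _))
    have h2 := mul_le_mul_of_nonneg_left h1 hKpos.le
    linarith
  -- Here c = A - 1/K is where the bump starts. The distance μ'/2 to A leaves the margin δ = μ'/4,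
  -- since 1/K ≤ μ'/4.
  have hright : ∀ m : ℝ, (m : ℂ) ∉ cantorK → p' < m → potential ν m + μ' / 4 ≤ A - 1 / K := by
    intro m hm hpm
    have h1 := potential_le_of_lt hK hm hpm
    have h2 : 1 / (K : ℝ) ≤ μ' / 4 := by
      rw [div_le_div_iff₀ hKpos (by norm_num)]
      linarith
    linarith
  have hleft : ∀ m : ℝ, (m : ℂ) ∉ cantorK → m < p → B + μ / 2 ≤ potential ν m := by
    intro m hm hpm
    have h1 := le_potential_of_lt hK hm hpm
    linarith
  have hmid : ∀ m : ℝ, (m : ℂ) ∉ cantorK → p < m → m < p' →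
      max 0 (1 - K * max 0 (max (A - potential ν m) (potential ν m - B))) = 1 := by
    intro m hm h1 h2
    have h3 := potential_le_of_lt hK hm h1
    have h4 := le_potential_of_lt hK hm h2
    rw [max_eq_left (a := (0 : ℝ)) (b := max _ _) (max_le (by linarith) (by linarith)), mul_zero,
      sub_zero, max_eq_right zero_le_one]
  refine ⟨fun u => max 0 (1 - K * max 0 (max (A - u) (u - B))), K, A - 1 / K, μ' / 4,
    ⟨?_, ?_, ?_, ?_, ?_⟩, hzero1, by positivity, hright, hmid⟩
  · rw [← NNReal.coe_le_coe, hKr, NNReal.coe_one]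
    have : 0 ≤ 4 / μ + 4 / μ' := by positivity
    linarith
  · refine LipschitzWith.of_dist_le_mul fun u v => ?_
    rw [Real.dist_eq, Real.dist_eq]
    refine (abs_max_sub_max_le_max _ _ _ _).trans ?_
    rw [sub_self, abs_zero, sub_sub_sub_cancel_left, ← mul_sub, abs_mul, NNReal.abs_eq,
      max_eq_right (by positivity)]
    refine mul_le_mul_of_nonneg_left ?_ hKpos.le
    refine (abs_max_sub_max_le_max _ _ _ _).trans ?_
    rw [sub_self, abs_zero, max_eq_right (abs_nonneg _), abs_sub_comm]
    refine (abs_max_sub_max_le_max _ _ _ _).trans (max_le (le_of_eq ?_) (le_of_eq ?_))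
    · rw [sub_sub_sub_cancel_left, abs_sub_comm, abs_sub_comm]
    · rw [sub_sub_sub_cancel_right]
  · refine fun u => ⟨le_max_left _ _, max_le zero_le_one ?_⟩
    have : 0 ≤ K * max 0 (max (A - u) (u - B)) := mul_nonneg hKpos.le (le_max_left _ _)
    linarith
  · intro m hm
    have hne : m ≠ p := fun h => hm (h ▸ mem_cantorK_of_atom hK hp)
    have hne' : m ≠ p' := fun h => hm (h ▸ mem_cantorK_of_atom hK hp')
    rcases lt_or_gt_of_ne hne with h | h
    · exact Or.inl (hzero2 _ (hleft m hm h))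
    · rcases lt_or_gt_of_ne hne' with h' | h'
      · exact Or.inr (hmid m hm h h')
      · exact Or.inl (hzero1 _ (by have := hright m hm h'; linarith))
  · refine hzero2 _ ?_
    have := hleft 0 (by simpa using zero_not_mem_cantorK) h0
    simpa using this

end BumpExists

/-! ### Potential and winding numbers at glued tips. -/

section TipValues

variable {ν : Measure ℂ} {Ψ : ℝ → ℝ} {C : NNReal}

theorem lipschitzWith_potential_proj [IsFiniteMeasure ν] (hK : ∀ᵐ t ∂ν, t ∈ cantorK) :
    LipschitzWith 1 fun α : UnivCover ν => potential ν α.proj := by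
  have := (lipschitzWith_potential hK).comp (lipschitzWith_proj (ν := ν))
  rwa [one_mul] at this

instance neBot_comap_nhdsGT :
    (comap (Subtype.val : {y : ℝ // y ≠ 0} → ℝ) (𝓝[>] (0 : ℝ))).NeBot := by
  refine comap_neBot_iff_frequently.mpr (Eventually.frequently ?_)
  filter_upwards [self_mem_nhdsWithin] with y hy
  exact ⟨⟨y, (mem_Ioi.mp hy).ne'⟩, rfl⟩

instance neBot_comap_nhdsLT :
    (comap (Subtype.val : {y : ℝ // y ≠ 0} → ℝ) (𝓝[<] (0 : ℝ))).NeBot := by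
  refine comap_neBot_iff_frequently.mpr (Eventually.frequently ?_)
  filter_upwards [self_mem_nhdsWithin] with y hy
  exact ⟨⟨y, (mem_Iio.mp hy).ne⟩, rfl⟩

theorem tendsto_negNe :
    Tendsto negNe (comap (Subtype.val : {y : ℝ // y ≠ 0} → ℝ) (𝓝[>] (0 : ℝ)))
      (comap Subtype.val (𝓝[<] (0 : ℝ))) := by
  refine tendsto_comap_iff.mpr ?_
  have h : Tendsto (fun y : ℝ => -y) (𝓝[>] (0 : ℝ)) (𝓝[<] (0 : ℝ)) := by
    have := tendsto_neg_nhdsGT (a := (0 : ℝ))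
    rwa [neg_zero] at this
  exact h.comp tendsto_comap

theorem potential_vertPt_negNe (hK : ∀ᵐ t ∂ν, t ∈ cantorK) (x : ℝ) (y : {y : ℝ // y ≠ 0}) :
    potential ν (vertPt x (negNe y)) = potential ν (vertPt x y) := by
  rw [← potential_conj hK (vertPt x y)]
  congr 1
  simp [vertPt, negNe]

/-- The potential takes the same value at x + iy and x - iy. -/
theorem extend_potential_tips [IsFiniteMeasure ν] (hK : ∀ᵐ t ∂ν, t ∈ cantorK)
    {g : Path.Homotopic.Quotient base base} {x : ℝ} {p q : CauchyCompletion (UnivCover ν)}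
    (hp : IsUpperTip ν g x p) (hq : IsLowerTip ν g x q) :
    extend (lipschitzWith_potential_proj hK) p = extend (lipschitzWith_potential_proj hK) q := by
  have hc := (lipschitzWith_extend (lipschitzWith_potential_proj hK)).continuous
  have h1 := (hc.tendsto p).comp hp
  have h2 := ((hc.tendsto q).comp hq).comp tendsto_negNe
  refine tendsto_nhds_unique h1 (h2.congr fun y => ?_)
  simp only [Function.comp_apply, extend_toCompletion]
  exact potential_vertPt_negNe hK x y

/-- For the same label g the winding is `circleVar` of g below the axis and this plus Ψ ∘
`potential` above it; the limits at the two tips differ by the limit of the second term. -/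
theorem IsBump.extend_winding_tips [IsFiniteMeasure ν] (hΨ : IsBump ν Ψ C)
    (hK : ∀ᵐ t ∂ν, t ∈ cantorK)
    {g : Path.Homotopic.Quotient base base} {x : ℝ} {p q : CauchyCompletion (UnivCover ν)}
    (hp : IsUpperTip ν g x p) (hq : IsLowerTip ν g x q) :
    extend (hΨ.lipschitzWith_winding hK) p = extend (hΨ.lipschitzWith_winding hK) q +
      Ψ (extend (lipschitzWith_potential_proj hK) p) := by
  have hc := (lipschitzWith_extend (lipschitzWith_potential_proj hK)).continuous
  have hc' := (lipschitzWith_extend (hΨ.lipschitzWith_winding hK)).continuous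
  have h1 := (hc'.tendsto p).comp hp
  have h2 := (hc'.tendsto q).comp hq
  have h3 := (hΨ.lipschitz.continuous.tendsto _).comp ((hc.tendsto p).comp hp)
  have e2 : extend (hΨ.lipschitzWith_winding hK) q = circleVar (hΨ.map hK) g := by
    refine tendsto_nhds_unique h2 (tendsto_const_nhds.congr' ?_)
    filter_upwards [preimage_mem_comap self_mem_nhdsWithin] with y hy
    simp only [Function.comp_apply, extend_toCompletion]
    exact (hΨ.winding_liftPt_of_neg hK g x hy).symm
  rw [e2]
  refine tendsto_nhds_unique h1 ((h3.const_add _).congr' ?_)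
  filter_upwards [preimage_mem_comap self_mem_nhdsWithin] with y hy
  simp only [Function.comp_apply, extend_toCompletion]
  exact (hΨ.winding_liftPt_of_pos hK g x hy).symm

/-- The values of the extended winding number and potential at glued tips. -/
theorem IsBump.extend_winding_of_checkRel [IsFiniteMeasure ν] (hΨ : IsBump ν Ψ C)
    (hK : ∀ᵐ t ∂ν, t ∈ cantorK)
    {P Q : Copies (List (LiftedAngle ν)) (CauchyCompletion (UnivCover ν))}
    (h : checkRel ν P Q) :
    extend (lipschitzWith_potential_proj hK) P.pt = extend (lipschitzWith_potential_proj hK) Q.pt ∧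
    |extend (hΨ.lipschitzWith_winding hK) P.pt - extend (hΨ.lipschitzWith_winding hK) Q.pt| =
      Ψ (extend (lipschitzWith_potential_proj hK) P.pt) := by
  obtain ⟨g, θ, x, -, -, ⟨-, hp, hq⟩ | ⟨-, hq, hp⟩⟩ := h
  · have h1 := extend_potential_tips hK hp hq
    refine ⟨h1, ?_⟩
    rw [hΨ.extend_winding_tips hK hp hq, add_sub_cancel_left, abs_of_nonneg (hΨ.mem_Icc _).1]
  · have h1 := extend_potential_tips hK hp hq
    refine ⟨h1.symm, ?_⟩
    rw [hΨ.extend_winding_tips hK hp hq, sub_add_cancel_left, abs_neg,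
      abs_of_nonneg (hΨ.mem_Icc _).1, h1]

end TipValues

/-! ### Two opposite bounds for the winding numbers of a limit. -/

section NoLimit

variable {ν : Measure ℂ} {Ψ : ℕ → ℝ → ℝ} {C : ℕ → NNReal}

/-- Up to bounded multiples of `C j`, the winding numbers are constant on the set of points at finite
distance from each other. -/
theorem winding_bounded_of_edist_ne_top [IsFiniteMeasure ν] (hK : ∀ᵐ t ∂ν, t ∈ cantorK)
    (hΨ : ∀ j, IsBump ν (Ψ j) (C j))
    {P Q : Copies (List (LiftedAngle ν)) (CauchyCompletion (UnivCover ν))}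
    (h : edist (Glued.mk (tildeRel ν) (Glued.mk (checkRel ν) P))
      (Glued.mk (tildeRel ν) (Glued.mk (checkRel ν) Q)) ≠ ⊤) :
    ∃ R : ℝ, ∀ j, |extend ((hΨ j).lipschitzWith_winding hK) P.pt -
      extend ((hΨ j).lipschitzWith_winding hK) Q.pt| ≤ R * C j := by
  set W := fun j => extend ((hΨ j).lipschitzWith_winding hK) with hW
  let E : Copies (List (LiftedAngle ν)) (CauchyCompletion (UnivCover ν)) →
      Copies (List (LiftedAngle ν)) (CauchyCompletion (UnivCover ν)) → Prop :=
    fun P Q => ∃ R : ℝ, ∀ j, |W j P.pt - W j Q.pt| ≤ R * C j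
  have hE : Equivalence E := by
    refine ⟨fun P => ⟨0, fun j => by simp⟩, fun ⟨R, h⟩ => ⟨R, fun j => by
      rw [abs_sub_comm]; exact h j⟩, fun ⟨R, h⟩ ⟨R', h'⟩ => ⟨R + R', fun j => ?_⟩⟩
    rw [add_mul]
    exact (abs_sub_le _ _ _).trans (add_le_add (h j) (h' j))
  -- A passage through a tip changes each winding number by at most 1 ≤ C j; this is why a bump is
  -- required to have C ≥ 1.
  have hr : ∀ x y, checkRel ν x y → E x y := fun x y hxy => ⟨1, fun j => by
    rw [((hΨ j).extend_winding_of_checkRel hK hxy).2, one_mul]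
    exact ((hΨ j).mem_Icc _).2.trans (by exact_mod_cast (hΨ j).one_le)⟩
  have hd : ∀ x y : Copies (List (LiftedAngle ν)) (CauchyCompletion (UnivCover ν)),
      edist x y ≠ ⊤ → E x y := fun x y hxy => by
    have h1 := (Copies.edist_ne_top hxy).2
    refine ⟨(edist x.pt y.pt).toReal, fun j => ?_⟩
    have h2 := lipschitzWith_extend ((hΨ j).lipschitzWith_winding hK) x.pt y.pt
    have h3 := ENNReal.toReal_mono (ENNReal.mul_ne_top ENNReal.coe_ne_top h1) h2
    rw [ENNReal.toReal_mul, ENNReal.coe_toReal, edist_dist, ENNReal.toReal_ofReal dist_nonneg,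
      Real.dist_eq, mul_comm] at h3
    exact h3
  let E' : CheckC ν → CheckC ν → Prop := fun P Q =>
    ∀ x y, Glued.mk (checkRel ν) x = P → Glued.mk (checkRel ν) y = Q → E x y
  have hE' : Equivalence E' := by
    refine ⟨fun P x y hx hy => Glued.rel_of_mk_eq hE hr (hx.trans hy.symm),
      fun h x y hx hy => hE.symm (h y x hy hx), fun {P Q R} h h' x y hx hy => ?_⟩
    obtain ⟨z, rfl⟩ := Glued.mk_surjective _ Q
    exact hE.trans (h x z hx rfl) (h' z y rfl hy)
  refine Glued.rel_of_edist_ne_top (E := E') hE' ?_ ?_ h P Q rfl rfl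
  -- Copies with equal monodromy are identified at the same point p of the universal covering, so
  -- the windings agree and R = 0; the value of the monodromy plays no role.
  · rintro P Q ⟨s, t, m, p, -, -, rfl, rfl⟩ x y hx hy
    exact hE.trans (Glued.rel_of_mk_eq hE hr hx) (hE.trans ⟨0, fun j => by simp⟩
      (Glued.rel_of_mk_eq hE hr hy.symm))
  · rintro P Q hPQ x y rfl rfl
    exact Glued.rel_of_edist_ne_top hE hr hd hPQ

/-- The winding number itself does not descend to the quotient, as it jumps at tips where Ψ ≠ 0.
Cutting it off by a function of the potential supported in {U < c}, where Ψ vanishes, gives a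
Lipschitz function φ that descends; on the tail φ ≥ N. -/
theorem le_abs_winding_of_tendsto [IsFiniteMeasure ν] (hK : ∀ᵐ t ∂ν, t ∈ cantorK)
    {Ψ : ℝ → ℝ} {C : NNReal} (hΨ : IsBump ν Ψ C) {c δ N : ℝ} (hc : ∀ u ≤ c, Ψ u = 0) (hδ : 0 < δ)
    (hN : 0 ≤ N) {s : ℕ → List (LiftedAngle ν)} {α : ℕ → UnivCover ν}
    (h : ∀ᶠ n in atTop, N ≤ |hΨ.winding hK (α n)| ∧ potential ν (α n).proj + δ ≤ c)
    {Q : Copies (List (LiftedAngle ν)) (CauchyCompletion (UnivCover ν))}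
    (hQ : Tendsto (fun n => tildePt ν (s n) (α n)) atTop
      (𝓝 (Glued.mk (tildeRel ν) (Glued.mk (checkRel ν) Q)))) :
    N ≤ |extend (hΨ.lipschitzWith_winding hK) Q.pt| := by
  set W := extend (hΨ.lipschitzWith_winding hK) with hW
  set U := extend (lipschitzWith_potential_proj hK) with hU
  -- With this slope the cut-off is at least N as soon as the potential is below c - δ.
  let L : NNReal := ⟨N / δ, by positivity⟩
  let φ : Copies (List (LiftedAngle ν)) (CauchyCompletion (UnivCover ν)) → ℝ := fun P =>
    min (max 0 (L * (c - U P.pt))) |W P.pt|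
  have hφ : LipschitzWith (max (L * 1) (1 * C)) φ := by
    refine Copies.lipschitzWith (ne_of_gt ?_) fun i => ?_
    · exact lt_max_of_lt_right (by rw [one_mul]; exact one_pos.trans_le hΨ.one_le)
    · exact ((lipschitzWith_max_zero_mul_sub L c).comp
        (lipschitzWith_extend (lipschitzWith_potential_proj hK))).min
        (lipschitzWith_one_norm.comp (lipschitzWith_extend (hΨ.lipschitzWith_winding hK)))
  have hinv : ∀ x y, checkRel ν x y → φ x = φ y := by
    intro x y hxy
    obtain ⟨h1, h2⟩ := hΨ.extend_winding_of_checkRel hK hxy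
    by_cases h3 : U x.pt ≤ c
    · rw [hc _ h3, abs_eq_zero, sub_eq_zero] at h2
      change min (max 0 (L * (c - U x.pt))) |W x.pt| = min (max 0 (L * (c - U y.pt))) |W y.pt|
      rw [show U x.pt = U y.pt from h1, show W x.pt = W y.pt from h2]
    · have h4 : (L : ℝ) * (c - U x.pt) ≤ 0 :=
        mul_nonpos_of_nonneg_of_nonpos L.2 (by linarith)
      change min (max 0 (L * (c - U x.pt))) |W x.pt| = min (max 0 (L * (c - U y.pt))) |W y.pt|
      rw [← show U x.pt = U y.pt from h1, max_eq_left h4, min_eq_left (abs_nonneg _),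
        min_eq_left (abs_nonneg _)]
  have hlift := Glued.lipschitzWith_lift hinv hφ
  have hinv' : ∀ P Q, tildeRel ν P Q → Glued.lift φ hinv P = Glued.lift φ hinv Q := by
    rintro P Q ⟨s, t, m, p, -, -, rfl, rfl⟩
    rfl
  have hlift' := Glued.lipschitzWith_lift hinv' hlift
  have hlim : Tendsto (fun n => φ ⟨s n, toCompletion (α n)⟩) atTop (𝓝 (φ Q)) :=
    (hlift'.continuous.tendsto _).comp hQ
  have hge : N ≤ φ Q := by
    refine ge_of_tendsto hlim (h.mono fun n hn => ?_)
    refine le_min (le_max_of_le_right ?_) ?_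
    · rw [hU, extend_toCompletion]
      have h1 : (L : ℝ) * δ = N := div_mul_cancel₀ _ hδ.ne'
      rw [← h1]
      exact mul_le_mul_of_nonneg_left (by linarith [hn.2]) L.2
    · rw [hW, extend_toCompletion]
      exact hn.1
  exact hge.trans (min_le_right _ _)

/-- For a limit Q the tail forces |Wⱼ| ≥ j Cⱼ, while the finite distance to the first point gives
|Wⱼ| ≤ 2 + R Cⱼ with R independent of j; this fails for j > R + 2 because Cⱼ ≥ 1. -/
theorem tilde_no_limit [IsFiniteMeasure ν] (hK : ∀ᵐ t ∂ν, t ∈ cantorK)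
    (hΨ : ∀ j, IsBump ν (Ψ j) (C j)) {c δ : ℕ → ℝ} (hc : ∀ j, ∀ u ≤ c j, Ψ j u = 0)
    (hδ : ∀ j, 0 < δ j) {s : ℕ → List (LiftedAngle ν)} {α : ℕ → UnivCover ν}
    (h0 : ∀ j, |(hΨ j).winding hK (α 0)| ≤ 2)
    (h : ∀ j : ℕ, ∀ᶠ n in atTop, j * C j ≤ |(hΨ j).winding hK (α n)| ∧
      potential ν (α n).proj + δ j ≤ c j)
    (hd : (∑' n, edist (tildePt ν (s n) (α n)) (tildePt ν (s (n + 1)) (α (n + 1)))) ≠ ⊤)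
    (Q : TildeC ν) : ¬ Tendsto (fun n => tildePt ν (s n) (α n)) atTop (𝓝 Q) := by
  intro hQ
  obtain ⟨Q, rfl⟩ := Glued.mk_surjective _ Q
  obtain ⟨Q, rfl⟩ := Glued.mk_surjective _ Q
  have h1 := edist_le_tsum_of_edist_le_of_tendsto₀ _ (fun _ => le_rfl) hQ
  obtain ⟨R, hR⟩ := winding_bounded_of_edist_ne_top hK hΨ (ne_top_of_le_ne_top hd h1)
  obtain ⟨j, hj⟩ := exists_nat_gt (R + 2)
  have h2 := le_abs_winding_of_tendsto hK (hΨ j) (hc j) (hδ j) (by positivity) (h j) hQ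
  have h3 := hR j
  rw [extend_toCompletion] at h3
  have h4 := h0 j
  have h5 : (1 : ℝ) ≤ C j := by exact_mod_cast (hΨ j).one_le
  have h6 := abs_sub_abs_le_abs_sub (extend ((hΨ j).lipschitzWith_winding hK) Q.pt)
    ((hΨ j).winding hK (α 0))
  rw [abs_sub_comm] at h6
  nlinarith

end NoLimit

/-! ### The spiralling sequence: down through tips, up through gaps. -/

section Spiral

variable {ν : Measure ℂ} {M : ℝ}

/-- Data of a sequence of crossings of the real axis at the gaps `m l`, close to the points `x l` of
the Cantor set, at the heights `h l`. -/
structure Spiral (ν : Measure ℂ) (M : ℝ) where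
  x : ℕ → ℝ
  m : ℕ → ℝ
  h : ℕ → {y : ℝ // y ≠ 0}
  angle : ℕ → Angle ν
  nice : ∀ l, Nice ν M (x l)
  not_mem : ∀ l, (m l : ℂ) ∉ cantorK
  h_pos : ∀ l, 0 < (h l : ℝ)
  close : ∀ l, |x l - m l| ≤ h l / 2
  gap : ∀ l, ∀ t ∈ cantorK, (h l : ℝ) / 6 ≤ ‖(m l : ℂ) - t‖
  lands : ∀ l, LandsAbove (angle l).1 (x l)

namespace Spiral

variable (S : Spiral ν M)

/-- The product of the first `l` crossing loops. -/
def loop : ℕ → Path.Homotopic.Quotient base base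
  | 0 => .refl _
  | l + 1 => (loop l).trans (crossLoop (S.x l) (S.m l) (S.not_mem l) (S.h l))

/-- The index of the copy reached after `l` passages through tips. -/
def index : ℕ → List (LiftedAngle ν)
  | 0 => []
  | l + 1 => index l ++ [(S.loop (l + 1), S.angle l)]

/-- The heights `h 0, -h 0, h 1, -h 1, …`. -/
def height (n : ℕ) : {y : ℝ // y ≠ 0} := if n % 2 = 0 then S.h (n / 2) else negNe (S.h (n / 2))

/-- The points of the sequence, in the universal covering. -/
def pt (n : ℕ) : UnivCover ν := liftPt ν (S.loop (n / 2 + 1)) (S.x (n / 2)) (S.height n)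

/-- The points of the sequence in `C̃`. -/
def tildeSeq (n : ℕ) : TildeC ν := tildePt ν (S.index ((n + 1) / 2)) (S.pt n)

theorem height_even (l : ℕ) : S.height (2 * l) = S.h l := by
  rw [height, if_pos (by omega), show 2 * l / 2 = l by omega]

theorem height_odd (l : ℕ) : S.height (2 * l + 1) = negNe (S.h l) := by
  rw [height, if_neg (by omega), show (2 * l + 1) / 2 = l by omega]

theorem pt_even (l : ℕ) : S.pt (2 * l) = liftPt ν (S.loop (l + 1)) (S.x l) (S.h l) := by
  rw [pt, height_even, show 2 * l / 2 = l by omega]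

theorem pt_odd (l : ℕ) : S.pt (2 * l + 1) = liftPt ν (S.loop (l + 1)) (S.x l) (negNe (S.h l)) := by
  rw [pt, height_odd, show (2 * l + 1) / 2 = l by omega]

theorem abs_height (n : ℕ) : |(S.height n : ℝ)| = S.h (n / 2) := by
  rw [height]
  split_ifs
  · exact abs_of_pos (S.h_pos _)
  · rw [negNe, abs_neg, abs_of_pos (S.h_pos _)]

theorem edist_tildePt_le (s : List (LiftedAngle ν)) (α β : UnivCover ν) :
    edist (tildePt ν s α) (tildePt ν s β) ≤ edist α β := by
  refine (Glued.edist_mk_le _ _ _).trans ((Glued.edist_mk_le _ _ _).trans ?_)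
  rw [Copies.edist_same, edist_toCompletion]

/-- The passage from copy l to copy l + 1: the upper tip is glued to the lower tip with the same
label. -/
theorem edist_even (hK : ∀ᵐ t ∂ν, t ∈ cantorK) (l : ℕ) :
    edist (S.tildeSeq (2 * l)) (S.tildeSeq (2 * l + 1)) ≤ ENNReal.ofReal (2 * M * S.h l) := by
  obtain ⟨p, hp, hp'⟩ := (S.nice l).exists_upperTip hK (S.loop (l + 1))
  obtain ⟨q, hq, hq'⟩ := (S.nice l).exists_lowerTip hK (S.loop (l + 1))
  have hglue : Glued.mk (checkRel ν) ⟨S.index l, p⟩ = Glued.mk (checkRel ν) ⟨S.index (l + 1), q⟩ :=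
    Glued.mk_eq ⟨S.loop (l + 1), S.angle l, S.x l, (S.nice l).mem_G₁ hK, rfl,
      Or.inl ⟨S.lands l, hp, hq⟩⟩
  rw [tildeSeq, tildeSeq, pt_even, pt_odd, show (2 * l + 1) / 2 = l by omega,
    show (2 * l + 1 + 1) / 2 = l + 1 by omega]
  refine (Glued.edist_mk_le _ _ _).trans ?_
  refine (edist_triangle _ (Glued.mk (checkRel ν) ⟨S.index l, p⟩) _).trans ?_
  have hM := (S.nice l).nonneg
  have hh := S.h_pos l
  rw [show 2 * M * (S.h l : ℝ) = M * S.h l + M * S.h l by ring,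
    ENNReal.ofReal_add (by positivity) (by positivity)]
  refine add_le_add ((Glued.edist_mk_le _ _ _).trans ?_) ?_
  · rw [Copies.edist_same]
    have := hp' (S.h l) hh
    rwa [abs_of_pos hh] at this
  · rw [hglue]
    refine (Glued.edist_mk_le _ _ _).trans ?_
    rw [Copies.edist_same, edist_comm]
    have := hq' (negNe (S.h l)) (neg_lt_zero.mpr hh)
    rwa [negNe, abs_neg, abs_of_pos hh] at this

/-- This step stays in one copy: it goes across the lower half-plane to the next line, then up
through the gap, where the label changes. The constant is 116 = 5 + 111. -/
theorem edist_odd (hK : ∀ᵐ t ∂ν, t ∈ cantorK) (l : ℕ) :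
    edist (S.tildeSeq (2 * l + 1)) (S.tildeSeq (2 * l + 1 + 1)) ≤
      ENNReal.ofReal (116 * M * (|S.x l - S.x (l + 1)| + S.h l + S.h (l + 1))) := by
  rw [show 2 * l + 1 + 1 = 2 * (l + 1) by ring, tildeSeq, tildeSeq, pt_even, pt_odd,
    show (2 * l + 1 + 1) / 2 = l + 1 by omega, show (2 * (l + 1) + 1) / 2 = l + 1 by omega]
  refine (edist_tildePt_le _ _ _).trans ?_
  have hM := (S.nice l).nonneg
  have hh := S.h_pos l
  have hh' := S.h_pos (l + 1)
  have e1 := (S.nice l).edist_liftPt_lower (S.nice (l + 1)) hK (S.loop (l + 1))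
    (y := negNe (S.h l)) (y' := negNe (S.h (l + 1))) (neg_lt_zero.mpr hh) (neg_lt_zero.mpr hh')
  have e2 := (S.nice (l + 1)).edist_liftPt_cross hK (S.loop (l + 1)) (S.not_mem (l + 1)) hh'
    (S.close (l + 1)) (S.gap (l + 1))
  refine (edist_triangle _ _ _).trans ((add_le_add e1 e2).trans ?_)
  simp only [negNe, abs_neg, abs_of_pos hh, abs_of_pos hh']
  have hx := abs_nonneg (S.x l - S.x (l + 1))
  rw [← ENNReal.ofReal_add (by positivity) (by positivity)]
  refine ENNReal.ofReal_le_ofReal ?_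
  have h1 := mul_nonneg hM hh.le
  have h2 := mul_nonneg hM hx
  nlinarith

theorem tsum_edist_ne_top (hK : ∀ᵐ t ∂ν, t ∈ cantorK) (hh : Summable fun l => (S.h l : ℝ))
    (hx : Summable fun l => |S.x l - S.x (l + 1)|) :
    (∑' n, edist (S.tildeSeq n) (S.tildeSeq (n + 1))) ≠ ⊤ := by
  rw [← tsum_even_add_odd ENNReal.summable ENNReal.summable]
  refine ENNReal.add_ne_top.mpr ⟨?_, ?_⟩
  · exact ((ENNReal.tsum_le_tsum (S.edist_even hK)).trans_lt
      (hh.mul_left (2 * M)).tsum_ofReal_lt_top).ne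
  · exact ((ENNReal.tsum_le_tsum (S.edist_odd hK)).trans_lt
      (((hx.add hh).add ((summable_nat_add_iff 1).mpr hh)).mul_left _).tsum_ofReal_lt_top).ne

theorem circleVar_loop [IsFiniteMeasure ν] (hK : ∀ᵐ t ∂ν, t ∈ cantorK) {Ψ : ℝ → ℝ} {C : NNReal}
    (hΨ : IsBump ν Ψ C) (l : ℕ) :
    circleVar (hΨ.map hK) (S.loop l) = -∑ i ∈ Finset.range l, Ψ (potential ν (S.m i)) := by
  induction l with
  | zero =>
    rw [Finset.sum_range_zero, neg_zero]
    exact circleVar_refl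
  | succ l ih =>
    rw [loop, circleVar_trans, ih, hΨ.circleVar_crossLoop hK _ _ _ (S.h_pos l),
      Finset.sum_range_succ, neg_add]

/-- Each gap crossing adds -Ψ to the winding of the label, and passages through tips leave the label
unchanged, so the contributions accumulate with one sign. The error is the value of Ψ ∘ `potential`
at an upper point, and 0 at a lower one. -/
theorem winding_pt [IsFiniteMeasure ν] (hK : ∀ᵐ t ∂ν, t ∈ cantorK) {Ψ : ℝ → ℝ} {C : NNReal}
    (hΨ : IsBump ν Ψ C) (n : ℕ) :
    |hΨ.winding hK (S.pt n) + ∑ i ∈ Finset.range (n / 2 + 1), Ψ (potential ν (S.m i))| ≤ 1 := by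
  have h1 := S.circleVar_loop hK hΨ (n / 2 + 1)
  rcases Nat.even_or_odd' n with ⟨l, rfl | rfl⟩
  · rw [show 2 * l / 2 = l by omega] at *
    rw [pt_even, hΨ.winding_liftPt_of_pos hK _ _ (S.h_pos l), h1, neg_add_eq_sub,
      sub_add_cancel, abs_of_nonneg (hΨ.mem_Icc _).1]
    exact (hΨ.mem_Icc _).2
  · rw [show (2 * l + 1) / 2 = l by omega] at *
    rw [pt_odd, hΨ.winding_liftPt_of_neg hK _ _ (neg_lt_zero.mpr (S.h_pos l)), h1, neg_add_cancel,
      abs_zero]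
    exact zero_le_one

theorem im_pt (n : ℕ) : ((S.pt n).proj : ℂ).im = S.height n := im_vertPt _ _

theorem tendsto_height (hh : Summable fun l => (S.h l : ℝ)) :
    Tendsto (fun n => (S.height n : ℝ)) atTop (𝓝 0) := by
  refine squeeze_zero_norm (fun n => (S.abs_height n).le) ?_
  exact hh.tendsto_atTop_zero.comp (Nat.tendsto_div_const_atTop two_ne_zero)

theorem tendsto_proj {a : ℝ} (hh : Summable fun l => (S.h l : ℝ))
    (hx : Tendsto S.x atTop (𝓝 a)) :
    Tendsto (fun n => ((S.pt n).proj : ℂ)) atTop (𝓝 (a : ℂ)) := by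
  have h1 : Tendsto (fun n => ((S.x (n / 2) : ℂ) + ((S.height n : ℝ) : ℂ) * Complex.I)) atTop
      (𝓝 ((a : ℂ) + ((0 : ℝ) : ℂ) * Complex.I)) :=
    ((Complex.continuous_ofReal.tendsto _).comp
      (hx.comp (Nat.tendsto_div_const_atTop two_ne_zero))).add
      (((Complex.continuous_ofReal.tendsto _).comp (S.tendsto_height hh)).mul_const _)
  rw [Complex.ofReal_zero, zero_mul, add_zero] at h1
  exact h1

theorem abs_potential_pt_sub_le [IsFiniteMeasure ν] (hK : ∀ᵐ t ∂ν, t ∈ cantorK) (n : ℕ) :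
    |potential ν (S.pt n).proj - potential ν (S.m (n / 2))| ≤ 56 * M * |(S.height n : ℝ)| := by
  have h := (S.nice (n / 2)).abs_potential_sub_gap_le hK (S.not_mem (n / 2)) (y := S.height n)
    (by rw [abs_height]; exact S.close _) (by rw [abs_height]; exact S.gap _)
  have h1 := mul_nonneg (S.nice 0).nonneg (abs_nonneg (S.height n : ℝ))
  refine h.trans ?_
  linarith

end Spiral

end Spiral

/-! ### Incompleteness of C̃. -/

section Tilde

variable {ν : Measure ℂ} {M : ℝ}

/-- A monotone sequence of integers that takes each value `j` at least `N j` times consecutively. -/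
theorem exists_monotone_index (N : ℕ → ℕ) (hN : ∀ j, 1 ≤ N j) :
    ∃ J : ℕ → ℕ, Monotone J ∧ ∀ j, ∃ a, (∀ i ∈ Finset.Ico a (a + N j), J i = j) ∧
      ∀ i ≥ a + N j, j < J i := by
  -- S j is the start of the j-th block, of length N j.
  let S : ℕ → ℕ := fun j => ∑ i ∈ Finset.range j, N i
  have hS : ∀ j, S (j + 1) = S j + N j := fun j => Finset.sum_range_succ _ _
  have hmono : StrictMono S := strictMono_nat_of_lt_succ fun j => by
    rw [hS]; have := hN j; omega
  refine ⟨fun l => Nat.findGreatest (fun j => S j ≤ l) l, fun l l' hl => ?_, fun j => ⟨S j, ?_, ?_⟩⟩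
  · exact Nat.findGreatest_mono (fun j (hj : S j ≤ l) => hj.trans hl) hl
  · intro i hi
    rw [Finset.mem_Ico, ← hS] at hi
    refine le_antisymm ?_ (Nat.le_findGreatest ((hmono.le_apply).trans hi.1) hi.1)
    have h1 : S (Nat.findGreatest (fun j => S j ≤ i) i) ≤ i :=
      Nat.findGreatest_spec (P := fun j => S j ≤ i) (m := 0) (Nat.zero_le _) (Nat.zero_le _)
    exact Nat.lt_succ_iff.mp (hmono.lt_iff_lt.mp (h1.trans_lt hi.2))
  · intro i hi
    rw [← hS] at hi
    exact Nat.lt_of_succ_le (Nat.le_findGreatest ((hmono.le_apply).trans hi) hi)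

theorem Nice.exists_gap_near {x : ℝ} (h : Nice ν M x) (k : ℕ) {p p' : ℝ} (hp : p < x)
    (hp' : x < p') :
    ∃ (m : ℝ) (y : {y : ℝ // y ≠ 0}), (m : ℂ) ∉ cantorK ∧ 0 < (y : ℝ) ∧ (y : ℝ) ≤ (1 / 3) ^ k ∧
      |x - m| ≤ y / 2 ∧ (∀ t ∈ cantorK, (y : ℝ) / 6 ≤ ‖(m : ℂ) - t‖) ∧ p < m ∧ m < p' := by
  obtain ⟨i, hi⟩ := exists_pow_lt_of_lt_one (lt_min (sub_pos.mpr hp) (sub_pos.mpr hp'))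
    (show (1 / 3 : ℝ) < 1 by norm_num)
  obtain ⟨m, hm, h1, h2⟩ := h.exists_gap (max i k)
  have hpos : (0 : ℝ) < (1 / 3) ^ max i k := by positivity
  have h3 : (1 / 3 : ℝ) ^ max i k ≤ (1 / 3) ^ i :=
    pow_le_pow_of_le_one (by norm_num) (by norm_num) (le_max_left _ _)
  have h4 := abs_le.mp h1
  have h5 := hi.trans_le (min_le_left _ _)
  have h6 := hi.trans_le (min_le_right _ _)
  exact ⟨m, ⟨_, hpos.ne'⟩, hm, hpos,
    pow_le_pow_of_le_one (by norm_num) (by norm_num) (le_max_right _ _), h1, h2, by linarith,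
    by linarith⟩

theorem tilde_incomplete [IsFiniteMeasure ν] (hK : ∀ᵐ t ∂ν, t ∈ cantorK)
    (hM : ∀ j, Nice ν M (tipSeq j)) (hsep : ∀ j, 0 < ν.real {(sepSeq j : ℂ)})
    (hlim : (1 / 4 : ℝ) ∈ G₁ ν) :
    ¬ CompleteSpace (TildeC ν) ∧
      ∃ a ∈ G₁ ν, ∃ (s : ℕ → List (LiftedAngle ν)) (α : ℕ → UnivCover ν),
        (∀ n, 0 < ((α (2 * n)).proj : ℂ).im ∧ ((α (2 * n + 1)).proj : ℂ).im < 0) ∧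
        Tendsto (fun n => ((α n).proj : ℂ)) atTop (𝓝 (a : ℂ)) ∧
        (∑' n, edist (tildePt ν (s n) (α n)) (tildePt ν (s (n + 1)) (α (n + 1)))) ≠ ⊤ ∧
        ∀ Q : TildeC ν, ¬ Tendsto (fun n => tildePt ν (s n) (α n)) atTop (𝓝 Q) := by
  -- The atom `sepSeq 0` is negative; the shift puts the windows to the right of 0, so that the
  -- bumps vanish at the base point.
  have hsep0 : ∀ j, 0 < sepSeq (j + 1) := fun j => by
    have h1 : sepSeq 1 ≤ sepSeq (j + 1) := strictMono_sepSeq.monotone (by omega)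
    have h2 : 0 < sepSeq 1 := by norm_num [sepSeq]
    linarith
  choose Ψ C c δ hΨ hc hδ hright hmid using fun j : ℕ =>
    exists_isBump hK (hsep0 j) (hsep (j + 1)) (hsep (j + 2))
  -- Crossing l takes place in window J l, around `tipSeq (J l + 2)`. Window j receives one crossing
  -- more than j Cⱼ requires, to absorb the error 1 of `Spiral.winding_pt`.
  obtain ⟨J, hJ, hJN⟩ := exists_monotone_index (fun j => ⌈(j * C j : ℝ)⌉₊ + 1) fun j => by omega
  choose m y hm hy hyk hxm hgap hpm hmp using fun l : ℕ =>
    (hM (J l + 2)).exists_gap_near l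
      (show sepSeq (J l + 1) < tipSeq (J l + 2) from sepSeq_lt_tipSeq _)
      (show tipSeq (J l + 2) < sepSeq (J l + 2) from tipSeq_lt_sepSeq _)
  let S : Spiral ν M :=
    { x := fun l => tipSeq (J l + 2), m := m, h := y, angle := fun l => tipAngle hK hM (J l + 2)
      nice := fun l => hM _, not_mem := hm, h_pos := hy, close := hxm, gap := hgap
      lands := fun l => landsAbove_tipSeq _ }
  have hsum : Summable fun l => (S.h l : ℝ) :=
    Summable.of_nonneg_of_le (fun l => (hy l).le) hyk
      (summable_geometric_of_lt_one (by norm_num) (by norm_num))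
  have htsum := S.tsum_edist_ne_top hK hsum (summable_abs_sub_of_monotone
    (fun l l' h => strictMono_tipSeq.monotone (Nat.add_le_add_right (hJ h) 2))
    fun l => (tipSeq_lt _).le)
  have hJlim : Tendsto J atTop atTop := tendsto_atTop.mpr fun j => by
    obtain ⟨a, -, h2⟩ := hJN j
    filter_upwards [eventually_ge_atTop _] with i hi using (h2 i hi).le
  have hterm : ∀ j i, 0 ≤ Ψ j (potential ν (S.m i)) := fun j i => ((hΨ j).mem_Icc _).1
  have hlimit : ∀ Q, ¬ Tendsto S.tildeSeq atTop (𝓝 Q) := by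
    -- Half of the margin δ j is spent on passing from the gaps to the points of the sequence, whose
    -- heights tend to 0.
    refine tilde_no_limit hK hΨ hc (δ := fun j => δ j / 2) (fun j => half_pos (hδ j)) (fun j => ?_)
      (fun j => ?_) htsum
    · have h1 := abs_le.mp (S.winding_pt hK (hΨ j) 0)
      have h2 := (hΨ j).mem_Icc (potential ν (S.m 0))
      rw [Nat.zero_div, zero_add, Finset.sum_range_one] at h1
      rw [abs_le]
      constructor <;> linarith [h1.1, h1.2, h2.1, h2.2]
    · obtain ⟨a, h1, h2⟩ := hJN j
      have hpot : Tendsto (fun n => 56 * M * |(S.height n : ℝ)|) atTop (𝓝 0) := by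
        simpa using ((S.tendsto_height hsum).abs.const_mul (56 * M))
      filter_upwards [eventually_ge_atTop (2 * (a + (⌈(j * C j : ℝ)⌉₊ + 1))),
        hpot.eventually (gt_mem_nhds (half_pos (hδ j)))] with n hn hn'
      constructor
      · have h3 := abs_le.mp (S.winding_pt hK (hΨ j) n)
        have h4 : ((⌈(j * C j : ℝ)⌉₊ + 1 : ℕ) : ℝ) ≤
            ∑ i ∈ Finset.range (n / 2 + 1), Ψ j (potential ν (S.m i)) := by
          have h5 : ∑ i ∈ Finset.Ico a (a + (⌈(j * C j : ℝ)⌉₊ + 1)),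
              Ψ j (potential ν (S.m i)) = ((⌈(j * C j : ℝ)⌉₊ + 1 : ℕ) : ℝ) := by
            rw [Finset.sum_congr rfl (g := fun _ => (1 : ℝ)) fun i hi => by
              have h6 := h1 i hi
              refine hmid j _ (hm i) ?_ ?_
              · rw [← h6]; exact hpm i
              · rw [← h6]; exact hmp i]
            rw [Finset.sum_const, Nat.card_Ico, Nat.add_sub_cancel_left, nsmul_eq_mul, mul_one]
          rw [← h5]
          refine Finset.sum_le_sum_of_subset_of_nonneg (fun i hi => ?_) fun i _ _ => hterm j i
          rw [Finset.mem_Ico] at hi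
          rw [Finset.mem_range]
          omega
        have h5 := Nat.le_ceil (j * C j : ℝ)
        push_cast at h4
        refine le_trans ?_ (neg_le_abs _)
        linarith [h3.2]
      · have h3 := abs_le.mp (S.abs_potential_pt_sub_le hK n)
        have h4 : j < J (n / 2) := h2 _ (by omega)
        -- Once the block of j is over, all crossings lie to the right of the atom `sepSeq (j + 2)`
        -- that closes window j.
        have h5 := hright j (m (n / 2)) (hm _)
          ((strictMono_sepSeq.monotone (by omega : j + 2 ≤ J (n / 2) + 1)).trans_lt (hpm _))
        have h6 : S.m (n / 2) = m (n / 2) := rfl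
        rw [h6] at h3
        linarith [h3.2]
  refine ⟨not_completeSpace_of_tsum htsum hlimit, 1 / 4, hlim, fun n => S.index ((n + 1) / 2), S.pt,
    fun n => ?_, S.tendsto_proj hsum ?_, htsum, hlimit⟩
  · rw [S.im_pt, S.im_pt, S.height_even, S.height_odd]
    exact ⟨S.h_pos n, neg_lt_zero.mpr (S.h_pos n)⟩
  · exact tendsto_tipSeq.comp (tendsto_atTop_mono (fun l => Nat.le_add_right _ 2) hJlim)

end Tilde

/-! ### The hypotheses for the atomic measure. -/

section Main

theorem quarter_mem_cantorK : (((1 / 4 : ℝ)) : ℂ) ∈ cantorK :=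
  mem_cantorK_of_add_half (by
    convert two_add_div_three_mem_cantorSet quarter_mem_cantorSet using 1; norm_num)

variable {lam : ℕ → ℝ} {x : (k : ℕ) → Fin (2 ^ k) → ℝ}

theorem ae_atomicMeasure_mem_cantorK (hx : IsEndpointEnumeration x) :
    ∀ᵐ t ∂atomicMeasure lam x, t ∈ cantorK :=
  ae_atomicMeasure
    (fun k l => mem_cantorK_of_add_half (stageEndpoints_subset_cantorSet k (hx.mem k l)))
    isClosed_cantorK.measurableSet

theorem atomicMeasure_sepSeq_pos (hpos : ∀ k, 0 < lam k) (hx : IsEndpointEnumeration x)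
    [IsFiniteMeasure (atomicMeasure lam x)] (j : ℕ) :
    0 < (atomicMeasure lam x).real {(sepSeq j : ℂ)} := by
  have h1 := tipSeq_lt_sepSeq j
  have h2 := sepSeq_lt_tipSeq j
  have h3 := tipSeq_lt (j + 1)
  have h4 : tipSeq 0 ≤ tipSeq j := strictMono_tipSeq.monotone (Nat.zero_le j)
  have h5 : tipSeq 0 = -1 / 4 := by norm_num [tipSeq]
  obtain ⟨k, l, h⟩ := hx.exhausts _ _ (sepSeq_mem_stageEndpoints j) (by linarith) (by linarith)
  rw [← add_right_cancel h]
  exact ENNReal.toReal_pos (atomicMeasure_singleton_pos hpos k l).ne' (measure_ne_top _ _)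

end Main

end CantorRiemannium

end

theorem mainTheorem9 (lam : ℕ → ℝ) (hpos : ∀ k, 0 < lam k)
    (hsum : HasSum (fun k => 2 ^ k * lam k) 1)
    (κ : ℝ) (hκ : 3 < κ) (hfast : Summable fun k => lam k * (2 * κ) ^ k)
    (x : (k : ℕ) → Fin (2 ^ k) → ℝ) (hx : CantorRiemannium.IsEndpointEnumeration x)
    (ν : Measure ℂ) (hν : ν = CantorRiemannium.atomicMeasure lam x) :
    (¬ CompleteSpace (CantorRiemannium.HatC ν) ∧
      ∃ a ∈ CantorRiemannium.G₁ ν,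
      ∃ (s : ℕ → List (CantorRiemannium.Angle ν)) (z : ℕ → CantorRiemannium.Omega),
        (∀ n, 0 < (z (2 * n) : ℂ).im ∧ (z (2 * n + 1) : ℂ).im < 0) ∧
        Tendsto (fun n => (z n : ℂ)) atTop (𝓝 (a : ℂ)) ∧
        (∑' n, edist (CantorRiemannium.hatPt ν (s n) (z n))
          (CantorRiemannium.hatPt ν (s (n + 1)) (z (n + 1)))) ≠ ⊤ ∧
        ∀ Q : CantorRiemannium.HatC ν,
          ¬ Tendsto (fun n => CantorRiemannium.hatPt ν (s n) (z n)) atTop (𝓝 Q)) ∧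
    (¬ CompleteSpace (CantorRiemannium.TildeC ν) ∧
      ∃ a ∈ CantorRiemannium.G₁ ν,
      ∃ (s : ℕ → List (CantorRiemannium.LiftedAngle ν)) (α : ℕ → CantorRiemannium.UnivCover ν),
        (∀ n, 0 < ((α (2 * n)).proj : ℂ).im ∧ ((α (2 * n + 1)).proj : ℂ).im < 0) ∧
        Tendsto (fun n => ((α n).proj : ℂ)) atTop (𝓝 (a : ℂ)) ∧
        (∑' n, edist (CantorRiemannium.tildePt ν (s n) (α n))
          (CantorRiemannium.tildePt ν (s (n + 1)) (α (n + 1)))) ≠ ⊤ ∧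
        ∀ Q : CantorRiemannium.TildeC ν,
          ¬ Tendsto (fun n => CantorRiemannium.tildePt ν (s n) (α n)) atTop (𝓝 Q)) := by
  subst hν
  have := CantorRiemannium.isFiniteMeasure_atomicMeasure (x := x) hsum
  have hK := CantorRiemannium.ae_atomicMeasure_mem_cantorK (lam := lam) hx
  obtain ⟨M, hM⟩ := CantorRiemannium.exists_nice hpos hκ hfast hx
  have hlim := (hM _ CantorRiemannium.quarter_mem_cantorK fun k e he =>
    CantorRiemannium.quarter_nice k he).mem_G₁ hK
  have htip := fun j => hM _ (CantorRiemannium.mem_cantorK_of_add_half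
    (CantorRiemannium.tipSeq_mem_cantorSet j)) fun k e he => CantorRiemannium.tipSeq_nice j k he
  have hsep := CantorRiemannium.atomicMeasure_sepSeq_pos hpos hx
  exact ⟨CantorRiemannium.hat_incomplete hK htip hsep hlim,
    CantorRiemannium.tilde_incomplete hK htip hsep hlim⟩
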